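/- Let $\alpha,\beta,\gamma>0$ be fixed real numbers. For positive integers $H,M,N$, real numbers $X>1$ and $\delta>0$, and complex numbers $a(h,m)$, $b(n)$ with $|a(h,m)|\le 1$ and $|b(n)|\le 1$, put $$S_\delta(H,M,N)=\sum_{H<h\le 2H}\ \sum_{M<m\le 2M}\ \sum_{N<n\le 2N}a(h,m)\,b(n)\,e\!\left(X\,\frac{M^\beta N^\gamma}{H^\alpha}\,\frac{h^\alpha}{m^\beta n^\gamma+\delta}\right),\qquad e(t)=e^{2\pi i t}.$$ Then for every $\epsilon>0$ there is a constant $C>0$, depending only on $\alpha,\beta,\gamma$ and $\epsilon$, such that for all such $H,M,N,X,\delta,a,b$ and every real $K\ge 1$ with $X\le (8\delta)^{-1}KM^{\beta}N^{\gamma}$, $$|S_\delta(H,M,N)|\le C\,(HMN)^{1+\epsilon}\left(\Big(\frac{KX}{HMN^{2}}\Big)^{1/4}+\Big(\frac{K^2}{HM}\Big)^{1/4}+\Big(\frac{K}{N}\Big)^{1/2}+\frac{K}{X^{1/2}}\right).$$ -/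

import Mathlib

/-- The additive character `e(t) = exp(2πit)` of the real line. -/
noncomputable def addExp (t : ℝ) : ℂ :=
  Complex.exp (2 * (Real.pi : ℂ) * Complex.I * (t : ℂ))

/-- The perturbed trilinear sum `S_δ(H,M,N)`; `h ∼ H` means `H < h ≤ 2H`, and likewise for
`m ∼ M` and `n ∼ N`. -/
noncomputable def perturbedSum (α β γ δ X : ℝ) (a : ℕ → ℕ → ℂ) (b : ℕ → ℂ) (H M N : ℕ) : ℂ :=
  ∑ h ∈ Finset.Ioc H (2 * H), ∑ m ∈ Finset.Ioc M (2 * M), ∑ n ∈ Finset.Ioc N (2 * N),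
    a h m * b n *
      addExp (X * ((M : ℝ) ^ β * (N : ℝ) ^ γ / (H : ℝ) ^ α) *
        ((h : ℝ) ^ α / ((m : ℝ) ^ β * (n : ℝ) ^ γ + δ)))

open MeasureTheory

/-! Put `x = (h/H)^α (M/m)^β`, `v = (N/n)^γ` and `σ = δ / (M^β N^γ)`. The phase is `X x v` plus a
correction `G` that is nonlinear in `v`. The condition on `X` says exactly `8 σ X ≤ K`, so `G` moves
by a bounded amount when `v` moves by `1/K`. Group the `n` into at most `2K` cells according to `⌊K
v⌋` and replace `v` in `G` by the endpoint of its cell. The replaced value depends only on `(h, m)`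
and the cell, so it is a harmless unimodular weight. The remaining difference is a power series in
`σ` whose terms are products of a function of `(h, m)` and a function of `n`, with coefficients
summable uniformly in all parameters. Its exponential can therefore be removed at the cost of a
constant (`exists_isMultiplier_perturbed_phase`).

The sum left over is bilinear with phase `X x v` and cell-dependent weights (`exists_cell_sum_le`).
The tool is the double large sieve (`exists_double_large_sieve`): a bilinear form with phase `x y`
is bounded by the numbers of close pairs among the `x` and among the `y`. For `X ≤ HM` it is applied
inside each cell, which gives the terms `K/N` and `K^2/X` under square roots. For `X ≥ HM` Cauchy's
inequality first squares out the sum over `n` inside a cell, and the sieve is applied to `x` against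
the differences `v - v'`, which gives the fourth roots. If `K ≥ X^(1/2)` the trivial bound suffices.

Three spacing estimates feed the sieve. For the powers `v` spacing is elementary. For the monomials
`x` the pairs are sorted by `gcd(h, h')` and `gcd(m, m')`: fractions with a common gcd are well
separated (`exists_monomial_count_le`). The deep one counts quadruples with `v₁ - v₂` close to `v₃ -
v₄`, with bound `N^(2+ε)` at scale `N^(-2)` (`exists_quadruple_count_le`).

That count is equivalent to a fourth moment over `x ≪ N^2` of an exponential sum of length `N` with
phase `x (n/N)^α / α`. For `x ≍ T`, Poisson summation and stationary phase turn it into a sum of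
length `≍ T/N` with exponent `α/(α-1)`. Hence the count at length `N` is controlled by counts for
the dual exponent at lengths below `N`, once `T` is at most `N^2 / 2^w` with `w` a large constant.
Each step loses a constant and gains `2^(-εw)`, so induction on the dyadic length closes for an
exponent and its dual simultaneously (`exists_quadCount_le`). -/

theorem addExp_add (s t : ℝ) : addExp (s + t) = addExp s * addExp t := by
  rw [addExp, addExp, addExp, ← Complex.exp_add]; push_cast; ring_nf

theorem addExp_eq (t : ℝ) : addExp t = Complex.exp (((2 * Real.pi * t : ℝ) : ℂ) * Complex.I) := by
  rw [addExp]; push_cast; ring_nf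

theorem norm_addExp (t : ℝ) : ‖addExp t‖ = 1 := by
  rw [addExp_eq, Complex.norm_exp_ofReal_mul_I]

theorem conj_addExp (t : ℝ) : (starRingEnd ℂ) (addExp t) = addExp (-t) := by
  rw [addExp_eq, addExp_eq, ← Complex.exp_conj]; simp [-Complex.ofReal_mul, neg_mul]

theorem addExp_sub (s t : ℝ) : addExp (s - t) = addExp s * (starRingEnd ℂ) (addExp t) := by
  rw [conj_addExp, ← addExp_add, sub_eq_add_neg]

theorem continuous_addExp : Continuous addExp := by unfold addExp; fun_prop

theorem hasDerivAt_addExp (t : ℝ) :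
    HasDerivAt addExp (2 * (Real.pi : ℂ) * Complex.I * addExp t) t := by
  have h : HasDerivAt (fun t : ℝ => 2 * (Real.pi : ℂ) * Complex.I * (t : ℂ))
      (2 * (Real.pi : ℂ) * Complex.I * 1) t :=
    (Complex.ofRealCLM.hasDerivAt (x := t)).const_mul _
  have := h.cexp
  unfold addExp
  convert this using 1
  ring

/-! ### Counting close pairs of real numbers -/

/-- The number of pairs of indices in `s` whose values under `f` differ by at most `η`. -/
noncomputable def closeCount {ι : Type*} (s : Finset ι) (f : ι → ℝ) (η : ℝ) : ℕ := by
  classical exact ((s ×ˢ s).filter fun p => |f p.1 - f p.2| ≤ η).card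

section closeCount
variable {ι : Type*} (s : Finset ι) (f : ι → ℝ)

theorem closeCount_eq_sum (η : ℝ) :
    (closeCount s f η : ℝ) = ∑ p ∈ s, ∑ q ∈ s, if |f p - f q| ≤ η then 1 else 0 := by
  classical
  rw [closeCount, Finset.card_filter, Finset.sum_product]
  push_cast
  refine Finset.sum_congr rfl fun p _ => Finset.sum_congr rfl fun q _ => ?_
  split_ifs <;> rfl

theorem closeCount_mono {η θ : ℝ} (h : η ≤ θ) : closeCount s f η ≤ closeCount s f θ := by
  classical
  unfold closeCount
  exact Finset.card_le_card fun p hp => by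
    simp only [Finset.mem_filter] at hp ⊢
    exact ⟨hp.1, hp.2.trans h⟩

theorem closeCount_mono_set {s t : Finset ι} (h : s ⊆ t) (η : ℝ) :
    closeCount s f η ≤ closeCount t f η := by
  classical
  unfold closeCount
  exact Finset.card_le_card (Finset.filter_subset_filter _ (Finset.product_subset_product h h))

theorem closeCount_mul {c : ℝ} (hc : 0 < c) (η : ℝ) :
    closeCount s (fun p => c * f p) (c * η) = closeCount s f η := by
  classical
  unfold closeCount
  congr 1
  refine Finset.filter_congr fun p _ => ?_
  rw [← mul_sub, abs_mul, abs_of_pos hc, mul_le_mul_iff_right₀ hc]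

theorem closeCount_le_sq (η : ℝ) : (closeCount s f η : ℝ) ≤ (s.card : ℝ) ^ 2 := by
  classical
  unfold closeCount
  calc _ ≤ (((s ×ˢ s).card : ℕ) : ℝ) := by exact_mod_cast Finset.card_filter_le _ _
    _ = _ := by rw [Finset.card_product]; push_cast; ring

/-- Pairs with prescribed difference of integer parts are at most as many as the close pairs. -/
theorem sum_floor_sub_eq_le (d : ℤ) :
    (∑ p ∈ s, ∑ q ∈ s, if ⌊f p⌋ - ⌊f q⌋ = d then (1 : ℝ) else 0) ≤ closeCount s f 1 := by
  classical
  set T : Finset ℤ := s.image (fun p => ⌊f p⌋) ∪ s.image (fun p => ⌊f p⌋ - d) with hT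
  -- `B i` counts the points in the unit cell starting at `i`. The sum is the correlation of `B`
  -- with its shift by `d`, at most the sum of squares of `B` by the arithmetic-geometric mean
  -- inequality, and two points of one cell are within distance 1.
  set B : ℤ → ℝ := fun i => ∑ p ∈ s, if ⌊f p⌋ = i then (1 : ℝ) else 0 with hB
  have h1 : (∑ p ∈ s, ∑ q ∈ s, if ⌊f p⌋ - ⌊f q⌋ = d then (1 : ℝ) else 0)
      = ∑ i ∈ T, B (i + d) * B i := by
    simp only [hB, Finset.sum_mul_sum]
    rw [Finset.sum_comm]
    conv_rhs => rw [Finset.sum_comm]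
    rw [Finset.sum_comm]
    refine Finset.sum_congr rfl fun p hp => ?_
    rw [Finset.sum_comm]
    refine Finset.sum_congr rfl fun q hq => ?_
    rw [Finset.sum_eq_single ⌊f q⌋]
    · by_cases h : ⌊f p⌋ - ⌊f q⌋ = d
      · rw [if_pos h, if_pos (by omega), if_pos rfl, mul_one]
      · rw [if_neg h, if_neg (by omega), zero_mul]
    · intro i _ hi
      rw [if_neg (Ne.symm hi), mul_zero]
    · intro h
      exact absurd (Finset.mem_union_left _ (Finset.mem_image_of_mem _ hq)) h
  have h2 : ∀ c : ℤ, ∑ i ∈ T, B (i + c) ^ 2 ≤ closeCount s f 1 := by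
    intro c
    rw [closeCount_eq_sum]
    have : ∑ i ∈ T, B (i + c) ^ 2
        = ∑ p ∈ s, ∑ q ∈ s, ∑ i ∈ T, (if ⌊f p⌋ = i + c then (1 : ℝ) else 0) *
            (if ⌊f q⌋ = i + c then (1 : ℝ) else 0) := by
      simp only [hB, sq, Finset.sum_mul_sum]
      rw [Finset.sum_comm]
      refine Finset.sum_congr rfl fun p _ => ?_
      rw [Finset.sum_comm]
    rw [this]
    refine Finset.sum_le_sum fun p _ => Finset.sum_le_sum fun q _ => ?_
    by_cases h : ⌊f p⌋ = ⌊f q⌋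
    · rw [if_pos (Int.abs_sub_lt_one_of_floor_eq_floor h).le]
      calc _ ≤ ∑ i ∈ T, if i = ⌊f p⌋ - c then (1 : ℝ) else 0 := by
            refine Finset.sum_le_sum fun i _ => ?_
            by_cases h' : ⌊f p⌋ = i + c
            · rw [if_pos h', if_pos (by omega), if_pos (by omega), mul_one]
            · rw [if_neg h', zero_mul]; split_ifs <;> norm_num
        _ ≤ 1 := by rw [Finset.sum_ite_eq' T]; split_ifs <;> norm_num
    · rw [Finset.sum_eq_zero]
      · split_ifs <;> norm_num
      · intro i _
        by_cases h' : ⌊f p⌋ = i + c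
        · rw [if_neg (show ¬ ⌊f q⌋ = i + c by omega), mul_zero]
        · rw [if_neg h', zero_mul]
  rw [h1]
  have h3 : ∑ i ∈ T, B (i + d) * B i ≤ ∑ i ∈ T, (B (i + d) ^ 2 + B (i + 0) ^ 2) / 2 := by
    refine Finset.sum_le_sum fun i _ => ?_
    rw [add_zero]
    nlinarith [sq_nonneg (B (i + d) - B i)]
  rw [← Finset.sum_div, Finset.sum_add_distrib] at h3
  linarith [h2 d, h2 0]

/-- Each value of the difference of integer parts is taken by at most `closeCount s f 1` pairs, so a
kernel majorised by a summable function of that difference costs only its total mass. -/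
theorem sum_kernel_le_closeCount (k : ℤ → ℝ) (hk : ∀ d, 0 ≤ k d) (hs : Summable k)
    (κ : ℝ → ℝ) (hκ : ∀ x y : ℝ, κ (x - y) ≤ k (⌊x⌋ - ⌊y⌋)) :
    ∑ p ∈ s, ∑ q ∈ s, κ (f p - f q) ≤ (∑' d, k d) * closeCount s f 1 := by
  classical
  set D : Finset ℤ := (s ×ˢ s).image (fun p => ⌊f p.1⌋ - ⌊f p.2⌋) with hD
  calc ∑ p ∈ s, ∑ q ∈ s, κ (f p - f q)
      ≤ ∑ p ∈ s, ∑ q ∈ s, ∑ d ∈ D, k d * (if ⌊f p⌋ - ⌊f q⌋ = d then (1 : ℝ) else 0) := by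
        refine Finset.sum_le_sum fun p hp => Finset.sum_le_sum fun q hq => ?_
        rw [Finset.sum_eq_single (⌊f p⌋ - ⌊f q⌋)]
        · rw [if_pos rfl, mul_one]; exact hκ _ _
        · intro d _ hd; rw [if_neg (Ne.symm hd), mul_zero]
        · intro h
          exact absurd (Finset.mem_image_of_mem (fun p : ι × ι => ⌊f p.1⌋ - ⌊f p.2⌋)
            (Finset.mk_mem_product hp hq)) h
    _ = ∑ d ∈ D, k d * ∑ p ∈ s, ∑ q ∈ s, (if ⌊f p⌋ - ⌊f q⌋ = d then (1 : ℝ) else 0) := by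
        simp only [Finset.mul_sum]
        rw [Finset.sum_comm]
        conv_rhs => rw [Finset.sum_comm]
        rw [Finset.sum_comm]
        refine Finset.sum_congr rfl fun p _ => ?_
        rw [Finset.sum_comm]
    _ ≤ ∑ d ∈ D, k d * closeCount s f 1 :=
        Finset.sum_le_sum fun d _ => mul_le_mul_of_nonneg_left (sum_floor_sub_eq_le s f d) (hk d)
    _ = (∑ d ∈ D, k d) * closeCount s f 1 := by rw [Finset.sum_mul]
    _ ≤ _ := mul_le_mul_of_nonneg_right (hs.sum_le_tsum D fun d _ => hk d) (by positivity)

/-- Points within `t` have integer parts differing by at most `⌊t⌋ + 1` in absolute value, which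
leaves `2⌊t⌋ + 3` differences. -/
theorem closeCount_le_mul_one {t : ℝ} (ht : 0 ≤ t) :
    (closeCount s f t : ℝ) ≤ (2 * t + 3) * closeCount s f 1 := by
  classical
  rw [closeCount_eq_sum]
  set k : ℤ → ℝ := fun d => if |d| ≤ ⌊t⌋ + 1 then 1 else 0 with hk
  have hfin : ∀ d ∉ Finset.Icc (-(⌊t⌋ + 1)) (⌊t⌋ + 1), k d = 0 := by
    intro d hd
    rw [hk]; simp only
    rw [if_neg]
    rwa [Finset.mem_Icc, ← abs_le] at hd
  have hfl : 0 ≤ ⌊t⌋ := Int.floor_nonneg.2 ht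
  have := sum_kernel_le_closeCount s f k (fun d => by rw [hk]; simp only; split_ifs <;> norm_num)
    (summable_of_ne_finset_zero hfin) (fun x => if |x| ≤ t then 1 else 0) (by
      intro x y
      by_cases h : |x - y| ≤ t
      · simp only [hk]
        rw [if_pos h, if_pos]
        rw [abs_le] at h ⊢
        have h1 := Int.floor_le x
        have h2 := Int.lt_floor_add_one x
        have h3 := Int.floor_le y
        have h4 := Int.lt_floor_add_one y
        have h5 := Int.lt_floor_add_one t
        constructor
        · have : ((-(⌊t⌋ + 1) - 1 : ℤ) : ℝ) < ((⌊x⌋ - ⌊y⌋ : ℤ) : ℝ) := by push_cast; linarith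
          have := Int.cast_lt.1 this; omega
        · have : ((⌊x⌋ - ⌊y⌋ : ℤ) : ℝ) < ((⌊t⌋ + 1 + 1 : ℤ) : ℝ) := by push_cast; linarith
          have := Int.cast_lt.1 this; omega
      · simp only [hk]; rw [if_neg h]; split_ifs <;> norm_num)
  refine this.trans (mul_le_mul_of_nonneg_right ?_ (by positivity))
  rw [tsum_eq_sum hfin]
  calc ∑ d ∈ Finset.Icc (-(⌊t⌋ + 1)) (⌊t⌋ + 1), k d
      ≤ ∑ d ∈ Finset.Icc (-(⌊t⌋ + 1)) (⌊t⌋ + 1), 1 :=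
        Finset.sum_le_sum fun d _ => by rw [hk]; simp only; split_ifs <;> norm_num
    _ = (((⌊t⌋ + 1 + 1 - (-(⌊t⌋ + 1))).toNat : ℕ) : ℝ) := by
        rw [Finset.sum_const, Int.card_Icc]; simp
    _ = ((2 * ⌊t⌋ + 3 : ℤ) : ℝ) := by
        rw [← Int.cast_natCast, Int.toNat_of_nonneg (by omega)]; congr 1; ring
    _ ≤ _ := by push_cast; linarith [Int.floor_le t]

theorem closeCount_le_mul {η t : ℝ} (hη : 0 < η) (ht : 0 ≤ t) :
    (closeCount s f (t * η) : ℝ) ≤ (2 * t + 3) * closeCount s f η := by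
  have h := closeCount_le_mul_one s (fun p => η⁻¹ * f p) ht
  have h1 := closeCount_mul s f (inv_pos.2 hη) (t * η)
  have h2 := closeCount_mul s f (inv_pos.2 hη) η
  rw [show η⁻¹ * (t * η) = t by field_simp] at h1
  rw [inv_mul_cancel₀ hη.ne'] at h2
  rwa [h1, h2] at h

theorem exists_sum_exp_le_closeCount {c : ℝ} (hc : 0 < c) :
    ∃ C : ℝ, 0 < C ∧ ∀ {ι : Type} (s : Finset ι) (f : ι → ℝ),
      ∑ p ∈ s, ∑ q ∈ s, Real.exp (-c * (f p - f q) ^ 2) ≤ C * closeCount s f 1 := by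
  -- With `d` the difference of floors, `d^2 ≤ 2 x^2 + 2`. Combined with `exp (-c x^2) ≤ 1 / (1 + c
  -- x^2)`, the factor `3 + 2/c` makes the quotient a majorant.
  set k : ℤ → ℝ := fun d => (3 + 2 / c) / (1 + (d : ℝ) ^ 2) with hk
  have hpos : ∀ d, 0 ≤ k d := fun d => by rw [hk]; positivity
  have hs : Summable k := by
    have h0 : Summable fun n : ℤ => 1 / (n : ℝ) ^ 2 := Real.summable_one_div_int_pow.2 one_lt_two
    have : Summable fun d : ℤ => 1 / (1 + (d : ℝ) ^ 2) := by
      refine Summable.of_norm_bounded_eventually (g := fun n : ℤ => 1 / (n : ℝ) ^ 2) h0 ?_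
      refine (Set.finite_singleton (0 : ℤ)).subset fun d hd => ?_
      by_contra h0
      apply hd
      have : (0 : ℝ) < (d : ℝ) ^ 2 := by
        have : (d : ℝ) ≠ 0 := Int.cast_ne_zero.2 h0
        positivity
      change ‖1 / (1 + (d : ℝ) ^ 2)‖ ≤ 1 / (d : ℝ) ^ 2
      rw [Real.norm_of_nonneg (by positivity)]
      exact one_div_le_one_div_of_le this (by linarith)
    simpa [hk, div_eq_mul_inv] using this.mul_left (3 + 2 / c)
  refine ⟨∑' d, k d, hs.tsum_pos hpos 0 (by rw [hk]; positivity), ?_⟩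
  intro ι s f
  refine sum_kernel_le_closeCount s f k hpos hs (fun x => Real.exp (-c * x ^ 2)) ?_
  intro x y
  have h1 := Int.floor_le x
  have h2 := Int.lt_floor_add_one x
  have h3 := Int.floor_le y
  have h4 := Int.lt_floor_add_one y
  have h5 : (((⌊x⌋ - ⌊y⌋ : ℤ) : ℝ)) ^ 2 ≤ 2 * (x - y) ^ 2 + 2 := by
    push_cast
    set u : ℝ := (⌊x⌋ : ℝ) - ⌊y⌋ - (x - y) with hu
    have : u ^ 2 ≤ 1 := by rw [sq_le_one_iff_abs_le_one, abs_le]; constructor <;> linarith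
    nlinarith [sq_nonneg (u - (x - y))]
  have h6 : Real.exp (-c * (x - y) ^ 2) ≤ 1 / (1 + c * (x - y) ^ 2) := by
    rw [neg_mul, Real.exp_neg, one_div]
    exact inv_anti₀ (by positivity) (by linarith [Real.add_one_le_exp (c * (x - y) ^ 2)])
  refine h6.trans ?_
  simp only [hk]
  rw [div_le_div_iff₀ (by positivity) (by positivity)]
  have : (3 + 2 / c) * (1 + c * (x - y) ^ 2) =
    3 + 2 / c + 3 * c * (x - y) ^ 2 + 2 * (x - y) ^ 2 := by field_simp; ring
  rw [this]
  have : 0 ≤ 2 / c := by positivity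
  have : 0 ≤ c * (x - y) ^ 2 := by positivity
  linarith

end closeCount

/-! ### Mean squares of exponential polynomials and close frequencies -/

theorem norm_sq_sum_mul_addExp {ι : Type*} (s : Finset ι) (b : ι → ℂ) (f : ι → ℝ) :
    ((‖∑ p ∈ s, b p * addExp (f p)‖ ^ 2 : ℝ) : ℂ)
      = ∑ p ∈ s, ∑ q ∈ s, b p * (starRingEnd ℂ) (b q) * addExp (f p - f q) := by
  push_cast
  rw [← Complex.mul_conj', map_sum, Finset.sum_mul_sum]
  refine Finset.sum_congr rfl fun p _ => Finset.sum_congr rfl fun q _ => ?_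
  rw [addExp_sub, map_mul]; ring

theorem integral_gaussian_mul_addExp {c : ℝ} (hc : 0 < c) (y : ℝ) :
    ∫ t : ℝ, (Real.exp (-c * t ^ 2) : ℂ) * addExp (t * y)
      = ((Real.sqrt (Real.pi / c) * Real.exp (-(Real.pi ^ 2 / c) * y ^ 2) : ℝ) : ℂ) := by
  have h := integral_cexp_quadratic (b := ((-c : ℝ) : ℂ)) (by simpa using hc)
    (2 * Real.pi * Complex.I * y) 0
  have h1 : ∀ t : ℝ, (Real.exp (-c * t ^ 2) : ℂ) * addExp (t * y)
      = Complex.exp (((-c : ℝ) : ℂ) * t ^ 2 + 2 * Real.pi * Complex.I * y * t + 0) := by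
    intro t
    rw [addExp, Complex.ofReal_exp, ← Complex.exp_add]; push_cast; ring_nf
  simp_rw [h1]
  rw [h]
  rw [show (Real.pi / -(((-c : ℝ) : ℂ))) = ((Real.pi / c : ℝ) : ℂ) by push_cast; ring,
    show (1 / 2 : ℂ) = ((1 / 2 : ℝ) : ℂ) by push_cast; ring,
    ← Complex.ofReal_cpow (by positivity), ← Real.sqrt_eq_rpow]
  rw [Complex.ofReal_mul, Complex.ofReal_exp]
  congr 2
  have : (c : ℂ) ≠ 0 := by exact_mod_cast hc.ne'
  have hI := Complex.I_sq
  push_cast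
  field_simp
  ring_nf
  rw [hI]; ring

theorem integrable_gaussian_mul_addExp {c : ℝ} (hc : 0 < c) (y : ℝ) :
    Integrable fun t : ℝ => (Real.exp (-c * t ^ 2) : ℂ) * addExp (t * y) := by
  refine (integrable_exp_neg_mul_sq hc).mono' (Continuous.aestronglyMeasurable ?_) ?_
  · have := continuous_addExp
    fun_prop
  · refine Filter.Eventually.of_forall fun t => ?_
    rw [norm_mul, norm_addExp, mul_one, Complex.norm_real, Real.norm_of_nonneg (Real.exp_pos _).le]

/-- Gaussian mean square of an exponential polynomial. -/
theorem integral_gaussian_mul_norm_sq_le {ι : Type*} (s : Finset ι) (b : ι → ℂ) (f : ι → ℝ)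
    {B c : ℝ} (hb : ∀ p ∈ s, ‖b p‖ ≤ B) (hc : 0 < c) :
    ∫ t : ℝ, Real.exp (-c * t ^ 2) * ‖∑ p ∈ s, b p * addExp (t * f p)‖ ^ 2
      ≤ B ^ 2 * Real.sqrt (Real.pi / c) *
        ∑ p ∈ s, ∑ q ∈ s, Real.exp (-(Real.pi ^ 2 / c) * (f p - f q) ^ 2) := by
  have h1 : ∀ t : ℝ, ((Real.exp (-c * t ^ 2) * ‖∑ p ∈ s, b p * addExp (t * f p)‖ ^ 2 : ℝ) : ℂ)
      = ∑ p ∈ s, ∑ q ∈ s, b p * (starRingEnd ℂ) (b q) *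
        ((Real.exp (-c * t ^ 2) : ℂ) * addExp (t * (f p - f q))) := by
    intro t
    rw [Complex.ofReal_mul, norm_sq_sum_mul_addExp, Finset.mul_sum]
    refine Finset.sum_congr rfl fun p _ => ?_
    rw [Finset.mul_sum]
    refine Finset.sum_congr rfl fun q _ => ?_
    rw [mul_sub]; ring
  have h2 : ((∫ t : ℝ, Real.exp (-c * t ^ 2) * ‖∑ p ∈ s, b p * addExp (t * f p)‖ ^ 2 : ℝ) : ℂ)
      = ∑ p ∈ s, ∑ q ∈ s, b p * (starRingEnd ℂ) (b q) *
        ((Real.sqrt (Real.pi / c) * Real.exp (-(Real.pi ^ 2 / c) * (f p - f q) ^ 2) : ℝ) : ℂ) := by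
    rw [← integral_complex_ofReal]
    simp_rw [h1]
    rw [integral_finsetSum]
    · refine Finset.sum_congr rfl fun p _ => ?_
      rw [integral_finsetSum]
      · refine Finset.sum_congr rfl fun q _ => ?_
        rw [integral_const_mul, integral_gaussian_mul_addExp hc]
      · exact fun q _ => (integrable_gaussian_mul_addExp hc _).const_mul _
    · exact fun p _ => integrable_finsetSum _ fun q _ =>
        (integrable_gaussian_mul_addExp hc _).const_mul _
  have h3 := le_abs_self (∫ t : ℝ, Real.exp (-c * t ^ 2) * ‖∑ p ∈ s, b p * addExp (t * f p)‖ ^ 2)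
  rw [← Real.norm_eq_abs, ← Complex.norm_real, h2] at h3
  refine h3.trans ?_
  rw [Finset.mul_sum]
  refine norm_sum_le_of_le _ fun p hp => ?_
  rw [Finset.mul_sum]
  refine norm_sum_le_of_le _ fun q hq => ?_
  have hB : 0 ≤ B := (norm_nonneg _).trans (hb p hp)
  rw [norm_mul, norm_mul, RCLike.norm_conj, Complex.norm_real, Real.norm_of_nonneg (by positivity)]
  have : ‖b p‖ * ‖b q‖ ≤ B ^ 2 := by
    rw [sq]; exact mul_le_mul (hb p hp) (hb q hq) (norm_nonneg _) hB
  calc _ ≤ B ^ 2 * (Real.sqrt (Real.pi / c) *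
        Real.exp (-(Real.pi ^ 2 / c) * (f p - f q) ^ 2)) := by gcongr
    _ = _ := by ring

theorem norm_sum_mul_addExp_le {ι : Type*} (s : Finset ι) (b : ι → ℂ) (f : ι → ℝ) :
    ‖∑ p ∈ s, b p * addExp (f p)‖ ≤ ∑ p ∈ s, ‖b p‖ :=
  norm_sum_le_of_le _ fun p _ => by rw [norm_mul, norm_addExp, mul_one]

theorem continuous_sum_mul_addExp {ι : Type*} (s : Finset ι) (b : ι → ℂ) (f : ι → ℝ) :
    Continuous fun t : ℝ => ∑ p ∈ s, b p * addExp (t * f p) := by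
  have := continuous_addExp
  fun_prop

theorem integrable_gaussian_mul_norm_sq {ι : Type*} (s : Finset ι) (b : ι → ℂ) (f : ι → ℝ)
    {c : ℝ} (hc : 0 < c) :
    Integrable fun t : ℝ => Real.exp (-c * t ^ 2) * ‖∑ p ∈ s, b p * addExp (t * f p)‖ ^ 2 := by
  refine ((integrable_exp_neg_mul_sq hc).mul_const ((∑ p ∈ s, ‖b p‖) ^ 2)).mono'
    (Continuous.aestronglyMeasurable ?_) ?_
  · have := continuous_sum_mul_addExp s b f
    fun_prop
  · refine Filter.Eventually.of_forall fun t => ?_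
    rw [Real.norm_of_nonneg (by positivity)]
    gcongr
    exact norm_sum_mul_addExp_le s b _

/-- The weight of width `R` has as Fourier transform a Gaussian of height `R` and width `1/R`, so
only pairs of frequencies at that scale contribute. -/
theorem exists_gaussian_mean_square_le :
    ∃ C : ℝ, 0 < C ∧ ∀ {ι : Type} (s : Finset ι) (b : ι → ℂ) (f : ι → ℝ) {B R : ℝ},
      (∀ p ∈ s, ‖b p‖ ≤ B) → 0 < R →
      ∫ t : ℝ, Real.exp (-(Real.pi / R ^ 2) * t ^ 2) * ‖∑ p ∈ s, b p * addExp (t * f p)‖ ^ 2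
        ≤ C * B ^ 2 * R * closeCount s f (1 / R) := by
  obtain ⟨C, hC, h⟩ := exists_sum_exp_le_closeCount Real.pi_pos
  refine ⟨C, hC, fun {ι} s b f {B R} hb hR => ?_⟩
  refine (integral_gaussian_mul_norm_sq_le s b f hb (by positivity)).trans ?_
  have h1 := h s (fun p => R * f p)
  have h2 := closeCount_mul s f hR (1 / R)
  rw [mul_one_div_cancel hR.ne'] at h2
  rw [h2] at h1
  have h3 : Real.sqrt (Real.pi / (Real.pi / R ^ 2)) = R := by
    rw [div_div_cancel₀ Real.pi_ne_zero, Real.sqrt_sq hR.le]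
  rw [h3]
  have h4 : ∀ p q, Real.exp (-(Real.pi ^ 2 / (Real.pi / R ^ 2)) * (f p - f q) ^ 2)
      = Real.exp (-Real.pi * (R * f p - R * f q) ^ 2) := by
    intro p q
    congr 1
    field_simp
  simp_rw [h4]
  calc _ ≤ B ^ 2 * R * (C * closeCount s f (1 / R)) := by gcongr
    _ = _ := by ring

/-- Mean square over a finite interval, bounded by the number of close pairs of frequencies. -/
theorem exists_mean_square_le :
    ∃ C : ℝ, 0 < C ∧ ∀ {ι : Type} (s : Finset ι) (b : ι → ℂ) (f : ι → ℝ) {B R : ℝ},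
      (∀ p ∈ s, ‖b p‖ ≤ B) → 0 < R →
      ∫ t in (0 : ℝ)..R, ‖∑ p ∈ s, b p * addExp (t * f p)‖ ^ 2
        ≤ C * B ^ 2 * R * closeCount s f (1 / R) := by
  obtain ⟨C, hC, h⟩ := exists_gaussian_mean_square_le
  refine ⟨Real.exp Real.pi * C, by positivity, fun {ι} s b f {B R} hb hR => ?_⟩
  have h1 := h s b f hb hR
  have hint := integrable_gaussian_mul_norm_sq s b f (c := Real.pi / R ^ 2) (by positivity)
  calc ∫ t in (0 : ℝ)..R, ‖∑ p ∈ s, b p * addExp (t * f p)‖ ^ 2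
      ≤ ∫ t in (0 : ℝ)..R, Real.exp Real.pi * (Real.exp (-(Real.pi / R ^ 2) * t ^ 2) *
          ‖∑ p ∈ s, b p * addExp (t * f p)‖ ^ 2) := by
        refine intervalIntegral.integral_mono_on hR.le ?_ ?_ ?_
        · exact ((continuous_sum_mul_addExp s b f).norm.pow 2).intervalIntegrable _ _
        · exact (hint.const_mul _).intervalIntegrable
        · intro t ht
          -- On `[0, R]` the Gaussian weight is at least `exp (-π)`, which is the price of the sharp
          -- cutoff.
          rw [← mul_assoc, ← Real.exp_add]
          refine le_mul_of_one_le_left (by positivity) (Real.one_le_exp ?_)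
          have : t ^ 2 / R ^ 2 ≤ 1 := by
            rw [div_le_one (by positivity)]
            exact pow_le_pow_left₀ ht.1 ht.2 2
          have h5 : Real.pi / R ^ 2 * t ^ 2 = Real.pi * (t ^ 2 / R ^ 2) := by ring
          rw [neg_mul, h5]
          nlinarith [Real.pi_pos]
    _ = Real.exp Real.pi * ∫ t in (0 : ℝ)..R, (Real.exp (-(Real.pi / R ^ 2) * t ^ 2) *
          ‖∑ p ∈ s, b p * addExp (t * f p)‖ ^ 2) := intervalIntegral.integral_const_mul _ _
    _ ≤ Real.exp Real.pi * (C * B ^ 2 * R * closeCount s f (1 / R)) := by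
        refine mul_le_mul_of_nonneg_left (le_trans ?_ h1) (by positivity)
        rw [intervalIntegral.integral_of_le hR.le]
        exact setIntegral_le_integral hint (Filter.Eventually.of_forall fun t => by positivity)
    _ = _ := by ring

/-- Centring the interval at `1/2` does not change the modulus. The angle is then at most `π/4 ≤
π/3`, where the cosine is at least `1/2`. -/
theorem one_half_le_norm_integral_addExp {ξ : ℝ} (h : |ξ| ≤ 1 / 4) :
    1 / 2 ≤ ‖∫ y in (0 : ℝ)..1, addExp (y * ξ)‖ := by
  have hc := continuous_addExp
  have h1 : ‖∫ y in (0 : ℝ)..1, addExp (y * ξ)‖ = ‖∫ y in (0 : ℝ)..1, addExp ((y - 1 / 2) * ξ)‖ := by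
    have : ∀ y : ℝ, addExp ((y - 1 / 2) * ξ) = addExp (-(1 / 2) * ξ) * addExp (y * ξ) := by
      intro y; rw [← addExp_add]; congr 1; ring
    simp_rw [this]
    rw [intervalIntegral.integral_const_mul, norm_mul, norm_addExp, one_mul]
  rw [h1]
  refine le_trans ?_ (Complex.re_le_norm _)
  have h2 : (∫ y in (0 : ℝ)..1, addExp ((y - 1 / 2) * ξ)).re
      = ∫ y in (0 : ℝ)..1, (addExp ((y - 1 / 2) * ξ)).re := by
    have := Complex.reCLM.intervalIntegral_comp_comm (a := 0) (b := 1) (μ := volume)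
      (f := fun y : ℝ => addExp ((y - 1 / 2) * ξ))
      (Continuous.intervalIntegrable (by fun_prop) _ _)
    simpa using this.symm
  rw [h2]
  calc (1 / 2 : ℝ) = ∫ y in (0 : ℝ)..1, (1 / 2 : ℝ) := by simp
    _ ≤ _ := by
      refine intervalIntegral.integral_mono_on zero_le_one (by simp) ?_ ?_
      · exact Continuous.intervalIntegrable (by fun_prop) _ _
      · intro y hy
        rw [addExp_eq, Complex.exp_ofReal_mul_I_re]
        have h3 : |2 * Real.pi * ((y - 1 / 2) * ξ)| ≤ Real.pi / 3 := by
          rw [abs_mul (2 * Real.pi), abs_mul (y - 1 / 2), abs_of_pos (by positivity : (0 : ℝ) < 2 * Real.pi)]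
          have : |y - 1 / 2| ≤ 1 / 2 := by rw [abs_le]; constructor <;> linarith [hy.1, hy.2]
          have : |y - 1 / 2| * |ξ| ≤ 1 / 2 * (1 / 4) := by gcongr
          nlinarith [Real.pi_pos]
        rw [← Real.cos_abs]
        refine Real.cos_pi_div_three.symm.le.trans ?_
        exact Real.cos_le_cos_of_nonneg_of_le_pi (abs_nonneg _) (by linarith [Real.pi_pos]) h3

/-- The number of close pairs of frequencies is bounded by a mean square. -/
theorem closeCount_le_mean_square {ι : Type} {s t : Finset ι} (hst : s ⊆ t) (w : ι → ℝ)
    (hw0 : ∀ p ∈ t, 0 ≤ w p) (hw1 : ∀ p ∈ s, 1 ≤ w p) (f : ι → ℝ) {T : ℝ} (hT : 0 < T) :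
    (closeCount s f (1 / (4 * T)) : ℝ)
      ≤ 8 * ∫ y in (0 : ℝ)..1, ‖∑ p ∈ t, (w p : ℂ) * addExp (y * T * f p)‖ ^ 2 := by
  have hc := continuous_addExp
  set h : ℝ → ℝ := fun y => ‖∑ p ∈ t, (w p : ℂ) * addExp (y * T * f p)‖ ^ 2 with hh
  have hcont : Continuous h := by rw [hh]; fun_prop
  have heven : ∀ y, h (-y) = h y := by
    intro y
    simp only [hh]
    congr 1
    rw [← RCLike.norm_conj, map_sum]
    congr 1
    refine Finset.sum_congr rfl fun p _ => ?_
    rw [map_mul, conj_addExp, Complex.conj_ofReal]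
    congr 2; ring
  -- Real weights make `h` even, so any window of length one inside `[-1, 1]` costs at most twice
  -- the integral over `[0, 1]`.
  have h1 : ∀ y' ∈ Set.Icc (0 : ℝ) 1, ∫ y in (0 : ℝ)..1, h (y - y') ≤ 2 * ∫ y in (0 : ℝ)..1, h y := by
    intro y' hy'
    rw [intervalIntegral.integral_comp_sub_right]
    calc ∫ y in (0 - y')..(1 - y'), h y ≤ ∫ y in (-1 : ℝ)..1, h y := by
          refine intervalIntegral.integral_mono_interval ?_ ?_ ?_ ?_ ?_
          · linarith [hy'.2]
          · linarith
          · linarith [hy'.1]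
          · exact Filter.Eventually.of_forall fun y => by simp only [hh]; positivity
          · exact hcont.intervalIntegrable _ _
      _ = (∫ y in (-1 : ℝ)..0, h y) + ∫ y in (0 : ℝ)..1, h y :=
          (intervalIntegral.integral_add_adjacent_intervals (hcont.intervalIntegrable _ _)
            (hcont.intervalIntegrable _ _)).symm
      _ = _ := by
          have : ∫ y in (-1 : ℝ)..0, h y = ∫ y in (0 : ℝ)..1, h y := by
            calc ∫ y in (-1 : ℝ)..0, h y = ∫ y in (-1 : ℝ)..(-0), h (-y) := by
                  simp_rw [heven]; simp
              _ = _ := by rw [intervalIntegral.integral_comp_neg]; simp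
          rw [this]; ring
  have hinner : Continuous fun y' => ∫ y in (0 : ℝ)..1, h (y - y') := by
    refine intervalIntegral.continuous_parametric_intervalIntegral_of_continuous' ?_ _ _
    fun_prop
  have h2 : ∫ y' in (0 : ℝ)..1, ∫ y in (0 : ℝ)..1, h (y - y') ≤ 2 * ∫ y in (0 : ℝ)..1, h y := by
    calc _ ≤ ∫ y' in (0 : ℝ)..1, 2 * ∫ y in (0 : ℝ)..1, h y :=
          intervalIntegral.integral_mono_on zero_le_one (hinner.intervalIntegrable _ _)
            (by simp) h1
      _ = _ := by simp
  set I : ℝ → ℂ := fun ξ => ∫ y in (0 : ℝ)..1, addExp (y * ξ) with hI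
  have hIconj : ∀ ξ, ∫ y in (0 : ℝ)..1, addExp (-(y * ξ)) = (starRingEnd ℂ) (I ξ) := by
    intro ξ
    simp_rw [← conj_addExp]
    simp only [hI]
    rw [intervalIntegral.integral_of_le zero_le_one, intervalIntegral.integral_of_le zero_le_one]
    exact integral_conj
  -- Averaging `h (y - y')` over both variables produces the nonnegative kernel `‖I ξ‖^2`. Hence far
  -- pairs may be dropped, while close pairs count at least `1/4`; with the factor 2 above this is
  -- the constant 8.
  have h3 : ((∫ y' in (0 : ℝ)..1, ∫ y in (0 : ℝ)..1, h (y - y') : ℝ) : ℂ)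
      = ∑ p ∈ t, ∑ q ∈ t, (w p : ℂ) * (w q : ℂ) *
          ((‖I (T * (f p - f q))‖ ^ 2 : ℝ) : ℂ) := by
    have e1 : ∀ y y' : ℝ, ((h (y - y') : ℝ) : ℂ) = ∑ p ∈ t, ∑ q ∈ t, (w p : ℂ) * (w q : ℂ) *
        (addExp (-(y' * (T * (f p - f q)))) * addExp (y * (T * (f p - f q)))) := by
      intro y y'
      simp only [hh]
      rw [norm_sq_sum_mul_addExp]
      refine Finset.sum_congr rfl fun p _ => Finset.sum_congr rfl fun q _ => ?_
      rw [Complex.conj_ofReal, ← addExp_add]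
      congr 2; ring
    rw [← intervalIntegral.integral_ofReal]
    have e2 : ∀ y' : ℝ, ((∫ y in (0 : ℝ)..1, h (y - y') : ℝ) : ℂ)
        = ∑ p ∈ t, ∑ q ∈ t, (w p : ℂ) * (w q : ℂ) *
        (addExp (-(y' * (T * (f p - f q)))) * I (T * (f p - f q))) := by
      intro y'
      rw [← intervalIntegral.integral_ofReal]
      simp_rw [e1]
      rw [intervalIntegral.integral_finsetSum]
      · refine Finset.sum_congr rfl fun p _ => ?_
        rw [intervalIntegral.integral_finsetSum]
        · refine Finset.sum_congr rfl fun q _ => ?_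
          rw [intervalIntegral.integral_const_mul, intervalIntegral.integral_const_mul]
        · exact fun q _ => Continuous.intervalIntegrable (by fun_prop) _ _
      · exact fun p _ => Continuous.intervalIntegrable (by fun_prop) _ _
    simp_rw [e2]
    rw [intervalIntegral.integral_finsetSum]
    · refine Finset.sum_congr rfl fun p _ => ?_
      rw [intervalIntegral.integral_finsetSum]
      · refine Finset.sum_congr rfl fun q _ => ?_
        rw [intervalIntegral.integral_const_mul, intervalIntegral.integral_mul_const, hIconj]
        push_cast
        rw [Complex.conj_mul']
      · exact fun q _ => Continuous.intervalIntegrable (by fun_prop) _ _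
    · exact fun p _ => Continuous.intervalIntegrable (by fun_prop) _ _
  have h4 : (∫ y' in (0 : ℝ)..1, ∫ y in (0 : ℝ)..1, h (y - y') : ℝ)
      = ∑ p ∈ t, ∑ q ∈ t, w p * w q * ‖I (T * (f p - f q))‖ ^ 2 := by
    have := h3
    norm_cast at this
  have h5 : (closeCount s f (1 / (4 * T)) : ℝ) / 4
      ≤ ∑ p ∈ t, ∑ q ∈ t, w p * w q * ‖I (T * (f p - f q))‖ ^ 2 := by
    rw [closeCount_eq_sum, Finset.sum_div]
    calc _ ≤ ∑ p ∈ s, ∑ q ∈ s, w p * w q * ‖I (T * (f p - f q))‖ ^ 2 := by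
          refine Finset.sum_le_sum fun p hp => ?_
          rw [Finset.sum_div]
          refine Finset.sum_le_sum fun q hq => ?_
          have hp1 := hw1 p hp
          have hq1 := hw1 q hq
          split_ifs with hcl
          · have hξ : |T * (f p - f q)| ≤ 1 / 4 := by
              rw [abs_mul, abs_of_pos hT]
              calc T * |f p - f q| ≤ T * (1 / (4 * T)) := by gcongr
                _ = 1 / 4 := by field_simp
            have := one_half_le_norm_integral_addExp hξ
            have h6 : (1 / 2 : ℝ) ^ 2 ≤ ‖I (T * (f p - f q))‖ ^ 2 := by gcongr
            have h7 : 1 ≤ w p * w q := by nlinarith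
            nlinarith
          · rw [zero_div]; positivity
      _ ≤ ∑ p ∈ s, ∑ q ∈ t, w p * w q * ‖I (T * (f p - f q))‖ ^ 2 :=
          Finset.sum_le_sum fun p hp => Finset.sum_le_sum_of_subset_of_nonneg hst
            fun q hq _ => mul_nonneg (mul_nonneg (hw0 p (hst hp)) (hw0 q hq)) (by positivity)
      _ ≤ _ := Finset.sum_le_sum_of_subset_of_nonneg hst fun p hp _ =>
          Finset.sum_nonneg fun q hq => mul_nonneg (mul_nonneg (hw0 p hp) (hw0 q hq)) (by positivity)
  linarith

/-! ### The double large sieve -/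

/-- Taking `c = sqrt (Q / P)` balances the two terms. This turns a weighted arithmetic-geometric
inequality under an integral into the Cauchy-Schwarz bound. -/
theorem le_sqrt_mul_of_forall_le {a P Q : ℝ} (hP : 0 < P) (hQ : 0 < Q)
    (h : ∀ c : ℝ, 0 < c → a ≤ (c * P + Q / c) / 2) : a ≤ Real.sqrt (P * Q) := by
  have h1 := h (Real.sqrt (Q / P)) (by positivity)
  refine h1.trans (le_of_eq ?_)
  rw [Real.sqrt_mul hP.le, Real.sqrt_div hQ.le]
  have hp := Real.sqrt_pos.2 hP
  have hq := Real.sqrt_pos.2 hQ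
  have e1 := Real.sq_sqrt hP.le
  have e2 := Real.sq_sqrt hQ.le
  set p := Real.sqrt P
  set q := Real.sqrt Q
  rw [← e1, ← e2]
  field_simp
  norm_num

theorem integral_shifted_gaussian_mul_addExp (x y : ℝ) :
    ∫ t : ℝ, (Real.exp (-Real.pi * (t - x) ^ 2) : ℂ) * addExp (t * y)
      = (Real.exp (-Real.pi * y ^ 2) : ℂ) * addExp (x * y) := by
  have h := integral_gaussian_mul_addExp Real.pi_pos y
  rw [← integral_sub_right_eq_self _ x] at h
  have h1 : ∀ t : ℝ, (Real.exp (-Real.pi * (t - x) ^ 2) : ℂ) * addExp (t * y)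
      = ((Real.exp (-Real.pi * (t - x) ^ 2) : ℂ) * addExp ((t - x) * y)) * addExp (x * y) := by
    intro t
    rw [mul_assoc, ← addExp_add]; congr 2; ring
  simp_rw [h1]
  rw [integral_mul_const, h, div_self Real.pi_ne_zero, Real.sqrt_one, one_mul]
  congr 4
  field_simp

theorem integrable_shifted_gaussian_mul_addExp (x y : ℝ) :
    Integrable fun t : ℝ => (Real.exp (-Real.pi * (t - x) ^ 2) : ℂ) * addExp (t * y) := by
  refine ((integrable_exp_neg_mul_sq Real.pi_pos).comp_sub_right x).mono'
    (Continuous.aestronglyMeasurable ?_) ?_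
  · have := continuous_addExp
    fun_prop
  · refine Filter.Eventually.of_forall fun t => ?_
    rw [norm_mul, norm_addExp, mul_one, Complex.norm_real, Real.norm_of_nonneg (Real.exp_pos _).le]

/-- Two Gaussians overlap only if their centres are close. The growing weight is harmless because
`|x| ≤ R` gives `t^2 / (2R)^2 ≤ (t - x)^2 / 2 + 1/2`; what remains still decays in `t - x`. -/
theorem shifted_gaussian_mul_le {x x' t R : ℝ} (hR : 1 ≤ R) (hx : |x| ≤ R) :
    Real.exp (-Real.pi * (t - x) ^ 2) * Real.exp (-Real.pi * (t - x') ^ 2) *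
        Real.exp (Real.pi / (2 * R) ^ 2 * t ^ 2)
      ≤ Real.exp (Real.pi / 2) * Real.exp (-(Real.pi / 8) * (x - x') ^ 2) *
        Real.exp (-(Real.pi / 4) * (t - x) ^ 2) := by
  rw [← Real.exp_add, ← Real.exp_add, ← Real.exp_add, ← Real.exp_add]
  refine Real.exp_le_exp.2 ?_
  have h1 : t ^ 2 / (2 * R) ^ 2 ≤ (t - x) ^ 2 / 2 + 1 / 2 := by
    rw [div_le_iff₀ (by positivity)]
    have : x ^ 2 ≤ R ^ 2 := by rw [← sq_abs]; gcongr
    have h3 : t ^ 2 ≤ 2 * (t - x) ^ 2 + 2 * x ^ 2 := by nlinarith [sq_nonneg (t - 2 * x)]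
    have h2 : (t - x) ^ 2 * 1 ≤ (t - x) ^ 2 * R ^ 2 := by gcongr; exact one_le_pow₀ hR
    nlinarith
  have h2 : Real.pi / (2 * R) ^ 2 * t ^ 2 = Real.pi * (t ^ 2 / (2 * R) ^ 2) := by ring
  rw [h2]
  have h3 : (x - x') ^ 2 ≤ 2 * (t - x) ^ 2 + 2 * (t - x') ^ 2 := by
    nlinarith [sq_nonneg ((t - x) + (t - x'))]
  have h4 : Real.pi * (t ^ 2 / (2 * R) ^ 2) ≤ Real.pi * ((t - x) ^ 2 / 2 + 1 / 2) := by
    gcongr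
  have h5 : Real.pi * (x - x') ^ 2 ≤ Real.pi * (2 * (t - x) ^ 2 + 2 * (t - x') ^ 2) := by
    gcongr
  have h6 : 0 ≤ Real.pi * (t - x') ^ 2 := by positivity
  linarith

/-- The double large sieve. -/
theorem exists_double_large_sieve :
    ∃ C : ℝ, 0 < C ∧ ∀ {ι κ : Type} (s : Finset ι) (t : Finset κ) (x : ι → ℝ) (y : κ → ℝ)
      (a : ι → ℂ) (b : κ → ℂ) (R : ℝ), 1 ≤ R → (∀ u ∈ s, |x u| ≤ R) → (∀ v ∈ t, |y v| ≤ 1) →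
      (∀ u ∈ s, ‖a u‖ ≤ 1) → (∀ v ∈ t, ‖b v‖ ≤ 1) →
      ‖∑ u ∈ s, ∑ v ∈ t, a u * b v * addExp (x u * y v)‖ ^ 2
        ≤ C * R * closeCount s x 1 * closeCount t y (1 / R) := by
  obtain ⟨C1, hC1, hx1⟩ := exists_sum_exp_le_closeCount (c := Real.pi / 8) (by positivity)
  obtain ⟨C2, hC2, hy2⟩ := exists_gaussian_mean_square_le
  refine ⟨Real.exp (Real.pi / 2) * 2 * C1 * (C2 * Real.exp Real.pi ^ 2 * 2 * 3),
    by positivity, ?_⟩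
  intro ι κ s t x y a b R hR hx hy ha hb
  have hRpos : 0 < R := by linarith
  -- Empty index sets are split off because the final optimisation needs both counts to be positive.
  rcases s.eq_empty_or_nonempty with rfl | hs
  · simp; positivity
  rcases t.eq_empty_or_nonempty with rfl | ht
  · simp; positivity
  have hcc : ∀ {ι : Type} (s : Finset ι) (f : ι → ℝ) (η : ℝ), 0 ≤ η → s.Nonempty →
      0 < (closeCount s f η : ℝ) := by
    intro ι s f η hη ⟨u, hu⟩
    have : 0 < closeCount s f η := by
      classical
      unfold closeCount
      exact Finset.card_pos.2 ⟨(u, u), by simp [hu, hη]⟩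
    exact_mod_cast this
  have hcx := hcc s x 1 zero_le_one hs
  have hcy := hcc t y (1 / R) (by positivity) ht
  -- Gaussian smoothing in `x` multiplies `e(x y)` by `exp (-π y^2)`. The compensating factor is put
  -- into `b'` and stays bounded since `|y| ≤ 1`.
  set b' : κ → ℂ := fun v => b v * (Real.exp (Real.pi * y v ^ 2) : ℂ) with hb'
  set A : ℝ → ℂ := fun r => ∑ u ∈ s, a u * (Real.exp (-Real.pi * (r - x u) ^ 2) : ℂ) with hA
  set A0 : ℝ → ℝ := fun r => ∑ u ∈ s, Real.exp (-Real.pi * (r - x u) ^ 2) with hA0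
  set g : ℝ → ℂ := fun r => ∑ v ∈ t, b' v * addExp (r * y v) with hg
  have hgc : Continuous g := continuous_sum_mul_addExp t b' y
  have hA0c : Continuous A0 := by rw [hA0]; fun_prop
  have hA0pos : ∀ r, 0 ≤ A0 r := fun r => Finset.sum_nonneg fun u _ => (Real.exp_pos _).le
  have hAA0 : ∀ r, ‖A r‖ ≤ A0 r := by
    intro r
    refine norm_sum_le_of_le _ fun u hu => ?_
    rw [norm_mul, Complex.norm_real, Real.norm_of_nonneg (Real.exp_pos _).le]
    exact mul_le_of_le_one_left (Real.exp_pos _).le (ha u hu)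
  have hb'le : ∀ v ∈ t, ‖b' v‖ ≤ Real.exp Real.pi := by
    intro v hv
    rw [hb']; simp only
    rw [norm_mul, Complex.norm_real, Real.norm_of_nonneg (Real.exp_pos _).le]
    have : y v ^ 2 ≤ 1 := by rw [sq_le_one_iff_abs_le_one]; exact hy v hv
    calc _ ≤ 1 * Real.exp (Real.pi * y v ^ 2) := by gcongr; exact hb v hv
      _ ≤ _ := by
        rw [one_mul]; refine Real.exp_le_exp.2 ?_
        nlinarith [Real.pi_pos]
  have hsum : ∑ u ∈ s, ∑ v ∈ t, a u * b v * addExp (x u * y v) = ∫ r, A r * g r := by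
    have h1 : ∀ r, A r * g r = ∑ u ∈ s, ∑ v ∈ t, a u * b' v *
        ((Real.exp (-Real.pi * (r - x u) ^ 2) : ℂ) * addExp (r * y v)) := by
      intro r
      simp only [hA, hg]
      rw [Finset.sum_mul_sum]
      exact Finset.sum_congr rfl fun u _ => Finset.sum_congr rfl fun v _ => by ring
    simp_rw [h1]
    rw [integral_finsetSum]
    · refine Finset.sum_congr rfl fun u _ => ?_
      rw [integral_finsetSum]
      · refine Finset.sum_congr rfl fun v _ => ?_
        rw [integral_const_mul, integral_shifted_gaussian_mul_addExp]
        simp only [hb']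
        have : (Real.exp (Real.pi * y v ^ 2) : ℂ) * (Real.exp (-Real.pi * y v ^ 2) : ℂ) = 1 := by
          rw [← Complex.ofReal_mul, ← Real.exp_add]; simp
        linear_combination (-(a u * b v * addExp (x u * y v))) * this
      · exact fun v _ => (integrable_shifted_gaussian_mul_addExp _ _).const_mul _
    · exact fun u _ => integrable_finsetSum _ fun v _ =>
        (integrable_shifted_gaussian_mul_addExp _ _).const_mul _
  -- This is the weight in Cauchy-Schwarz: its inverse is the Gaussian window of width `2R` used for
  -- `g`, and it is tolerated by `A0`, which lives on `|r| ≲ R`.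
  set Ω : ℝ → ℝ := fun r => Real.exp (Real.pi / (2 * R) ^ 2 * r ^ 2) with hΩ
  have hΩpos : ∀ r, 0 < Ω r := fun r => Real.exp_pos _
  set D : ℝ → ℝ := fun r => ∑ u ∈ s, ∑ u' ∈ s, Real.exp (Real.pi / 2) *
    Real.exp (-(Real.pi / 8) * (x u - x u') ^ 2) * Real.exp (-(Real.pi / 4) * (r - x u) ^ 2) with hD
  have hAΩ : ∀ r, A0 r ^ 2 * Ω r ≤ D r := by
    intro r
    simp only [hA0, hD]
    rw [sq, Finset.sum_mul_sum, Finset.sum_mul]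
    refine Finset.sum_le_sum fun u hu => ?_
    rw [Finset.sum_mul]
    exact Finset.sum_le_sum fun u' hu' => shifted_gaussian_mul_le hR (hx u hu)
  have hgauss : ∀ z : ℝ, Integrable fun r : ℝ => Real.exp (-(Real.pi / 4) * (r - z) ^ 2) :=
    fun z => (integrable_exp_neg_mul_sq (by positivity)).comp_sub_right z
  have hDint : Integrable D := integrable_finsetSum _ fun u _ => integrable_finsetSum _ fun u' _ =>
    (hgauss _).const_mul _
  have hDval : ∫ r, D r ≤ Real.exp (Real.pi / 2) * 2 * C1 * closeCount s x 1 := by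
    have h1 : ∫ r, D r = Real.exp (Real.pi / 2) * 2 *
        ∑ u ∈ s, ∑ u' ∈ s, Real.exp (-(Real.pi / 8) * (x u - x u') ^ 2) := by
      simp only [hD]
      rw [integral_finsetSum _ fun u _ => integrable_finsetSum _ fun u' _ => (hgauss _).const_mul _,
        Finset.mul_sum]
      refine Finset.sum_congr rfl fun u _ => ?_
      rw [integral_finsetSum _ fun u' _ => (hgauss _).const_mul _, Finset.mul_sum]
      refine Finset.sum_congr rfl fun u' _ => ?_
      rw [integral_const_mul, integral_sub_right_eq_self
        (fun r : ℝ => Real.exp (-(Real.pi / 4) * r ^ 2)), integral_gaussian]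
      have : Real.sqrt (Real.pi / (Real.pi / 4)) = 2 := by
        rw [div_div_cancel₀ Real.pi_ne_zero, show (4 : ℝ) = 2 ^ 2 by norm_num]
        exact Real.sqrt_sq (by norm_num)
      rw [this]; ring
    rw [h1, mul_assoc _ C1]
    gcongr
    exact hx1 s x
  set G : ℝ → ℝ := fun r => Real.exp (-(Real.pi / (2 * R) ^ 2) * r ^ 2) * ‖g r‖ ^ 2 with hG
  have hGint : Integrable G := integrable_gaussian_mul_norm_sq t b' y (by positivity)
  have hGval : ∫ r, G r ≤ C2 * Real.exp Real.pi ^ 2 * 2 * 3 * R * closeCount t y (1 / R) := by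
    refine (hy2 t b' y hb'le (by positivity : 0 < 2 * R)).trans ?_
    have : (closeCount t y (1 / (2 * R)) : ℝ) ≤ closeCount t y (1 / R) := by
      exact_mod_cast closeCount_mono t y (one_div_le_one_div_of_le hRpos (by linarith))
    calc _ ≤ C2 * Real.exp Real.pi ^ 2 * (2 * R) * closeCount t y (1 / R) := by gcongr
      _ ≤ _ := by
        have : 0 ≤ C2 * Real.exp Real.pi ^ 2 * R * closeCount t y (1 / R) := by positivity
        linarith
  have hmain : ∀ c : ℝ, 0 < c → ‖∑ u ∈ s, ∑ v ∈ t, a u * b v * addExp (x u * y v)‖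
      ≤ (c * (Real.exp (Real.pi / 2) * 2 * C1 * closeCount s x 1)
        + (C2 * Real.exp Real.pi ^ 2 * 2 * 3 * R * closeCount t y (1 / R)) / c) / 2 := by
    intro c hc
    rw [hsum]
    have hpt : ∀ r, ‖A r * g r‖ ≤ (c * D r + G r / c) / 2 := by
      intro r
      rw [norm_mul]
      have h1 : ‖A r‖ * ‖g r‖ ≤ A0 r * ‖g r‖ := by gcongr; exact hAA0 r
      have h2 : A0 r * ‖g r‖ ≤ (c * (A0 r ^ 2 * Ω r) + G r / c) / 2 := by
        have e1 : G r = ‖g r‖ ^ 2 / Ω r := by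
          simp only [hG, hΩ]
          rw [neg_mul, Real.exp_neg]; ring
        rw [e1]
        have e2 : (c * (A0 r ^ 2 * Ω r) + ‖g r‖ ^ 2 / Ω r / c) / 2 - A0 r * ‖g r‖
            = (c * Ω r * A0 r - ‖g r‖) ^ 2 / (2 * c * Ω r) := by
          have := (hΩpos r).ne'
          field_simp
          ring
        have e3 : 0 ≤ (c * Ω r * A0 r - ‖g r‖) ^ 2 / (2 * c * Ω r) := by
          have := hΩpos r
          positivity
        linarith
      have h3 : c * (A0 r ^ 2 * Ω r) ≤ c * D r := by gcongr; exact hAΩ r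
      linarith
    have hint : Integrable fun r => (c * D r + G r / c) / 2 :=
      ((hDint.const_mul c).add (hGint.div_const c)).div_const 2
    calc ‖∫ r, A r * g r‖ ≤ ∫ r, (c * D r + G r / c) / 2 :=
          norm_integral_le_of_norm_le hint (Filter.Eventually.of_forall hpt)
      _ = (c * (∫ r, D r) + (∫ r, G r) / c) / 2 := by
          rw [integral_div, integral_add (hDint.const_mul c) (hGint.div_const c),
            integral_const_mul, integral_div]
      _ ≤ _ := by gcongr
  have hfin := le_sqrt_mul_of_forall_le (by positivity) (by positivity) hmain
  calc _ ≤ (Real.sqrt _) ^ 2 := by gcongr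
    _ = _ := by
      rw [Real.sq_sqrt (by positivity)]; ring

/-! ### Second derivative test for monomial phases -/

/-- The quotient `(σ - 1) / (σ^(α-1) - 1)` has only a removable singularity: the denominator
vanishes just at `σ = 1`, with derivative `α - 1 ≠ 0`. Analyticity of the difference quotient gives
smoothness there. It allows division by the phase derivative near the stationary point. -/
theorem exists_dual_slope {α : ℝ} (hα : α ≠ 1) :
    ∃ k : ℝ → ℝ, ContDiffOn ℝ 2 k (Set.Ioi 0) ∧
      ∀ σ, 0 < σ → k σ * (σ ^ (α - 1) - 1) = σ - 1 := by
  set f : ℝ → ℝ := fun σ => σ ^ (α - 1) with hf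
  have hα1 : α - 1 ≠ 0 := sub_ne_zero.2 hα
  have hderiv : deriv f 1 = α - 1 := by
    have := (Real.hasDerivAt_rpow_const (x := (1 : ℝ)) (p := α - 1) (Or.inl one_ne_zero)).deriv
    rw [Real.one_rpow, mul_one] at this
    exact this
  have hne : ∀ σ, 0 < σ → σ ≠ 1 → f σ ≠ 1 := by
    intro σ hσ h1 h
    simp only [hf] at h
    have h2 := congrArg Real.log h
    rw [Real.log_rpow hσ, Real.log_one] at h2
    rcases mul_eq_zero.1 h2 with h | h
    · exact hα1 h
    · exact h1 (Real.eq_one_of_pos_of_log_eq_zero hσ h)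
  have hf1 : f 1 = 1 := by simp [hf]
  have hd0 : ∀ σ, 0 < σ → dslope f 1 σ ≠ 0 := by
    intro σ hσ
    by_cases h1 : σ = 1
    · rw [h1, dslope_same, hderiv]; exact hα1
    · rw [dslope_of_ne _ h1, slope_def_field, hf1]
      exact div_ne_zero (sub_ne_zero.2 (hne σ hσ h1)) (sub_ne_zero.2 h1)
  have hfa : ∀ σ, 0 < σ → AnalyticAt ℝ f σ := by
    intro σ hσ
    have h : AnalyticAt ℝ (fun x : ℝ => Real.exp (Real.log x * (α - 1))) σ :=
      ((analyticAt_log hσ).mul analyticAt_const).rexp'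
    refine h.congr ?_
    filter_upwards [lt_mem_nhds hσ] with y hy
    simp only [hf]
    rw [Real.rpow_def_of_pos hy]
  have hda : ∀ σ, 0 < σ → ContDiffAt ℝ 2 (dslope f 1) σ := by
    intro σ hσ
    by_cases h1 : σ = 1
    · subst h1
      obtain ⟨p, hp⟩ := hfa 1 hσ
      exact (HasFPowerSeriesAt.analyticAt
        (HasFPowerSeriesAt.has_fpower_series_dslope_fslope hp)).contDiffAt
    · have h2 : slope f 1 =ᶠ[nhds σ] dslope f 1 :=
        (dslope_eventuallyEq_slope_of_ne f h1).symm
      refine ContDiffAt.congr_of_eventuallyEq ?_ h2.symm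
      have h3 : slope f 1 = fun y => (f y - f 1) / (y - 1) := by
        funext y; exact slope_def_field _ _ _
      rw [h3]
      exact ((hfa σ hσ).contDiffAt.sub contDiffAt_const).div
        (contDiffAt_id.sub contDiffAt_const) (sub_ne_zero.2 h1)
  refine ⟨fun σ => (dslope f 1 σ)⁻¹, fun σ hσ => ?_, fun σ hσ => ?_⟩
  · exact ((hda σ hσ).inv (hd0 σ hσ)).contDiffWithinAt
  · by_cases h1 : σ = 1
    · simp [h1]
    · have h2 := hne σ hσ h1
      change (dslope f 1 σ)⁻¹ * (f σ - 1) = σ - 1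
      rw [dslope_of_ne _ h1, slope_def_field, hf1]
      have : f σ - 1 ≠ 0 := sub_ne_zero.2 h2
      rw [inv_div, div_mul_cancel₀ _ this]

/-- The monomial phase `s ^ α / α`, with derivative `s ^ (α - 1)`. -/
noncomputable def powPhase (α s : ℝ) : ℝ := s ^ α / α

theorem hasDerivAt_powPhase {α s : ℝ} (hα : α ≠ 0) (hs : 0 < s) :
    HasDerivAt (powPhase α) (s ^ (α - 1)) s := by
  have h := (Real.hasDerivAt_rpow_const (p := α) (Or.inl hs.ne')).div_const α
  have e : α * s ^ (α - 1) / α = s ^ (α - 1) := by field_simp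
  rw [e] at h
  exact h

theorem continuousOn_powPhase {α : ℝ} (hα : α ≠ 0) : ContinuousOn (powPhase α) (Set.Ioi 0) :=
  fun _ hs => (hasDerivAt_powPhase hα hs).continuousAt.continuousWithinAt

/-- The monomial phase with its first order Taylor polynomial at `1` removed. -/
noncomputable def centredPhase (α σ : ℝ) : ℝ := powPhase α σ - powPhase α 1 - (σ - 1)

theorem hasDerivAt_centredPhase {α σ : ℝ} (hα : α ≠ 0) (hσ : 0 < σ) :
    HasDerivAt (centredPhase α) (σ ^ (α - 1) - 1) σ :=
  ((hasDerivAt_powPhase hα hσ).sub_const _).sub ((hasDerivAt_id σ).sub_const 1)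

theorem continuousOn_rpow_sub_one (α : ℝ) :
    ContinuousOn (fun σ : ℝ => σ ^ (α - 1) - 1) (Set.Ioi 0) :=
  (ContinuousOn.rpow_const continuousOn_id fun _ hx => Or.inl (ne_of_gt hx)).sub continuousOn_const

theorem hasDerivAt_addExp_centredPhase {α σ : ℝ} (hα : α ≠ 0) (hσ : 0 < σ) (Y : ℝ) :
    HasDerivAt (fun σ => addExp (Y * centredPhase α σ))
      (2 * Real.pi * Complex.I * (Y * (σ ^ (α - 1) - 1) : ℝ) * addExp (Y * centredPhase α σ)) σ := by
  have h1 := (hasDerivAt_centredPhase hα hσ).const_mul Y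
  have h2 := (hasDerivAt_addExp (Y * centredPhase α σ)).scomp σ h1
  have e : (Y * (σ ^ (α - 1) - 1)) • (2 * Real.pi * Complex.I * addExp (Y * centredPhase α σ))
      = 2 * Real.pi * Complex.I * (Y * (σ ^ (α - 1) - 1) : ℝ) * addExp (Y * centredPhase α σ) := by
    rw [Complex.real_smul]; ring
  rw [e] at h2
  exact h2

theorem integral_inv_one_add_mul_sq_le {Y : ℝ} (hY : 0 < Y) {c C : ℝ} (hcC : c ≤ C) :
    ∫ σ in c..C, (1 + Y * (σ - 1) ^ 2)⁻¹ ≤ Real.pi / Real.sqrt Y := by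
  have hs := Real.sqrt_pos.2 hY
  have h1 : Integrable fun σ : ℝ => (1 + Y * (σ - 1) ^ 2)⁻¹ := by
    have := ((integrable_inv_one_add_sq).comp_mul_left' hs.ne').comp_sub_right 1
    refine this.congr (Filter.Eventually.of_forall fun σ => ?_)
    simp only [mul_pow, Real.sq_sqrt hY.le]
  have h2 : ∫ σ : ℝ, (1 + Y * (σ - 1) ^ 2)⁻¹ = Real.pi / Real.sqrt Y := by
    have e : ∀ σ : ℝ, (1 + Y * (σ - 1) ^ 2)⁻¹ = (1 + (Real.sqrt Y * (σ - 1)) ^ 2)⁻¹ := by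
      intro σ; rw [mul_pow, Real.sq_sqrt hY.le]
    simp_rw [e]
    rw [integral_sub_right_eq_self (fun σ : ℝ => (1 + (Real.sqrt Y * σ) ^ 2)⁻¹),
      Measure.integral_comp_mul_left (fun σ : ℝ => (1 + σ ^ 2)⁻¹), integral_univ_inv_one_add_sq,
      abs_of_pos (inv_pos.2 hs), smul_eq_mul]
    ring
  rw [← h2, intervalIntegral.integral_of_le hcC]
  exact setIntegral_le_integral h1 (Filter.Eventually.of_forall fun σ => by positivity)

theorem abs_div_one_add_mul_sq_le {Y : ℝ} (hY : 0 < Y) (u : ℝ) :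
    |u / (1 + Y * u ^ 2)| ≤ 1 / Real.sqrt Y := by
  have hs := Real.sqrt_pos.2 hY
  rw [abs_div, abs_of_pos (by positivity : 0 < 1 + Y * u ^ 2),
    div_le_div_iff₀ (by positivity) hs, one_mul]
  have e := Real.sq_sqrt hY.le
  have : (Real.sqrt Y * |u|) ^ 2 = Y * u ^ 2 := by rw [mul_pow, e, sq_abs]
  nlinarith [sq_nonneg (Real.sqrt Y * |u| - 1)]

theorem hasDerivAt_div_one_add_mul_sq {Y : ℝ} (hY : 0 < Y) (σ : ℝ) :
    HasDerivAt (fun σ : ℝ => (σ - 1) / (1 + Y * (σ - 1) ^ 2))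
      ((1 - Y * (σ - 1) ^ 2) / (1 + Y * (σ - 1) ^ 2) ^ 2) σ := by
  have h1 : HasDerivAt (fun σ : ℝ => σ - 1) 1 σ := (hasDerivAt_id σ).sub_const 1
  have h2 := ((h1.pow 2).const_mul Y).const_add 1
  have h0 : (1 : ℝ) + Y * (σ - 1) ^ 2 ≠ 0 := by positivity
  have h3 := h1.div h2 h0
  refine h3.congr_deriv ?_
  congr 1
  simp only [Pi.pow_apply]
  push_cast; ring

theorem abs_one_sub_div_sq_le {Y : ℝ} (hY : 0 < Y) (u : ℝ) :
    |(1 - Y * u ^ 2) / (1 + Y * u ^ 2) ^ 2| ≤ (1 + Y * u ^ 2)⁻¹ := by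
  have h : 0 ≤ Y * u ^ 2 := by positivity
  rw [abs_div, abs_of_pos (by positivity : 0 < (1 + Y * u ^ 2) ^ 2), div_le_iff₀ (by positivity)]
  have : (1 + Y * u ^ 2)⁻¹ * (1 + Y * u ^ 2) ^ 2 = 1 + Y * u ^ 2 := by field_simp
  rw [this, abs_le]
  constructor <;> linarith

/-- Second derivative test for the phase `Y * centredPhase α`. -/
theorem exists_norm_integral_mul_addExp_le {α : ℝ} (hα0 : α ≠ 0) (hα1 : α ≠ 1) {c C : ℝ}
    (hc : 0 < c) (hcC : c ≤ C) :
    ∃ D : ℝ, 0 < D ∧ ∀ (G G' : ℝ → ℂ) (B Y : ℝ), 0 < Y →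
      (∀ σ ∈ Set.Icc c C, HasDerivAt G (G' σ) σ) → ContinuousOn G' (Set.Icc c C) →
      G c = 0 → G C = 0 → (∀ σ ∈ Set.Icc c C, ‖G σ‖ ≤ B) → (∀ σ ∈ Set.Icc c C, ‖G' σ‖ ≤ B) →
      ‖∫ σ in c..C, G σ * addExp (Y * centredPhase α σ)‖ ≤ D * B / Real.sqrt Y := by
  obtain ⟨k, hk, hkeq⟩ := exists_dual_slope hα1
  have hsub : Set.Icc c C ⊆ Set.Ioi 0 := fun σ hσ => lt_of_lt_of_le hc hσ.1
  have hkd : ∀ σ ∈ Set.Icc c C, HasDerivAt k (deriv k σ) σ := fun σ hσ =>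
    ((hk.contDiffAt (Ioi_mem_nhds (hsub hσ))).differentiableAt (by norm_num)).hasDerivAt
  have hkc : ContinuousOn k (Set.Icc c C) := hk.continuousOn.mono hsub
  have hk'c : ContinuousOn (deriv k) (Set.Icc c C) :=
    (hk.continuousOn_deriv_of_isOpen isOpen_Ioi (by norm_num)).mono hsub
  obtain ⟨K0, hK0⟩ := isCompact_Icc.exists_bound_of_continuousOn hkc
  obtain ⟨K1, hK1⟩ := isCompact_Icc.exists_bound_of_continuousOn hk'c
  have hcmem : c ∈ Set.Icc c C := Set.left_mem_Icc.2 hcC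
  have hK0p : 0 ≤ K0 := (norm_nonneg _).trans (hK0 c hcmem)
  have hK1p : 0 ≤ K1 := (norm_nonneg _).trans (hK1 c hcmem)
  refine ⟨(1 + K0) * Real.pi + (K0 + K1) * (C - c) + 1, by
    have := Real.pi_pos; have : 0 ≤ C - c := by linarith
    positivity, ?_⟩
  intro G G' B Y hY hG hG'c hGc hGC hB hB'
  have hBp : 0 ≤ B := (norm_nonneg _).trans (hB c hcmem)
  have hs := Real.sqrt_pos.2 hY
  have huIcc : Set.uIcc c C = Set.Icc c C := Set.uIcc_of_le hcC
  set E : ℝ → ℂ := fun σ => addExp (Y * centredPhase α σ) with hE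
  have hEd : ∀ σ ∈ Set.Icc c C, HasDerivAt E
      (2 * Real.pi * Complex.I * (Y * (σ ^ (α - 1) - 1) : ℝ) * E σ) σ := fun σ hσ =>
    hasDerivAt_addExp_centredPhase hα0 (hsub hσ) Y
  have hEc : ContinuousOn E (Set.Icc c C) := fun σ hσ => (hEd σ hσ).continuousAt.continuousWithinAt
  have hGcont : ContinuousOn G (Set.Icc c C) :=
    fun σ hσ => (hG σ hσ).continuousAt.continuousWithinAt
  -- The function `q` is a regularised form of `1 / (Y (σ - 1))`. Writing `1 = r + Y (σ - 1)^2 r`,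
  -- the second part is `k q` times the phase derivative and is integrated by parts. Both `r` and
  -- `q'` have integral `O(Y^(-1/2))`, and `q` itself has that size.
  set q : ℝ → ℝ := fun σ => (σ - 1) / (1 + Y * (σ - 1) ^ 2) with hq
  set q' : ℝ → ℝ := fun σ => (1 - Y * (σ - 1) ^ 2) / (1 + Y * (σ - 1) ^ 2) ^ 2 with hq'
  have hqd : ∀ σ, HasDerivAt q (q' σ) σ := hasDerivAt_div_one_add_mul_sq hY
  have hqc : Continuous q := continuous_iff_continuousAt.2 fun σ => (hqd σ).continuousAt
  have hden : ∀ σ : ℝ, 1 + Y * (σ - 1) ^ 2 ≠ 0 := fun σ => by positivity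
  have hq'c : Continuous q' := by
    simp only [hq']
    refine Continuous.div (by fun_prop) (by fun_prop) fun σ => pow_ne_zero _ (hden σ)
  set P : ℝ → ℂ := fun σ => G σ * ((k σ * q σ : ℝ) : ℂ) with hP
  set P' : ℝ → ℂ := fun σ => G' σ * ((k σ * q σ : ℝ) : ℂ) +
    G σ * ((deriv k σ * q σ + k σ * q' σ : ℝ) : ℂ) with hP'
  have hPd : ∀ σ ∈ Set.Icc c C, HasDerivAt P (P' σ) σ := fun σ hσ =>
    (hG σ hσ).mul ((hkd σ hσ).mul (hqd σ)).ofReal_comp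
  have hP'c : ContinuousOn P' (Set.Icc c C) := by
    refine ContinuousOn.add (hG'c.mul ?_) (hGcont.mul ?_)
    · exact Complex.continuous_ofReal.comp_continuousOn (hkc.mul hqc.continuousOn)
    · exact Complex.continuous_ofReal.comp_continuousOn
        ((hk'c.mul hqc.continuousOn).add (hkc.mul hq'c.continuousOn))
  have hE'c : ContinuousOn (fun σ => 2 * Real.pi * Complex.I * (Y * (σ ^ (α - 1) - 1) : ℝ) * E σ)
      (Set.Icc c C) := by
    refine ContinuousOn.mul (continuousOn_const.mul ?_) hEc
    exact Complex.continuous_ofReal.comp_continuousOn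
      (continuousOn_const.mul ((continuousOn_rpow_sub_one α).mono hsub))
  have hibp := intervalIntegral.integral_mul_deriv_eq_deriv_mul (a := c) (b := C)
    (u := P) (v := E) (u' := P')
    (v' := fun σ => 2 * Real.pi * Complex.I * (Y * (σ ^ (α - 1) - 1) : ℝ) * E σ)
    (fun σ hσ => hPd σ (huIcc ▸ hσ)) (fun σ hσ => hEd σ (huIcc ▸ hσ))
    ((hP'c.intervalIntegrable_of_Icc hcC)) (hE'c.intervalIntegrable_of_Icc hcC)
  have hPc0 : P c = 0 := by simp [hP, hGc]
  have hPC0 : P C = 0 := by simp [hP, hGC]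
  rw [hPc0, hPC0, zero_mul, zero_mul, sub_zero, zero_sub] at hibp
  set r : ℝ → ℝ := fun σ => (1 + Y * (σ - 1) ^ 2)⁻¹ with hr
  have hrc : Continuous r := by
    rw [hr]
    exact Continuous.inv₀ (by fun_prop) hden
  have hsplit : ∫ σ in c..C, G σ * E σ
      = (∫ σ in c..C, (r σ : ℂ) * (G σ * E σ)) - (2 * Real.pi * Complex.I)⁻¹ *
        ∫ σ in c..C, P' σ * E σ := by
    have h2pi : (2 * Real.pi * Complex.I : ℂ) ≠ 0 := by simp [Real.pi_ne_zero]
    have h1 : (2 * Real.pi * Complex.I)⁻¹ * ∫ σ in c..C, P' σ * E σ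
        = - ∫ σ in c..C, (Y * (σ - 1) ^ 2 * r σ : ℝ) * (G σ * E σ) := by
      rw [← neg_neg (∫ σ in c..C, P' σ * E σ), ← hibp, mul_neg, ← intervalIntegral.integral_const_mul]
      congr 1
      refine intervalIntegral.integral_congr fun σ hσ => ?_
      rw [huIcc] at hσ
      have h3 := hkeq σ (hsub hσ)
      have h4 : Y * (σ - 1) ^ 2 * r σ = (k σ * q σ) * (Y * (σ ^ (α - 1) - 1)) := by
        simp only [hr, hq]
        rw [div_eq_mul_inv]
        linear_combination (-(Y * (σ - 1) * (1 + Y * (σ - 1) ^ 2)⁻¹)) * h3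
      simp only [hP]
      rw [h4]
      push_cast
      field_simp
    rw [h1, sub_neg_eq_add, ← intervalIntegral.integral_add]
    · refine intervalIntegral.integral_congr fun σ _ => ?_
      rw [← add_mul]
      have : (r σ : ℂ) + ((Y * (σ - 1) ^ 2 * r σ : ℝ) : ℂ) = 1 := by
        rw [← Complex.ofReal_add]
        have : r σ + Y * (σ - 1) ^ 2 * r σ = 1 := by
          simp only [hr]; have := hden σ; field_simp
        rw [this, Complex.ofReal_one]
      rw [this, one_mul]
    · refine ContinuousOn.intervalIntegrable_of_Icc hcC ?_
      exact (Complex.continuous_ofReal.comp hrc).continuousOn.mul (hGcont.mul hEc)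
    · refine ContinuousOn.intervalIntegrable_of_Icc hcC ?_
      refine ContinuousOn.mul (Continuous.continuousOn ?_) (hGcont.mul hEc)
      exact Complex.continuous_ofReal.comp (by fun_prop)
  have hEn : ∀ σ, ‖E σ‖ = 1 := fun σ => norm_addExp _
  have hrint : IntervalIntegrable r volume c C := hrc.intervalIntegrable _ _
  have hrle := integral_inv_one_add_mul_sq_le hY hcC
  have hb1 : ‖∫ σ in c..C, (r σ : ℂ) * (G σ * E σ)‖ ≤ B * (Real.pi / Real.sqrt Y) := by
    calc _ ≤ ∫ σ in c..C, B * r σ := by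
          refine intervalIntegral.norm_integral_le_of_norm_le hcC ?_ (hrint.const_mul B)
          refine Filter.Eventually.of_forall fun σ hσ => ?_
          have hrp : 0 ≤ r σ := by simp only [hr]; positivity
          rw [norm_mul, norm_mul, hEn, mul_one, Complex.norm_real, Real.norm_of_nonneg hrp, mul_comm]
          gcongr
          exact hB σ ⟨hσ.1.le, hσ.2⟩
      _ = B * ∫ σ in c..C, r σ := intervalIntegral.integral_const_mul _ _
      _ ≤ _ := by gcongr
  have hb2 : ‖∫ σ in c..C, P' σ * E σ‖
      ≤ B * K0 * (Real.pi / Real.sqrt Y) + B * (K0 + K1) * (1 / Real.sqrt Y) * (C - c) := by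
    calc _ ≤ ∫ σ in c..C, (B * K0 * r σ + B * (K0 + K1) * (1 / Real.sqrt Y)) := by
          refine intervalIntegral.norm_integral_le_of_norm_le hcC ?_
            ((hrint.const_mul _).add (by simp))
          refine Filter.Eventually.of_forall fun σ hσ => ?_
          have hσ' : σ ∈ Set.Icc c C := ⟨hσ.1.le, hσ.2⟩
          have hqb : |q σ| ≤ 1 / Real.sqrt Y := abs_div_one_add_mul_sq_le hY (σ - 1)
          have hq'b : |q' σ| ≤ r σ := abs_one_sub_div_sq_le hY (σ - 1)
          have hk0 : |k σ| ≤ K0 := hK0 σ hσ'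
          have hk1 : |deriv k σ| ≤ K1 := hK1 σ hσ'
          rw [norm_mul, hEn, mul_one]
          refine (norm_add_le _ _).trans ?_
          rw [norm_mul, norm_mul, Complex.norm_real, Complex.norm_real, Real.norm_eq_abs,
            Real.norm_eq_abs]
          have a1 : |k σ * q σ| ≤ K0 * (1 / Real.sqrt Y) := by rw [abs_mul]; gcongr
          have a2 : |deriv k σ * q σ + k σ * q' σ| ≤ K1 * (1 / Real.sqrt Y) + K0 * r σ := by
            refine (abs_add_le _ _).trans ?_
            rw [abs_mul, abs_mul]; gcongr
          have a3 : ‖G' σ‖ * |k σ * q σ| ≤ B * (K0 * (1 / Real.sqrt Y)) := by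
            gcongr; exact hB' σ hσ'
          have a4 : ‖G σ‖ * |deriv k σ * q σ + k σ * q' σ|
              ≤ B * (K1 * (1 / Real.sqrt Y) + K0 * r σ) := by
            gcongr; exact hB σ hσ'
          linarith
      _ = B * K0 * (∫ σ in c..C, r σ) + B * (K0 + K1) * (1 / Real.sqrt Y) * (C - c) := by
          rw [intervalIntegral.integral_add (hrint.const_mul _) (by simp),
            intervalIntegral.integral_const_mul, intervalIntegral.integral_const, smul_eq_mul]
          ring
      _ ≤ _ := by gcongr
  have hpi : ‖(2 * Real.pi * Complex.I : ℂ)⁻¹‖ ≤ 1 := by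
    rw [norm_inv]
    refine inv_le_one_of_one_le₀ ?_
    rw [norm_mul, norm_mul, Complex.norm_I, Complex.norm_real, Real.norm_of_nonneg Real.pi_pos.le,
      Complex.norm_ofNat]
    linarith [Real.pi_gt_three]
  change ‖∫ σ in c..C, G σ * E σ‖ ≤ _
  rw [hsplit]
  refine (norm_sub_le _ _).trans ?_
  rw [norm_mul]
  have hlast : ‖(2 * Real.pi * Complex.I : ℂ)⁻¹‖ * ‖∫ σ in c..C, P' σ * E σ‖
      ≤ 1 * (B * K0 * (Real.pi / Real.sqrt Y) + B * (K0 + K1) * (1 / Real.sqrt Y) * (C - c)) := by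
    gcongr
  have : ((1 + K0) * Real.pi + (K0 + K1) * (C - c) + 1) * B / Real.sqrt Y
      = B * (Real.pi / Real.sqrt Y) + 1 * (B * K0 * (Real.pi / Real.sqrt Y)
        + B * (K0 + K1) * (1 / Real.sqrt Y) * (C - c)) + B / Real.sqrt Y := by ring
  rw [this]
  have : 0 ≤ B / Real.sqrt Y := by positivity
  linarith

/-! ### The smooth cutoff -/

/-- A smooth bump equal to `1` on `[1, 2]` and supported in `[3/4, 9/4]`. -/
noncomputable def bump (s : ℝ) : ℝ :=
  (⟨1 / 2, 3 / 4, by norm_num, by norm_num⟩ : ContDiffBump (3 / 2 : ℝ)) s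

theorem contDiff_bump {n : ℕ∞} : ContDiff ℝ n bump := ContDiffBump.contDiff _

theorem bump_nonneg (s : ℝ) : 0 ≤ bump s := ContDiffBump.nonneg _

theorem bump_eq_one {s : ℝ} (hs : s ∈ Set.Icc (1 : ℝ) 2) : bump s = 1 := by
  refine ContDiffBump.one_of_mem_closedBall _ ?_
  rw [Metric.mem_closedBall, Real.dist_eq, abs_le]
  constructor <;> simp only <;> linarith [hs.1, hs.2]

theorem bump_eq_zero {s : ℝ} (hs : s ∉ Set.Ioo (3 / 4 : ℝ) (9 / 4)) : bump s = 0 := by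
  refine ContDiffBump.zero_of_le_dist _ ?_
  rw [Real.dist_eq]
  by_contra h
  simp only at h
  rw [not_le, abs_lt] at h
  exact hs ⟨by linarith [h.1], by linarith [h.2]⟩

theorem bump_eq_zero' {s : ℝ} (hs : s ∉ Set.Ioo (1 / 2 : ℝ) (5 / 2)) : bump s = 0 :=
  bump_eq_zero fun h => hs ⟨by linarith [h.1], by linarith [h.2]⟩

theorem hasCompactSupport_bump : HasCompactSupport bump := ContDiffBump.hasCompactSupport _

theorem hasDerivAt_bump (s : ℝ) : HasDerivAt bump (deriv bump s) s :=
  ((contDiff_bump (n := 1)).differentiable (by norm_num) s).hasDerivAt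

theorem contDiff_deriv_bump : ContDiff ℝ 1 (deriv bump) := by
  have h : ContDiff ℝ 2 bump := contDiff_bump (n := 2)
  rw [show (2 : WithTop ℕ∞) = 1 + 1 by norm_num, contDiff_succ_iff_deriv] at h
  exact h.2.2

theorem hasDerivAt_deriv_bump (s : ℝ) : HasDerivAt (deriv bump) (deriv (deriv bump) s) s :=
  (contDiff_deriv_bump.differentiable (by norm_num) s).hasDerivAt

theorem continuous_bump : Continuous bump := (contDiff_bump (n := 0)).continuous

theorem continuous_deriv_bump : Continuous (deriv bump) := contDiff_deriv_bump.continuous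

theorem continuous_deriv_deriv_bump : Continuous (deriv (deriv bump)) :=
  contDiff_deriv_bump.continuous_deriv (by norm_num)

/-- The bump already vanishes outside `[3/4, 9/4]`, so the larger interval leaves room for a
neighbourhood. Thus boundary terms at `1/2` and `5/2` vanish for derivatives as well. -/
theorem deriv_bump_eq_zero {s : ℝ} (hs : s ∉ Set.Ioo (1 / 2 : ℝ) (5 / 2)) : deriv bump s = 0 := by
  have hz : ∀ᶠ y in nhds s, bump y = 0 := by
    have : {y : ℝ | y ∉ Set.Icc (3 / 4 : ℝ) (9 / 4)} ∈ nhds s := by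
      refine isClosed_Icc.isOpen_compl.mem_nhds fun h => hs ⟨?_, ?_⟩ <;> linarith [h.1, h.2]
    filter_upwards [this] with y hy
    exact bump_eq_zero fun h => hy ⟨h.1.le, h.2.le⟩
  have : bump =ᶠ[nhds s] fun _ => 0 := hz
  rw [this.deriv_eq]; simp

theorem exists_bump_bound :
    ∃ B : ℝ, 0 < B ∧ ∀ s, |bump s| ≤ B ∧ |deriv bump s| ≤ B ∧ |deriv (deriv bump) s| ≤ B := by
  obtain ⟨B0, h0⟩ := hasCompactSupport_bump.exists_bound_of_continuous continuous_bump
  obtain ⟨B1, h1⟩ := hasCompactSupport_bump.deriv.exists_bound_of_continuous continuous_deriv_bump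
  obtain ⟨B2, h2⟩ := hasCompactSupport_bump.deriv.deriv.exists_bound_of_continuous
    continuous_deriv_deriv_bump
  refine ⟨max 1 (max B0 (max B1 B2)), by positivity, fun s => ⟨?_, ?_, ?_⟩⟩
  · exact (h0 s).trans ((le_max_left _ _).trans (le_max_right _ _))
  · exact (h1 s).trans ((le_max_left _ _).trans ((le_max_right _ _).trans (le_max_right _ _)))
  · exact (h2 s).trans ((le_max_right _ _).trans ((le_max_right _ _).trans (le_max_right _ _)))

/-! ### Stationary phase with a slowly varying amplitude -/

/-- The oscillatory integral with phase `x (s ^ α / α - lam s)` and weight `bump`. -/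
noncomputable def oscInt (α x lam : ℝ) : ℂ :=
  ∫ s, (bump s : ℂ) * addExp (x * (powPhase α s - lam * s))

/-- The oscillatory integral `oscInt` with its stationary phase factor removed. -/
noncomputable def oscAmp (α x lam : ℝ) : ℂ :=
  ∫ s, (bump s : ℂ) * addExp (x * (powPhase α s - lam * s + powPhase (α / (α - 1)) lam))

theorem oscInt_eq (α x lam : ℝ) :
    oscInt α x lam = addExp (-(x * powPhase (α / (α - 1)) lam)) * oscAmp α x lam := by
  rw [oscInt, oscAmp, ← integral_const_mul]
  congr 1
  funext s
  rw [mul_left_comm, ← addExp_add]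
  congr 2; ring

/-- With `lam = μ^(α-1)` the phase `s^α/α - lam s` is stationary at `s = μ`, and the right side is
minus its critical value. This is the source of the dual exponent `α/(α-1)`. -/
theorem powPhase_dual {α μ : ℝ} (hα0 : α ≠ 0) (hα1 : α ≠ 1) (hμ : 0 < μ) :
    powPhase (α / (α - 1)) (μ ^ (α - 1)) = μ ^ α * (1 - 1 / α) := by
  have h1 : α - 1 ≠ 0 := sub_ne_zero.2 hα1
  rw [powPhase, ← Real.rpow_mul hμ.le, mul_div_cancel₀ _ h1]
  field_simp

/-- Homogeneity: the substitution `s = μ σ` moves the stationary point to `1`, leaving a single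
phase for all frequencies with only its size `μ^α` varying. -/
theorem phase_scaled {α μ σ : ℝ} (hα0 : α ≠ 0) (hα1 : α ≠ 1) (hμ : 0 < μ) (hσ : 0 < σ) :
    powPhase α (μ * σ) - μ ^ (α - 1) * (μ * σ) + powPhase (α / (α - 1)) (μ ^ (α - 1))
      = μ ^ α * centredPhase α σ := by
  rw [powPhase_dual hα0 hα1 hμ, centredPhase, powPhase, powPhase, powPhase,
    Real.mul_rpow hμ.le hσ.le, Real.one_rpow, Real.rpow_sub_one hμ.ne']
  field_simp
  ring

theorem integral_mul_addExp_scaled {α μ c C : ℝ} (hα0 : α ≠ 0) (hα1 : α ≠ 1) (hμ : 0 < μ)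
    (hc : 0 < c) (hμc : μ * c ≤ 1 / 2) (hμC : 5 / 2 ≤ μ * C) (x : ℝ) (W : ℝ → ℂ)
    (hW : ∀ s, s ∉ Set.Ioo (1 / 2 : ℝ) (5 / 2) → W s = 0) :
    ∫ s, W s * addExp (x * (powPhase α s - μ ^ (α - 1) * s + powPhase (α / (α - 1)) (μ ^ (α - 1))))
      = μ * ∫ σ in c..C, W (μ * σ) * addExp (x * μ ^ α * centredPhase α σ) := by
  have hcC : c ≤ C := by
    by_contra h
    nlinarith
  rw [← intervalIntegral.integral_eq_integral_of_support_subset (a := μ * c) (b := μ * C)]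
  · rw [← intervalIntegral.smul_integral_comp_mul_left, Complex.real_smul]
    congr 1
    refine intervalIntegral.integral_congr fun σ hσ => ?_
    rw [Set.uIcc_of_le hcC] at hσ
    rw [phase_scaled hα0 hα1 hμ (lt_of_lt_of_le hc hσ.1), mul_assoc]
  · intro s hs
    rw [Function.mem_support] at hs
    by_contra h
    refine hs ?_
    rw [hW s fun h' => h ⟨by linarith [h'.1], by linarith [h'.2]⟩, zero_mul]

set_option maxHeartbeats 800000 in
-- The first bound is the second derivative test. In the second, `Y (σ - 1)` is a smooth multiple of
-- the phase derivative, so one integration by parts removes the large factor and the test applies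
-- to the new amplitude. This second integral is the one produced by differentiating `oscAmp` in the
-- frequency.
theorem exists_scaled_bump_bound {α c C M : ℝ} (hα0 : α ≠ 0) (hα1 : α ≠ 1) (hc : 0 < c)
    (hcC : c ≤ C) (hM : 0 ≤ M) :
    ∃ D : ℝ, 0 < D ∧ ∀ μ Y : ℝ, 0 < μ → μ ≤ M → μ * c ≤ 1 / 2 → 5 / 2 ≤ μ * C → 0 < Y →
      ‖∫ σ in c..C, (bump (μ * σ) : ℂ) * addExp (Y * centredPhase α σ)‖ ≤ D / Real.sqrt Y ∧
      ‖Y * ∫ σ in c..C, (bump (μ * σ) * (σ - 1) : ℝ) * addExp (Y * centredPhase α σ)‖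
        ≤ D / Real.sqrt Y := by
  obtain ⟨D, hD, hvdc⟩ := exists_norm_integral_mul_addExp_le hα0 hα1 hc hcC
  obtain ⟨B, hB, hbump⟩ := exists_bump_bound
  obtain ⟨k, hk, hkeq⟩ := exists_dual_slope hα1
  have hsub : Set.Icc c C ⊆ Set.Ioi 0 := fun σ hσ => lt_of_lt_of_le hc hσ.1
  have huIcc : Set.uIcc c C = Set.Icc c C := Set.uIcc_of_le hcC
  have hk' : ContDiffOn ℝ 1 (deriv k) (Set.Ioi 0) :=
    hk.deriv_of_isOpen isOpen_Ioi (by norm_num)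
  have hkd : ∀ σ ∈ Set.Icc c C, HasDerivAt k (deriv k σ) σ := fun σ hσ =>
    ((hk.contDiffAt (Ioi_mem_nhds (hsub hσ))).differentiableAt (by norm_num)).hasDerivAt
  have hkd' : ∀ σ ∈ Set.Icc c C, HasDerivAt (deriv k) (deriv (deriv k) σ) σ := fun σ hσ =>
    ((hk'.contDiffAt (Ioi_mem_nhds (hsub hσ))).differentiableAt (by norm_num)).hasDerivAt
  have hkc : ContinuousOn k (Set.Icc c C) := hk.continuousOn.mono hsub
  have hk'c : ContinuousOn (deriv k) (Set.Icc c C) := hk'.continuousOn.mono hsub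
  have hk''c : ContinuousOn (deriv (deriv k)) (Set.Icc c C) :=
    (hk'.continuousOn_deriv_of_isOpen isOpen_Ioi (by norm_num)).mono hsub
  obtain ⟨K0, hK0⟩ := isCompact_Icc.exists_bound_of_continuousOn hkc
  obtain ⟨K1, hK1⟩ := isCompact_Icc.exists_bound_of_continuousOn hk'c
  obtain ⟨K2, hK2⟩ := isCompact_Icc.exists_bound_of_continuousOn hk''c
  have hcmem : c ∈ Set.Icc c C := Set.left_mem_Icc.2 hcC
  have hK0p : 0 ≤ K0 := (norm_nonneg _).trans (hK0 c hcmem)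
  have hK1p : 0 ≤ K1 := (norm_nonneg _).trans (hK1 c hcmem)
  have hK2p : 0 ≤ K2 := (norm_nonneg _).trans (hK2 c hcmem)
  set Bt : ℝ := B * (1 + M) ^ 2 * (1 + 2 * (K0 + K1 + K2)) with hBt
  have hBt' : Bt = B * (1 + M) ^ 2 + 2 * (B * (1 + M) ^ 2 * K0) + 2 * (B * (1 + M) ^ 2 * K1)
      + 2 * (B * (1 + M) ^ 2 * K2) := by rw [hBt]; ring
  refine ⟨D * Bt, by positivity, ?_⟩
  intro μ Y hμ hμM hμc hμC hY
  have hcond : ∀ {F : ℝ → ℝ}, (∀ s, s ∉ Set.Ioo (1 / 2 : ℝ) (5 / 2) → F s = 0) →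
      F (μ * c) = 0 ∧ F (μ * C) = 0 := fun hF =>
    ⟨hF _ fun h => by linarith [h.1], hF _ fun h => by linarith [h.2]⟩
  have z0 := hcond (F := bump) fun s hs => bump_eq_zero' hs
  have z1 := hcond (F := deriv bump) fun s hs => deriv_bump_eq_zero hs
  have hmul : ∀ σ : ℝ, HasDerivAt (fun σ => μ * σ) μ σ := fun σ => by
    simpa using (hasDerivAt_id σ).const_mul μ
  have hb : ∀ σ, HasDerivAt (fun σ => bump (μ * σ)) (deriv bump (μ * σ) * μ) σ := fun σ =>
    (hasDerivAt_bump (μ * σ)).comp σ (hmul σ)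
  have hb' : ∀ σ, HasDerivAt (fun σ => deriv bump (μ * σ)) (deriv (deriv bump) (μ * σ) * μ) σ :=
    fun σ => (hasDerivAt_deriv_bump (μ * σ)).comp σ (hmul σ)
  have cb : Continuous fun σ => bump (μ * σ) := by
    have := continuous_bump; fun_prop
  have cb' : Continuous fun σ => deriv bump (μ * σ) := by
    have := continuous_deriv_bump; fun_prop
  have cb'' : Continuous fun σ => deriv (deriv bump) (μ * σ) := by
    have := continuous_deriv_deriv_bump; fun_prop
  have hM1 : (1 : ℝ) ≤ (1 + M) ^ 2 := one_le_pow₀ (by linarith)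
  have hM2 : M ≤ (1 + M) ^ 2 := by nlinarith
  have hM3 : M ^ 2 ≤ (1 + M) ^ 2 := by nlinarith
  have hKp : 0 ≤ K0 + K1 + K2 := by positivity
  have hBt1 : B * (1 + M) ^ 2 ≤ Bt := by
    rw [hBt]; exact le_mul_of_one_le_right (by positivity) (by linarith)
  constructor
  · refine hvdc (fun σ => (bump (μ * σ) : ℂ)) (fun σ => ((deriv bump (μ * σ) * μ : ℝ) : ℂ)) Bt Y hY
      (fun σ _ => (hb σ).ofReal_comp) ?_ (by simp [z0.1]) (by simp [z0.2]) ?_ ?_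
    · exact (Complex.continuous_ofReal.comp (by fun_prop)).continuousOn
    · intro σ _
      rw [Complex.norm_real]
      refine (hbump _).1.trans (le_trans ?_ hBt1)
      exact le_mul_of_one_le_right hB.le hM1
    · intro σ _
      rw [Complex.norm_real, norm_mul, Real.norm_eq_abs, Real.norm_of_nonneg hμ.le]
      refine le_trans ?_ hBt1
      have := (hbump (μ * σ)).2.1
      have : μ ≤ (1 + M) ^ 2 := hμM.trans hM2
      gcongr
  -- Since `σ - 1` equals `k σ` times the phase derivative up to `Y`, the amplitude to integrate by
  -- parts is `bump · k`. The second derivative test then needs `F''`, hence two derivatives of `k`.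
  · set F : ℝ → ℝ := fun σ => bump (μ * σ) * k σ with hF
    set F' : ℝ → ℝ := fun σ => deriv bump (μ * σ) * μ * k σ + bump (μ * σ) * deriv k σ with hF'
    set F'' : ℝ → ℝ := fun σ => (deriv (deriv bump) (μ * σ) * μ * μ * k σ
      + deriv bump (μ * σ) * μ * deriv k σ)
      + (deriv bump (μ * σ) * μ * deriv k σ + bump (μ * σ) * deriv (deriv k) σ) with hF''
    have hFd : ∀ σ ∈ Set.Icc c C, HasDerivAt F (F' σ) σ := fun σ hσ => (hb σ).mul (hkd σ hσ)
    have hF'd : ∀ σ ∈ Set.Icc c C, HasDerivAt F' (F'' σ) σ := fun σ hσ =>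
      (((hb' σ).mul_const μ).mul (hkd σ hσ)).add ((hb σ).mul (hkd' σ hσ))
    have hF'c : ContinuousOn F' (Set.Icc c C) := fun σ hσ =>
      (hF'd σ hσ).continuousAt.continuousWithinAt
    have hF''c : ContinuousOn F'' (Set.Icc c C) := by
      refine ContinuousOn.add (ContinuousOn.add (ContinuousOn.mul ?_ hkc) (ContinuousOn.mul ?_ hk'c))
        (ContinuousOn.add (ContinuousOn.mul ?_ hk'c) (cb.continuousOn.mul hk''c))
      all_goals exact Continuous.continuousOn (by fun_prop)
    set E : ℝ → ℂ := fun σ => addExp (Y * centredPhase α σ) with hE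
    have hEd : ∀ σ ∈ Set.Icc c C, HasDerivAt E
        (2 * Real.pi * Complex.I * (Y * (σ ^ (α - 1) - 1) : ℝ) * E σ) σ := fun σ hσ =>
      hasDerivAt_addExp_centredPhase hα0 (hsub hσ) Y
    have hEc : ContinuousOn E (Set.Icc c C) := fun σ hσ =>
      (hEd σ hσ).continuousAt.continuousWithinAt
    have hE'c : ContinuousOn
        (fun σ => 2 * Real.pi * Complex.I * (Y * (σ ^ (α - 1) - 1) : ℝ) * E σ) (Set.Icc c C) := by
      refine ContinuousOn.mul (continuousOn_const.mul ?_) hEc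
      exact Complex.continuous_ofReal.comp_continuousOn
        (continuousOn_const.mul ((continuousOn_rpow_sub_one α).mono hsub))
    have hibp := intervalIntegral.integral_mul_deriv_eq_deriv_mul (a := c) (b := C)
      (u := fun σ => (F σ : ℂ)) (v := E) (u' := fun σ => (F' σ : ℂ))
      (v' := fun σ => 2 * Real.pi * Complex.I * (Y * (σ ^ (α - 1) - 1) : ℝ) * E σ)
      (fun σ hσ => (hFd σ (huIcc ▸ hσ)).ofReal_comp) (fun σ hσ => hEd σ (huIcc ▸ hσ))
      (((Complex.continuous_ofReal.comp_continuousOn hF'c).intervalIntegrable_of_Icc hcC))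
      (hE'c.intervalIntegrable_of_Icc hcC)
    have hFc : F c = 0 := by simp [hF, z0.1]
    have hFC : F C = 0 := by simp [hF, z0.2]
    rw [hFc, hFC, Complex.ofReal_zero, zero_mul, zero_mul, sub_zero, zero_sub] at hibp
    have h2pi : (2 * Real.pi * Complex.I : ℂ) ≠ 0 := by simp [Real.pi_ne_zero]
    have hkey : (Y : ℂ) * ∫ σ in c..C, (bump (μ * σ) * (σ - 1) : ℝ) * E σ
        = -((2 * Real.pi * Complex.I)⁻¹ * ∫ σ in c..C, (F' σ : ℂ) * E σ) := by
      rw [← mul_neg, ← hibp, ← intervalIntegral.integral_const_mul,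
        ← intervalIntegral.integral_const_mul]
      refine intervalIntegral.integral_congr fun σ hσ => ?_
      rw [huIcc] at hσ
      simp only [hF]
      rw [← hkeq σ (hsub hσ)]
      push_cast
      field_simp
    have hpi : ‖(2 * Real.pi * Complex.I : ℂ)⁻¹‖ ≤ 1 := by
      rw [norm_inv]
      refine inv_le_one_of_one_le₀ ?_
      rw [norm_mul, norm_mul, Complex.norm_I, Complex.norm_real, Real.norm_of_nonneg Real.pi_pos.le,
        Complex.norm_ofNat]
      linarith [Real.pi_gt_three]
    change ‖(Y : ℂ) * ∫ σ in c..C, (bump (μ * σ) * (σ - 1) : ℝ) * E σ‖ ≤ _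
    rw [hkey, norm_neg, norm_mul]
    refine (mul_le_of_le_one_left (norm_nonneg _) hpi).trans ?_
    refine hvdc (fun σ => (F' σ : ℂ)) (fun σ => (F'' σ : ℂ)) Bt Y hY
      (fun σ hσ => (hF'd σ hσ).ofReal_comp) (Complex.continuous_ofReal.comp_continuousOn hF''c)
      (by simp [hF', z0.1, z1.1]) (by simp [hF', z0.2, z1.2]) ?_ ?_
    · intro σ hσ
      obtain ⟨b0, b1, -⟩ := hbump (μ * σ)
      have k0 : |k σ| ≤ K0 := hK0 σ hσ
      have k1 : |deriv k σ| ≤ K1 := hK1 σ hσ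
      rw [Complex.norm_real, Real.norm_eq_abs]
      refine (abs_add_le _ _).trans ?_
      rw [abs_mul, abs_mul, abs_mul, abs_of_pos hμ]
      have e1 : |deriv bump (μ * σ)| * μ * |k σ| ≤ B * (1 + M) ^ 2 * K0 := by
        have : μ ≤ (1 + M) ^ 2 := hμM.trans hM2
        gcongr
      have e2 : |bump (μ * σ)| * |deriv k σ| ≤ B * (1 + M) ^ 2 * K1 := by
        have : |bump (μ * σ)| ≤ B * (1 + M) ^ 2 := b0.trans (le_mul_of_one_le_right hB.le hM1)
        gcongr
      have e3 : 0 ≤ B * (1 + M) ^ 2 := by positivity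
      rw [hBt']
      linarith [mul_nonneg e3 hK0p, mul_nonneg e3 hK1p, mul_nonneg e3 hK2p]
    · intro σ hσ
      obtain ⟨b0, b1, b2⟩ := hbump (μ * σ)
      have k0 : |k σ| ≤ K0 := hK0 σ hσ
      have k1 : |deriv k σ| ≤ K1 := hK1 σ hσ
      have k2 : |deriv (deriv k) σ| ≤ K2 := hK2 σ hσ
      rw [Complex.norm_real, Real.norm_eq_abs]
      have e1 : |deriv (deriv bump) (μ * σ) * μ * μ * k σ| ≤ B * (1 + M) ^ 2 * K0 := by
        rw [abs_mul, abs_mul, abs_mul, abs_of_pos hμ, mul_assoc (|_|) μ μ]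
        have : μ * μ ≤ (1 + M) ^ 2 := by nlinarith
        gcongr
      have e2 : |deriv bump (μ * σ) * μ * deriv k σ| ≤ B * (1 + M) ^ 2 * K1 := by
        rw [abs_mul, abs_mul, abs_of_pos hμ]
        have : μ ≤ (1 + M) ^ 2 := hμM.trans hM2
        gcongr
      have e3 : |bump (μ * σ) * deriv (deriv k) σ| ≤ B * (1 + M) ^ 2 * K2 := by
        rw [abs_mul]
        have : |bump (μ * σ)| ≤ B * (1 + M) ^ 2 := b0.trans (le_mul_of_one_le_right hB.le hM1)
        gcongr
      have e4 : 0 ≤ B * (1 + M) ^ 2 := by positivity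
      refine (abs_add_le _ _).trans ?_
      have a1 := abs_add_le (deriv (deriv bump) (μ * σ) * μ * μ * k σ)
        (deriv bump (μ * σ) * μ * deriv k σ)
      have a2 := abs_add_le (deriv bump (μ * σ) * μ * deriv k σ)
        (bump (μ * σ) * deriv (deriv k) σ)
      rw [hBt']
      linarith [mul_nonneg e4 hK0p, mul_nonneg e4 hK1p, mul_nonneg e4 hK2p]

theorem measurable_powPhase (α : ℝ) : Measurable (powPhase α) := by
  unfold powPhase; fun_prop

/-- Removing the critical value makes the derivative of the phase in `lam` proportional to `μ - s`,
with `μ = lam^(1/(α-1))` the stationary point. It vanishes there, so the amplitude varies slowly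
although `oscInt` oscillates. -/
theorem hasDerivAt_oscAmp {α lam : ℝ} (hα0 : α ≠ 0) (hα1 : α < 1) (hlam : 0 < lam) (x : ℝ) :
    HasDerivAt (oscAmp α x) (∫ s, (bump s : ℂ) *
      (2 * Real.pi * Complex.I * (x * (lam ^ (1 / (α - 1)) - s) : ℝ)) *
      addExp (x * (powPhase α s - lam * s + powPhase (α / (α - 1)) lam))) lam := by
  have hα1' : α - 1 ≠ 0 := by linarith
  have hneg : 1 / (α - 1) ≤ 0 := by
    rw [one_div]; exact inv_nonpos.2 (by linarith)
  have hexp : α / (α - 1) - 1 = 1 / (α - 1) := by field_simp; ring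
  have hdual : α / (α - 1) ≠ 0 := div_ne_zero hα0 hα1'
  have hmeas := measurable_powPhase α
  have hbm : Measurable bump := continuous_bump.measurable
  have hem : Measurable addExp := continuous_addExp.measurable
  have hbint : Integrable bump := continuous_bump.integrable_of_hasCompactSupport
    hasCompactSupport_bump
  refine (hasDerivAt_integral_of_dominated_loc_of_deriv_le
    (F := fun lam s => (bump s : ℂ) *
      addExp (x * (powPhase α s - lam * s + powPhase (α / (α - 1)) lam)))
    (F' := fun lam s => (bump s : ℂ) *
      (2 * Real.pi * Complex.I * (x * (lam ^ (1 / (α - 1)) - s) : ℝ)) *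
      addExp (x * (powPhase α s - lam * s + powPhase (α / (α - 1)) lam)))
    (bound := fun s => bump s * (2 * Real.pi * (|x| * ((lam / 2) ^ (1 / (α - 1)) + 5 / 2))))
    (s := Set.Ioi (lam / 2)) (Ioi_mem_nhds (by linarith)) ?_ ?_ ?_ ?_ ?_ ?_).2
  · exact Filter.Eventually.of_forall fun l => Measurable.aestronglyMeasurable (by fun_prop)
  · refine hbint.mono' (Measurable.aestronglyMeasurable (by fun_prop))
      (Filter.Eventually.of_forall fun s => ?_)
    rw [norm_mul, norm_addExp, mul_one, Complex.norm_real, Real.norm_of_nonneg (bump_nonneg s)]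
  · exact Measurable.aestronglyMeasurable (by fun_prop)
  · refine Filter.Eventually.of_forall fun s l hl => ?_
    have hl' : lam / 2 < l := hl
    by_cases hs : s ∈ Set.Ioo (1 / 2 : ℝ) (5 / 2)
    · rw [norm_mul, norm_mul, norm_addExp, mul_one, Complex.norm_real,
        Real.norm_of_nonneg (bump_nonneg s)]
      refine mul_le_mul_of_nonneg_left ?_ (bump_nonneg s)
      rw [norm_mul, norm_mul, norm_mul, Complex.norm_I, Complex.norm_real, Complex.norm_real,
        Real.norm_of_nonneg Real.pi_pos.le, Complex.norm_ofNat, mul_one, norm_mul,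
        Real.norm_eq_abs, Real.norm_eq_abs]
      gcongr
      have h1 : l ^ (1 / (α - 1)) ≤ (lam / 2) ^ (1 / (α - 1)) :=
        Real.rpow_le_rpow_of_nonpos (by linarith) hl'.le hneg
      have h2 : 0 < l ^ (1 / (α - 1)) := Real.rpow_pos_of_pos (by linarith) _
      rw [abs_le]
      constructor <;> linarith [hs.1, hs.2]
    · simp [bump_eq_zero' hs]
  · exact hbint.mul_const _
  · refine Filter.Eventually.of_forall fun s l hl => ?_
    have hl' : 0 < l := lt_trans (by linarith) (show lam / 2 < l from hl)
    have h1 := hasDerivAt_powPhase hdual hl'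
    rw [hexp] at h1
    have h2 : HasDerivAt (fun l => x * (powPhase α s - l * s + powPhase (α / (α - 1)) l))
        (x * (l ^ (1 / (α - 1)) - s)) l := by
      have h3 := ((((hasDerivAt_id l).mul_const s).const_sub (powPhase α s)).add h1).const_mul x
      refine h3.congr_deriv ?_
      ring
    have h4 := ((hasDerivAt_addExp _).scomp l h2).const_mul (bump s : ℂ)
    refine h4.congr_deriv ?_
    rw [Complex.real_smul]; push_cast; ring

/-- Size and Lipschitz bounds for the amplitude of the oscillatory integral. -/
theorem exists_oscAmp_bounds {α la lb : ℝ} (hα0 : α ≠ 0) (hα1 : α < 1) (hla : 0 < la)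
    (hlab : la ≤ lb) :
    ∃ D : ℝ, 0 < D ∧ ∀ x : ℝ, 0 < x →
      (∀ lam ∈ Set.Icc la lb, ‖oscAmp α x lam‖ ≤ D / Real.sqrt x) ∧
      ∀ lam ∈ Set.Icc la lb, ∀ lam' ∈ Set.Icc la lb,
        ‖oscAmp α x lam - oscAmp α x lam'‖ ≤ D / Real.sqrt x * |lam - lam'| := by
  have hα1' : α - 1 ≠ 0 := by linarith
  have hαne : α ≠ 1 := hα1.ne
  have hneg : 1 / (α - 1) ≤ 0 := by
    rw [one_div]; exact inv_nonpos.2 (by linarith)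
  set μa := lb ^ (1 / (α - 1)) with hμa
  set μb := la ^ (1 / (α - 1)) with hμb
  have hμap : 0 < μa := Real.rpow_pos_of_pos (by linarith) _
  have hμbp : 0 < μb := Real.rpow_pos_of_pos hla _
  have hμab : μa ≤ μb := Real.rpow_le_rpow_of_nonpos hla hlab hneg
  -- The interval `[c, C]` is chosen so that `μ σ` covers `[1/2, 5/2]` for every stationary point
  -- `μ` in `[μa, μb]`; a single constant then serves all frequencies.
  set c := 1 / (2 * μb) with hc
  set C := 5 / (2 * μa) with hC
  have hcp : 0 < c := by positivity
  have hcC : c ≤ C := by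
    rw [hc, hC, div_le_div_iff₀ (by positivity) (by positivity)]
    linarith
  obtain ⟨D, hD, hbd⟩ := exists_scaled_bump_bound (M := μb) hα0 hαne hcp hcC hμbp.le
  have hcont : ContinuousOn (fun μ : ℝ => μ / Real.sqrt (μ ^ α)) (Set.Icc μa μb) := by
    intro μ hμ
    have : 0 < μ := lt_of_lt_of_le hμap hμ.1
    refine ContinuousAt.continuousWithinAt ?_
    refine continuousAt_id.div ?_ (Real.sqrt_pos.2 (Real.rpow_pos_of_pos this _)).ne'
    exact (Real.continuousAt_rpow_const _ _ (Or.inl this.ne')).sqrt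
  have hcont2 : ContinuousOn (fun μ : ℝ => μ ^ 2 / (μ ^ α * Real.sqrt (μ ^ α)))
      (Set.Icc μa μb) := by
    intro μ hμ
    have : 0 < μ := lt_of_lt_of_le hμap hμ.1
    have hp := Real.rpow_pos_of_pos this α
    have hca := Real.continuousAt_rpow_const μ α (Or.inl this.ne')
    refine ContinuousAt.continuousWithinAt ?_
    exact (continuousAt_id.pow 2).div (hca.mul hca.sqrt)
      (mul_pos hp (Real.sqrt_pos.2 hp)).ne'
  obtain ⟨E1, hE1⟩ := isCompact_Icc.exists_bound_of_continuousOn hcont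
  obtain ⟨E2, hE2⟩ := isCompact_Icc.exists_bound_of_continuousOn hcont2
  have hE1p : 0 ≤ E1 := (norm_nonneg _).trans (hE1 μa ⟨le_rfl, hμab⟩)
  have hE2p : 0 ≤ E2 := (norm_nonneg _).trans (hE2 μa ⟨le_rfl, hμab⟩)
  refine ⟨D * E1 + 2 * Real.pi * D * E2 + 1, by positivity, ?_⟩
  intro x hx
  have hsx := Real.sqrt_pos.2 hx
  have hμ : ∀ lam ∈ Set.Icc la lb, ∃ μ ∈ Set.Icc μa μb, lam ^ (1 / (α - 1)) = μ ∧
      lam = μ ^ (α - 1) ∧ μ * c ≤ 1 / 2 ∧ 5 / 2 ≤ μ * C := by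
    intro lam hlam
    have hl : 0 < lam := lt_of_lt_of_le hla hlam.1
    have h1 : lam ^ (1 / (α - 1)) ∈ Set.Icc μa μb :=
      ⟨Real.rpow_le_rpow_of_nonpos hl hlam.2 hneg, Real.rpow_le_rpow_of_nonpos hla hlam.1 hneg⟩
    refine ⟨_, h1, rfl, ?_, ?_, ?_⟩
    · rw [← Real.rpow_mul hl.le, one_div_mul_cancel hα1', Real.rpow_one]
    · rw [hc, mul_one_div, div_le_div_iff₀ (by positivity) two_pos]; linarith [h1.2]
    · rw [hC, mul_div_assoc', div_le_div_iff₀ two_pos (by positivity)]; linarith [h1.1]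
  have hfirst : ∀ lam ∈ Set.Icc la lb, ‖oscAmp α x lam‖ ≤ D * E1 / Real.sqrt x := by
    intro lam hlam
    obtain ⟨μ, hμm, -, rfl, h3, h4⟩ := hμ lam hlam
    have hμp : 0 < μ := lt_of_lt_of_le hμap hμm.1
    have hp := Real.rpow_pos_of_pos hμp α
    rw [oscAmp, integral_mul_addExp_scaled hα0 hαne hμp hcp h3 h4 x (fun s => (bump s : ℂ))
      (fun s hs => by rw [bump_eq_zero' hs, Complex.ofReal_zero]), norm_mul, Complex.norm_real,
      Real.norm_of_nonneg hμp.le]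
    have h5 := (hbd μ (x * μ ^ α) hμp hμm.2 h3 h4 (by positivity)).1
    have h6 := hE1 μ hμm
    rw [Real.norm_of_nonneg (by positivity)] at h6
    calc _ ≤ μ * (D / Real.sqrt (x * μ ^ α)) := by gcongr
      _ = D * (μ / Real.sqrt (μ ^ α)) / Real.sqrt x := by
        rw [Real.sqrt_mul hx.le]; field_simp
      _ ≤ _ := by gcongr
  have hsecond : ∀ lam ∈ Set.Icc la lb, ‖∫ s, (bump s : ℂ) *
      (2 * Real.pi * Complex.I * (x * (lam ^ (1 / (α - 1)) - s) : ℝ)) *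
      addExp (x * (powPhase α s - lam * s + powPhase (α / (α - 1)) lam))‖
      ≤ 2 * Real.pi * D * E2 / Real.sqrt x := by
    intro lam hlam
    obtain ⟨μ, hμm, hμl, hμl2, h3, h4⟩ := hμ lam hlam
    rw [hμl]
    subst hμl2
    have hμp : 0 < μ := lt_of_lt_of_le hμap hμm.1
    have hp := Real.rpow_pos_of_pos hμp α
    rw [integral_mul_addExp_scaled hα0 hαne hμp hcp h3 h4 x
      (fun s => (bump s : ℂ) * (2 * Real.pi * Complex.I * (x * (μ - s) : ℝ)))
      (fun s hs => by rw [bump_eq_zero' hs, Complex.ofReal_zero, zero_mul])]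
    have h7 : (μ : ℂ) * ∫ σ in c..C, (bump (μ * σ) : ℂ) * (2 * Real.pi * Complex.I *
        (x * (μ - μ * σ) : ℝ)) * addExp (x * μ ^ α * centredPhase α σ)
        = -(2 * Real.pi * Complex.I) * ((μ ^ 2 / μ ^ α : ℝ) : ℂ) * (((x * μ ^ α : ℝ) : ℂ) *
          ∫ σ in c..C, (bump (μ * σ) * (σ - 1) : ℝ) * addExp (x * μ ^ α * centredPhase α σ)) := by
      rw [← intervalIntegral.integral_const_mul, ← intervalIntegral.integral_const_mul,
        ← intervalIntegral.integral_const_mul]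
      refine intervalIntegral.integral_congr fun σ _ => ?_
      have : ((μ ^ α : ℝ) : ℂ) ≠ 0 := by exact_mod_cast hp.ne'
      push_cast
      field_simp
      ring
    rw [h7]
    have h5 := (hbd μ (x * μ ^ α) hμp hμm.2 h3 h4 (by positivity)).2
    have h6 := hE2 μ hμm
    rw [Real.norm_of_nonneg (by positivity)] at h6
    rw [norm_mul, norm_mul, norm_neg, norm_mul, norm_mul, Complex.norm_I, Complex.norm_real,
      Complex.norm_real, Real.norm_of_nonneg Real.pi_pos.le, Complex.norm_ofNat, mul_one,
      Real.norm_of_nonneg (by positivity : 0 ≤ μ ^ 2 / μ ^ α)]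
    calc _ ≤ 2 * Real.pi * (μ ^ 2 / μ ^ α) * (D / Real.sqrt (x * μ ^ α)) := by gcongr
      _ = 2 * Real.pi * D * (μ ^ 2 / (μ ^ α * Real.sqrt (μ ^ α))) / Real.sqrt x := by
        rw [Real.sqrt_mul hx.le]; field_simp
      _ ≤ _ := by gcongr
  constructor
  · intro lam hlam
    refine (hfirst lam hlam).trans ?_
    gcongr
    have : 0 ≤ 2 * Real.pi * D * E2 := by positivity
    linarith
  · intro lam hlam lam' hlam'
    have h := Convex.norm_image_sub_le_of_norm_hasDerivWithin_le (f := oscAmp α x)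
      (s := Set.Icc la lb) (C := 2 * Real.pi * D * E2 / Real.sqrt x)
      (fun l hl => (hasDerivAt_oscAmp hα0 hα1 (lt_of_lt_of_le hla hl.1) x).hasDerivWithinAt)
      hsecond (convex_Icc la lb) hlam' hlam
    rw [Real.norm_eq_abs] at h
    refine h.trans ?_
    gcongr
    have : 0 ≤ D * E1 := by positivity
    linarith

/-- Repeated integration by parts away from stationary points. -/
theorem norm_integral_mul_addExp_nonstationary_le {c C x m κ P1 P2 B : ℝ} (hcC : c ≤ C)
    (hx : 0 < x) (hm : 0 < m) (hκ : 0 < κ) {ph p p' p'' b b' b'' : ℝ → ℝ}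
    (hph : ∀ s ∈ Set.Icc c C, HasDerivAt ph (m * p s) s)
    (hp : ∀ s ∈ Set.Icc c C, HasDerivAt p (p' s) s)
    (hp' : ∀ s ∈ Set.Icc c C, HasDerivAt p' (p'' s) s) (hp''c : ContinuousOn p'' (Set.Icc c C))
    (hpκ : ∀ s ∈ Set.Icc c C, κ ≤ |p s|) (hP1 : ∀ s ∈ Set.Icc c C, |p' s| ≤ P1)
    (hP2 : ∀ s ∈ Set.Icc c C, |p'' s| ≤ P2)
    (hb : ∀ s, HasDerivAt b (b' s) s) (hb' : ∀ s, HasDerivAt b' (b'' s) s)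
    (hb''c : Continuous b'') (hB : ∀ s, |b s| ≤ B ∧ |b' s| ≤ B ∧ |b'' s| ≤ B)
    (hbc : b c = 0) (hbC : b C = 0) (hb'c : b' c = 0) (hb'C : b' C = 0) :
    ‖∫ s in c..C, (b s : ℂ) * addExp (x * ph s)‖
      ≤ B * (1 / κ + 2 * (P1 / κ ^ 2) + (P2 / κ ^ 2 + 2 * P1 ^ 2 / κ ^ 3)) ^ 2 * (C - c) / (x * m) ^ 2 := by
  have huIcc : Set.uIcc c C = Set.Icc c C := Set.uIcc_of_le hcC
  have hcmem : c ∈ Set.Icc c C := Set.left_mem_Icc.2 hcC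
  have hP1p : 0 ≤ P1 := (abs_nonneg _).trans (hP1 c hcmem)
  have hP2p : 0 ≤ P2 := (abs_nonneg _).trans (hP2 c hcmem)
  have hBp : 0 ≤ B := (abs_nonneg _).trans (hB c).1
  have hp0 : ∀ s ∈ Set.Icc c C, p s ≠ 0 := fun s hs =>
    abs_pos.1 (lt_of_lt_of_le hκ (hpκ s hs))
  set E : ℝ → ℂ := fun s => addExp (x * ph s) with hE
  have hEd : ∀ s ∈ Set.Icc c C,
      HasDerivAt E (2 * Real.pi * Complex.I * (x * m * p s : ℝ) * E s) s := by
    intro s hs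
    have h2 := (hasDerivAt_addExp (x * ph s)).scomp s ((hph s hs).const_mul x)
    refine h2.congr_deriv ?_
    rw [Complex.real_smul]; push_cast; ring
  have hEc : ContinuousOn E (Set.Icc c C) := fun s hs => (hEd s hs).continuousAt.continuousWithinAt
  have hpc : ContinuousOn p (Set.Icc c C) := fun s hs => (hp s hs).continuousAt.continuousWithinAt
  have hp'c : ContinuousOn p' (Set.Icc c C) :=
    fun s hs => (hp' s hs).continuousAt.continuousWithinAt
  have hE'c : ContinuousOn (fun s => 2 * Real.pi * Complex.I * (x * m * p s : ℝ) * E s)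
      (Set.Icc c C) :=
    (continuousOn_const.mul (Complex.continuous_ofReal.comp_continuousOn
      (continuousOn_const.mul hpc))).mul hEc
  have h2pi : (2 * Real.pi * Complex.I : ℂ) ≠ 0 := by simp [Real.pi_ne_zero]
  -- One integration by parts gains `1 / (x m)`; it is used twice, first for `b` and then for the
  -- derivative of `b / p`.
  have hstep : ∀ F F' : ℝ → ℝ, (∀ s ∈ Set.Icc c C, HasDerivAt (fun s => F s * (p s)⁻¹) (F' s) s) →
      ContinuousOn F' (Set.Icc c C) → F c = 0 → F C = 0 →
      ‖∫ s in c..C, (F s : ℂ) * E s‖ ≤ 1 / (x * m) * ‖∫ s in c..C, (F' s : ℂ) * E s‖ := by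
    intro F F' hF hF'c hFc hFC
    have hibp := intervalIntegral.integral_mul_deriv_eq_deriv_mul (a := c) (b := C)
      (u := fun s => ((F s * (p s)⁻¹ : ℝ) : ℂ)) (v := E) (u' := fun s => (F' s : ℂ))
      (v' := fun s => 2 * Real.pi * Complex.I * (x * m * p s : ℝ) * E s)
      (fun s hs => (hF s (huIcc ▸ hs)).ofReal_comp) (fun s hs => hEd s (huIcc ▸ hs))
      ((Complex.continuous_ofReal.comp_continuousOn hF'c).intervalIntegrable_of_Icc hcC)
      (hE'c.intervalIntegrable_of_Icc hcC)
    rw [hFc, hFC] at hibp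
    simp only [zero_mul, Complex.ofReal_zero, sub_zero, zero_sub] at hibp
    have hkey : ∫ s in c..C, (F s : ℂ) * E s
        = (2 * Real.pi * Complex.I * (x * m : ℝ))⁻¹ * -∫ s in c..C, (F' s : ℂ) * E s := by
      rw [← hibp, ← intervalIntegral.integral_const_mul]
      refine intervalIntegral.integral_congr fun s hs => ?_
      rw [huIcc] at hs
      have h1 : (p s : ℂ) ≠ 0 := by exact_mod_cast hp0 s hs
      have h2 : (x : ℂ) ≠ 0 := by exact_mod_cast hx.ne'
      have h3 : (m : ℂ) ≠ 0 := by exact_mod_cast hm.ne'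
      push_cast
      field_simp
    rw [hkey, norm_mul, norm_neg, norm_inv, norm_mul, norm_mul, norm_mul, Complex.norm_I,
      Complex.norm_real, Complex.norm_real, Complex.norm_ofNat, Real.norm_of_nonneg Real.pi_pos.le,
      Real.norm_of_nonneg (by positivity)]
    gcongr
    rw [one_div]
    refine inv_anti₀ (by positivity) ?_
    have := Real.pi_gt_three
    have : 0 < x * m := by positivity
    nlinarith
  set F1 : ℝ → ℝ := fun s => b' s * (p s)⁻¹ + b s * (-p' s / p s ^ 2) with hF1
  have hinv : ∀ s ∈ Set.Icc c C, HasDerivAt (fun s => (p s)⁻¹) (-p' s / p s ^ 2) s :=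
    fun s hs => (hp s hs).inv (hp0 s hs)
  have hinv2 : ∀ s ∈ Set.Icc c C, HasDerivAt (fun s => -p' s / p s ^ 2)
      (-p'' s / p s ^ 2 + 2 * p' s ^ 2 / p s ^ 3) s := by
    intro s hs
    have h := ((hp' s hs).neg).div ((hp s hs).pow 2) (pow_ne_zero 2 (hp0 s hs))
    refine h.congr_deriv ?_
    have := hp0 s hs
    simp only [Pi.pow_apply, Pi.neg_apply]
    field_simp
    ring
  have hF1d : ∀ s ∈ Set.Icc c C, HasDerivAt (fun s => b s * (p s)⁻¹) (F1 s) s :=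
    fun s hs => (hb s).mul (hinv s hs)
  have hF1c : ContinuousOn F1 (Set.Icc c C) := by
    have c1 : ContinuousOn b' (Set.Icc c C) := fun s _ => (hb' s).continuousAt.continuousWithinAt
    have c2 : ContinuousOn b (Set.Icc c C) := fun s _ => (hb s).continuousAt.continuousWithinAt
    exact (c1.mul (hpc.inv₀ hp0)).add (c2.mul
      (hp'c.neg.div (hpc.pow 2) fun s hs => pow_ne_zero 2 (hp0 s hs)))
  set G : ℝ → ℝ := fun s => b'' s * (p s)⁻¹ + b' s * (-p' s / p s ^ 2)
      + (b' s * (-p' s / p s ^ 2) + b s * (-p'' s / p s ^ 2 + 2 * p' s ^ 2 / p s ^ 3)) with hG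
  have hF1d' : ∀ s ∈ Set.Icc c C, HasDerivAt F1 (G s) s := fun s hs =>
    ((hb' s).mul (hinv s hs)).add ((hb s).mul (hinv2 s hs))
  set H : ℝ → ℝ := fun s => G s * (p s)⁻¹ + F1 s * (-p' s / p s ^ 2) with hH
  have hGc : ContinuousOn G (Set.Icc c C) := by
    have c0 : ContinuousOn b'' (Set.Icc c C) := hb''c.continuousOn
    have c1 : ContinuousOn b' (Set.Icc c C) := fun s _ => (hb' s).continuousAt.continuousWithinAt
    have c2 : ContinuousOn b (Set.Icc c C) := fun s _ => (hb s).continuousAt.continuousWithinAt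
    have c3 : ContinuousOn (fun s => -p' s / p s ^ 2) (Set.Icc c C) :=
      hp'c.neg.div (hpc.pow 2) fun s hs => pow_ne_zero 2 (hp0 s hs)
    have c4 : ContinuousOn (fun s => -p'' s / p s ^ 2 + 2 * p' s ^ 2 / p s ^ 3) (Set.Icc c C) :=
      (hp''c.neg.div (hpc.pow 2) fun s hs => pow_ne_zero 2 (hp0 s hs)).add
        ((continuousOn_const.mul (hp'c.pow 2)).div (hpc.pow 3)
          fun s hs => pow_ne_zero 3 (hp0 s hs))
    exact ((c0.mul (hpc.inv₀ hp0)).add (c1.mul c3)).add ((c1.mul c3).add (c2.mul c4))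
  have hHd : ∀ s ∈ Set.Icc c C, HasDerivAt (fun s => F1 s * (p s)⁻¹) (H s) s := fun s hs =>
    (hF1d' s hs).mul (hinv s hs)
  have hHc : ContinuousOn H (Set.Icc c C) :=
    (hGc.mul (hpc.inv₀ hp0)).add (hF1c.mul
      (hp'c.neg.div (hpc.pow 2) fun s hs => pow_ne_zero 2 (hp0 s hs)))
  set Q1 := P1 / κ ^ 2 with hQ1
  set Q2 := P2 / κ ^ 2 + 2 * P1 ^ 2 / κ ^ 3 with hQ2
  have hQ1p : 0 ≤ Q1 := by positivity
  have hQ2p : 0 ≤ Q2 := by positivity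
  have hκi : 0 ≤ 1 / κ := by positivity
  -- `W` dominates the sizes of `1/p` and its first two derivatives together, so each of the two
  -- integrations by parts costs at most one factor `W`.
  set W := 1 / κ + 2 * Q1 + Q2 with hW
  have hWp : 0 ≤ W := by positivity
  have hHb : ∀ s ∈ Set.Icc c C, |H s| ≤ B * W ^ 2 := by
    intro s hs
    obtain ⟨b0, b1, b2⟩ := hB s
    have hk := hpκ s hs
    have q0 : |(p s)⁻¹| ≤ 1 / κ := by
      rw [abs_inv, one_div]; exact inv_anti₀ hκ hk
    have q1 : |-p' s / p s ^ 2| ≤ Q1 := by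
      rw [abs_div, abs_neg, abs_pow]
      exact div_le_div₀ hP1p (hP1 s hs) (by positivity) (by gcongr)
    have q2 : |-p'' s / p s ^ 2 + 2 * p' s ^ 2 / p s ^ 3| ≤ Q2 := by
      refine (abs_add_le _ _).trans (add_le_add ?_ ?_)
      · rw [abs_div, abs_neg, abs_pow]
        exact div_le_div₀ hP2p (hP2 s hs) (by positivity) (by gcongr)
      · rw [abs_div, abs_mul, abs_pow, abs_pow, abs_two]
        exact div_le_div₀ (by positivity) (by have := hP1 s hs; gcongr) (by positivity) (by gcongr)
    have f1 : |F1 s| ≤ B * (1 / κ) + B * Q1 := by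
      refine (abs_add_le _ _).trans ?_
      rw [abs_mul, abs_mul]; gcongr
    have g : |G s| ≤ (B * (1 / κ) + B * Q1) + (B * Q1 + B * Q2) := by
      refine (abs_add_le _ _).trans (add_le_add ((abs_add_le _ _).trans ?_)
        ((abs_add_le _ _).trans ?_))
      · rw [abs_mul, abs_mul]; gcongr
      · rw [abs_mul, abs_mul]; gcongr
    have g' : |G s| ≤ B * W := by rw [hW]; linarith
    have f' : |F1 s| ≤ B * W := by
      have : 0 ≤ B * (Q1 + Q2) := by positivity
      rw [hW]; linarith
    calc |H s| ≤ |G s| * |(p s)⁻¹| + |F1 s| * |-p' s / p s ^ 2| := by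
          refine (abs_add_le _ _).trans ?_
          rw [abs_mul, abs_mul]
      _ ≤ B * W * (1 / κ) + B * W * Q1 := by gcongr
      _ = B * W * (1 / κ + Q1) := by ring
      _ ≤ B * W * W := by gcongr; rw [hW]; linarith
      _ = _ := by ring
  have hF1c0 : F1 c = 0 := by simp [hF1, hbc, hb'c]
  have hF1C0 : F1 C = 0 := by simp [hF1, hbC, hb'C]
  have s1 := hstep b F1 hF1d hF1c hbc hbC
  have s2 := hstep F1 H hHd hHc hF1c0 hF1C0
  have s3 : ‖∫ s in c..C, (H s : ℂ) * E s‖ ≤ B * W ^ 2 * (C - c) := by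
    have := intervalIntegral.norm_integral_le_of_norm_le_const (a := c) (b := C)
      (C := B * W ^ 2) (f := fun s => (H s : ℂ) * E s) (by
        intro s hs
        rw [Set.uIoc_of_le hcC] at hs
        rw [norm_mul, norm_addExp, mul_one, Complex.norm_real]
        exact hHb s ⟨hs.1.le, hs.2⟩)
    rwa [abs_of_nonneg (by linarith)] at this
  have hxm : 0 ≤ 1 / (x * m) := by positivity
  calc ‖∫ s in c..C, (b s : ℂ) * E s‖ ≤ 1 / (x * m) * (1 / (x * m) * (B * W ^ 2 * (C - c))) :=
        s1.trans (mul_le_mul_of_nonneg_left (s2.trans (mul_le_mul_of_nonneg_left s3 hxm)) hxm)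
    _ = _ := by field_simp

/-- Bound for the oscillatory integral when the phase has no stationary point. -/
theorem exists_oscInt_tail_bound {α : ℝ} (hα0 : α ≠ 0) (hα1 : α < 1) :
    ∃ la lb D : ℝ, 0 < la ∧ la ≤ lb ∧ 0 < D ∧ ∀ x lam : ℝ, 0 < x → lam ∉ Set.Icc la lb →
      ‖oscInt α x lam‖ ≤ D / (x * (1 + |lam|)) ^ 2 := by
  obtain ⟨B, hB, hbump⟩ := exists_bump_bound
  -- On the support `s^(α-1)` lies in `[2a, d]`. For `lam` outside `[a, 2d]` the phase derivative is
  -- therefore at least a constant times `1 + |lam|`, and dividing by `1 + |lam|` makes all bounds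
  -- uniform in `lam`.
  set a : ℝ := (5 / 2 : ℝ) ^ (α - 1) / 2 with ha
  set d : ℝ := (1 / 2 : ℝ) ^ (α - 1) with hd
  have hap : 0 < a := by positivity
  have hrange : ∀ s ∈ Set.Icc (1 / 2 : ℝ) (5 / 2), 2 * a ≤ s ^ (α - 1) ∧ s ^ (α - 1) ≤ d := by
    intro s hs
    have hsp : 0 < s := by linarith [hs.1]
    constructor
    · rw [ha, mul_div_cancel₀ _ two_ne_zero]
      exact Real.rpow_le_rpow_of_nonpos hsp hs.2 (by linarith)
    · exact Real.rpow_le_rpow_of_nonpos (by norm_num) hs.1 (by linarith)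
  have hcont : ∀ r : ℝ, ContinuousOn (fun s : ℝ => s ^ r) (Set.Icc (1 / 2) (5 / 2)) := fun r =>
    ContinuousOn.rpow_const continuousOn_id fun s hs => Or.inl (by
      have := hs.1; change s ≠ 0; linarith)
  obtain ⟨P1, hP1⟩ := isCompact_Icc.exists_bound_of_continuousOn
    ((hcont (α - 1 - 1)).const_smul (α - 1))
  obtain ⟨P2, hP2⟩ := isCompact_Icc.exists_bound_of_continuousOn
    ((hcont (α - 1 - 1 - 1)).const_smul ((α - 1) * (α - 1 - 1)))
  have hmem : (1 : ℝ) ∈ Set.Icc (1 / 2 : ℝ) (5 / 2) := by norm_num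
  have hda : 2 * a ≤ d := by
    have := hrange 1 hmem; linarith [this.1, this.2]
  set κ : ℝ := a / (4 * (1 + a)) with hκ
  have hκp : 0 < κ := by positivity
  refine ⟨a, 2 * d, B * (1 / κ + 2 * (P1 / κ ^ 2) + (P2 / κ ^ 2 + 2 * P1 ^ 2 / κ ^ 3)) ^ 2 *
    (5 / 2 - 1 / 2) + 1, hap, by linarith, by positivity, ?_⟩
  intro x lam hx hlam
  have hm : 0 < 1 + |lam| := by positivity
  have hint : oscInt α x lam
      = ∫ s in (1 / 2 : ℝ)..(5 / 2), (bump s : ℂ) * addExp (x * (powPhase α s - lam * s)) := by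
    rw [oscInt, intervalIntegral.integral_eq_integral_of_support_subset]
    intro s hs
    rw [Function.mem_support] at hs
    by_contra h
    refine hs ?_
    rw [bump_eq_zero' fun h' => h ⟨h'.1, h'.2.le⟩, Complex.ofReal_zero, zero_mul]
  rw [hint]
  have hmi : 1 / (1 + |lam|) ≤ 1 := by
    rw [div_le_one hm]; linarith [abs_nonneg lam]
  have hpos : ∀ s ∈ Set.Icc (1 / 2 : ℝ) (5 / 2), 0 < s := fun s hs => by linarith [hs.1]
  have hz : (1 / 2 : ℝ) ∉ Set.Ioo (1 / 2 : ℝ) (5 / 2) := by simp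
  have hz' : (5 / 2 : ℝ) ∉ Set.Ioo (1 / 2 : ℝ) (5 / 2) := by simp
  refine (norm_integral_mul_addExp_nonstationary_le (c := 1 / 2) (C := 5 / 2) (x := x)
    (m := 1 + |lam|) (κ := κ) (P1 := P1) (P2 := P2) (B := B) (by norm_num) hx hm hκp
    (ph := fun s => powPhase α s - lam * s) (p := fun s => (s ^ (α - 1) - lam) / (1 + |lam|))
    (p' := fun s => (α - 1) * s ^ (α - 1 - 1) / (1 + |lam|))
    (p'' := fun s => (α - 1) * ((α - 1 - 1) * s ^ (α - 1 - 1 - 1)) / (1 + |lam|))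
    (b := bump) (b' := deriv bump) (b'' := deriv (deriv bump))
    ?_ ?_ ?_ ?_ ?_ ?_ ?_ hasDerivAt_bump hasDerivAt_deriv_bump continuous_deriv_deriv_bump hbump
    (bump_eq_zero' hz) (bump_eq_zero' hz') (deriv_bump_eq_zero hz) (deriv_bump_eq_zero hz')).trans ?_
  · intro s hs
    have h := (hasDerivAt_powPhase hα0 (hpos s hs)).sub ((hasDerivAt_id s).const_mul lam)
    refine h.congr_deriv ?_
    field_simp
  · intro s hs
    exact ((Real.hasDerivAt_rpow_const (Or.inl (hpos s hs).ne')).sub_const lam).div_const _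
  · intro s hs
    exact ((Real.hasDerivAt_rpow_const (Or.inl (hpos s hs).ne')).const_mul (α - 1)).div_const _
  · exact (continuousOn_const.mul (continuousOn_const.mul (hcont _))).div_const _
  · intro s hs
    obtain ⟨h1, h2⟩ := hrange s hs
    rw [abs_div, abs_of_pos hm, le_div_iff₀ hm]
    have hκ1 : κ * (1 + a) = a / 4 := by rw [hκ]; field_simp
    rw [Set.mem_Icc, not_and_or, not_le, not_le] at hlam
    rcases hlam with hl | hl
    · rw [abs_of_pos (show 0 < s ^ (α - 1) - lam by linarith)]
      have hκ4 : κ ≤ 1 := by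
        rw [hκ, div_le_one (by positivity)]; linarith
      rcases le_or_gt 0 lam with h0 | h0
      · rw [abs_of_nonneg h0]
        nlinarith
      · rw [abs_of_neg h0]
        nlinarith
    · have hl0 : 0 < lam := by linarith
      rw [abs_of_pos hl0, abs_sub_comm, abs_of_pos (show 0 < lam - s ^ (α - 1) by linarith)]
      have hla : a ≤ lam := by linarith
      have : κ * (1 + lam) ≤ lam / 4 := by
        have e : κ * (1 + lam) = a * (1 + lam) / (4 * (1 + a)) := by rw [hκ]; ring
        rw [e, div_le_div_iff₀ (by positivity) (by norm_num)]
        nlinarith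
      linarith
  · intro s hs
    have h := hP1 s hs
    rw [div_eq_mul_one_div, abs_mul, abs_of_pos (by positivity : 0 < 1 / (1 + |lam|))]
    calc _ ≤ |(α - 1) * s ^ (α - 1 - 1)| * 1 := by gcongr
      _ ≤ P1 := by rw [mul_one]; exact h
  · intro s hs
    have h := hP2 s hs
    rw [div_eq_mul_one_div, abs_mul, abs_of_pos (by positivity : 0 < 1 / (1 + |lam|))]
    calc _ ≤ |(α - 1) * ((α - 1 - 1) * s ^ (α - 1 - 1 - 1))| * 1 := by gcongr
      _ ≤ P2 := by
        rw [mul_one, ← mul_assoc]; exact h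
  · gcongr
    linarith

/-! ### Poisson summation -/

/-- The function whose values at integers are summed in the smoothed exponential sum. -/
noncomputable def smoothTerm (α N x t : ℝ) : ℂ := (bump (t / N) : ℂ) * addExp (x * powPhase α (t / N))

theorem continuous_smoothTerm {α N : ℝ} (hα : α ≠ 0) (hN : 0 < N) (x : ℝ) :
    Continuous (smoothTerm α N x) := by
  rw [continuous_iff_continuousAt]
  intro t
  rcases lt_or_ge 0 t with ht | ht
  · have h0 : 0 < t / N := by positivity
    have h1 : ContinuousAt (fun t : ℝ => t / N) t := by fun_prop
    have h2 : ContinuousAt (powPhase α) (t / N) := (hasDerivAt_powPhase hα h0).continuousAt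
    have h3 : ContinuousAt (fun t : ℝ => powPhase α (t / N)) t :=
      ContinuousAt.comp (f := fun t : ℝ => t / N) h2 h1
    have h4 : ContinuousAt (fun t : ℝ => addExp (x * powPhase α (t / N))) t :=
      continuous_addExp.continuousAt.comp (continuousAt_const.mul h3)
    have h5 : Continuous fun t : ℝ => (bump (t / N) : ℂ) := by
      have := continuous_bump; fun_prop
    exact h5.continuousAt.mul h4
  · have : smoothTerm α N x =ᶠ[nhds t] fun _ => 0 := by
      have hlt : t < N * (3 / 4) := by nlinarith
      filter_upwards [gt_mem_nhds hlt] with y hy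
      have : y / N ≤ 3 / 4 := by rw [div_le_iff₀ hN]; linarith
      rw [smoothTerm, bump_eq_zero fun h => by linarith [h.1], Complex.ofReal_zero, zero_mul]
    exact continuousAt_const.congr this.symm

theorem smoothTerm_eq_zero {α N x t : ℝ} (hN : 0 < N) (ht : t < 0 ∨ 3 * N ≤ t) :
    smoothTerm α N x t = 0 := by
  rw [smoothTerm, bump_eq_zero, Complex.ofReal_zero, zero_mul]
  rintro ⟨h1, h2⟩
  rw [lt_div_iff₀ hN] at h1
  rw [div_lt_iff₀ hN] at h2
  rcases ht with h | h <;> nlinarith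

theorem fourier_smoothTerm {α N x : ℝ} (hN : 0 < N) (hx : 0 < x) (ξ : ℝ) :
    FourierTransform.fourier (smoothTerm α N x) ξ = N * oscInt α x (N * ξ / x) := by
  rw [Real.fourier_real_eq_integral_exp_smul, oscInt]
  have h := Measure.integral_comp_div (fun s => (bump s : ℂ) *
    addExp (x * (powPhase α s - N * ξ / x * s))) N
  rw [abs_of_pos hN, Complex.real_smul] at h
  rw [← h]
  refine integral_congr_ae (Filter.Eventually.of_forall fun t => ?_)
  simp only [smoothTerm, smul_eq_mul]
  have h1 : addExp (x * (powPhase α (t / N) - N * ξ / x * (t / N)))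
      = addExp (-(t * ξ)) * addExp (x * powPhase α (t / N)) := by
    rw [← addExp_add]; congr 1; field_simp; ring
  have h2 : Complex.exp (((-2 * Real.pi * t * ξ : ℝ) : ℂ) * Complex.I) = addExp (-(t * ξ)) := by
    rw [addExp_eq]; congr 3; ring
  rw [h1, h2]; ring

/-- The smoothed exponential sum over integers near `N`. -/
noncomputable def smoothSum (α : ℝ) (N : ℕ) (x : ℝ) : ℂ :=
  ∑ n ∈ Finset.range (3 * N), smoothTerm α N x n

theorem tsum_smoothTerm {α x : ℝ} {N : ℕ} (hN : 0 < N) :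
    ∑' n : ℤ, smoothTerm α N x n = smoothSum α N x := by
  have hN' : (0 : ℝ) < N := by exact_mod_cast hN
  rw [tsum_eq_sum (s := (Finset.range (3 * N)).map Nat.castEmbedding)]
  · rw [Finset.sum_map, smoothSum]
    refine Finset.sum_congr rfl fun n _ => ?_
    simp
  · intro n hn
    refine smoothTerm_eq_zero hN' ?_
    by_contra h
    rw [not_or, not_lt, not_le] at h
    have h0 : 0 ≤ n := by exact_mod_cast h.1
    have h1 : n < 3 * N := by exact_mod_cast h.2
    refine hn (Finset.mem_map.2 ⟨n.toNat, ?_, ?_⟩)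
    · rw [Finset.mem_range]; omega
    · simp [h0]

/-- Poisson summation for the smoothed exponential sum, truncated to the frequencies having a
stationary point. -/
theorem exists_poisson_truncated {α : ℝ} (hα0 : α ≠ 0) (hα1 : α < 1) :
    ∃ la lb D : ℝ, 0 < la ∧ la ≤ lb ∧ 0 < D ∧ ∀ (N : ℕ) (x : ℝ) (L : Finset ℕ), 0 < N → 1 ≤ x →
      x ≤ (N : ℝ) ^ 2 → (∀ l : ℕ, (N : ℝ) * l / x ∈ Set.Icc la lb → l ∈ L) →
      ‖smoothSum α N x - N * ∑ l ∈ L, oscInt α x (N * l / x)‖ ≤ D * N / x := by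
  obtain ⟨la, lb, D, hla, hlab, hD, htail⟩ := exists_oscInt_tail_bound hα0 hα1
  have hs0 : Summable fun n : ℤ => 1 / (n : ℝ) ^ 2 := Real.summable_one_div_int_pow.2 one_lt_two
  set Z : ℝ := ∑' n : ℤ, 1 / (n : ℝ) ^ 2 with hZ
  have hZ0 : 0 ≤ Z := tsum_nonneg fun n => by positivity
  refine ⟨la, lb, D * (1 + Z), hla, hlab, by positivity, ?_⟩
  intro N x L hN hx hxN hL
  have hN' : (0 : ℝ) < N := by exact_mod_cast hN
  have hx0 : 0 < x := by linarith
  set g : ℤ → ℂ := fun l => N * oscInt α x (N * l / x) with hg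
  have hcont := continuous_smoothTerm hα0 hN' x
  have hO1 : (smoothTerm α N x) =O[Filter.cocompact ℝ] fun t => |t| ^ (-2 : ℝ) := by
    have : smoothTerm α N x =ᶠ[Filter.cocompact ℝ] fun _ => 0 := by
      filter_upwards [(isCompact_Icc (a := (0 : ℝ)) (b := 3 * N)).compl_mem_cocompact] with t ht
      refine smoothTerm_eq_zero hN' ?_
      by_contra h
      rw [not_or, not_lt, not_le] at h
      exact ht ⟨h.1, h.2.le⟩
    exact this.trans_isBigO (Asymptotics.isBigO_zero _ _)
  -- With `lam = N ξ / x` one has `x |lam| = N |ξ|`, so the tail bound is summable in the frequency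
  -- with a constant free of `x`.
  have htail' : ∀ ξ : ℝ, ξ ≠ 0 → (N : ℝ) * ξ / x ∉ Set.Icc la lb →
      ‖(N : ℂ) * oscInt α x (N * ξ / x)‖ ≤ D / N * (1 / ξ ^ 2) := by
    intro ξ hξ hn
    rw [norm_mul, Complex.norm_natCast]
    have h1 := htail x _ hx0 hn
    have h2 : (N * |ξ|) ^ 2 ≤ (x * (1 + |(N : ℝ) * ξ / x|)) ^ 2 := by
      have : (N : ℝ) * |ξ| ≤ x * (1 + |(N : ℝ) * ξ / x|) := by
        rw [abs_div, abs_mul, abs_of_pos hN', abs_of_pos hx0, mul_add, mul_div_cancel₀ _ hx0.ne']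
        linarith
      gcongr
    have h3 : 0 < |ξ| := abs_pos.2 hξ
    calc (N : ℝ) * ‖oscInt α x (N * ξ / x)‖ ≤ N * (D / (N * |ξ|) ^ 2) := by
          refine mul_le_mul_of_nonneg_left (h1.trans ?_) hN'.le
          exact div_le_div_of_nonneg_left hD.le (by positivity) h2
      _ = D / N * (1 / ξ ^ 2) := by
          rw [mul_pow, sq_abs]
          field_simp
  have hO2 : FourierTransform.fourier (smoothTerm α N x) =O[Filter.cocompact ℝ]
      fun t => |t| ^ (-2 : ℝ) := by
    refine Asymptotics.IsBigO.of_bound (D / N) ?_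
    filter_upwards [(isCompact_Icc (a := (0 : ℝ)) (b := x * lb / N)).compl_mem_cocompact] with ξ hξ
    have hξ0 : ξ ≠ 0 := by
      rintro rfl
      refine hξ ⟨le_rfl, ?_⟩
      have : 0 < lb := by linarith
      positivity
    rw [fourier_smoothTerm hN' hx0]
    have := htail' ξ hξ0 (fun h => hξ ⟨?_, ?_⟩)
    · refine this.trans (le_of_eq ?_)
      rw [Real.norm_of_nonneg (by positivity), Real.rpow_neg (abs_nonneg _), Real.rpow_two, sq_abs,
        one_div]
    · have h1 := h.1
      rw [le_div_iff₀ hx0] at h1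
      have : 0 < la * x := by positivity
      by_contra hneg
      rw [not_le] at hneg
      nlinarith
    · have h1 := h.2
      rw [div_le_iff₀ hx0] at h1
      rw [le_div_iff₀ hN']
      linarith
  have hpois := Real.tsum_eq_tsum_fourier_of_rpow_decay hcont one_lt_two hO1 hO2 0
  have hleft : ∑' n : ℤ, smoothTerm α N x (0 + n) = smoothSum α N x := by
    simp_rw [zero_add]; exact tsum_smoothTerm hN
  have hright : ∀ n : ℤ, FourierTransform.fourier (smoothTerm α N x) (n : ℝ) *
      (fourier n) ((0 : ℝ) : UnitAddCircle) = g n := by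
    intro n
    rw [fourier_smoothTerm hN' hx0]
    simp [hg]
  rw [hleft] at hpois
  simp_rw [hright] at hpois
  set L' : Finset ℤ := L.map Nat.castEmbedding with hL'
  have hLsum : ∑ l ∈ L', g l = N * ∑ l ∈ L, oscInt α x (N * l / x) := by
    rw [hL', Finset.sum_map, Finset.mul_sum]
    refine Finset.sum_congr rfl fun l _ => ?_
    simp [hg]
  -- Frequency zero needs its own majorant `D N / x^2`. All other frequencies outside `L` contribute
  -- `O(1/N)` in total, which is `O(N/x)` because `x ≤ N^2`.
  set u : ℤ → ℝ := fun l => D * N / x ^ 2 * (if l = 0 then 1 else 0) + D / N * (1 / (l : ℝ) ^ 2)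
    with hu
  set g' : ℤ → ℂ := fun l => if l ∈ L' then 0 else g l with hg'
  have hgle : ∀ l, ‖g' l‖ ≤ u l := by
    intro l
    simp only [hg', hu]
    split_ifs with hl h0 h0
    · rw [norm_zero]; positivity
    · rw [norm_zero]; positivity
    · subst h0
      simp only [hg]
      have h1 := htail x (N * ((0 : ℤ) : ℝ) / x) hx0 (by simp; intro h; linarith)
      rw [norm_mul, Complex.norm_natCast]
      simp only [Int.cast_zero, mul_zero, zero_div, abs_zero, add_zero, mul_one] at h1 ⊢
      calc _ ≤ N * (D / x ^ 2) := by gcongr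
        _ = D * N / x ^ 2 + D / N * (1 / 0 ^ 2) := by simp; ring
    · rw [mul_zero, zero_add]
      refine htail' l (by exact_mod_cast h0) fun h => hl ?_
      have hlpos : 0 ≤ l := by
        have h1 := h.1
        rw [le_div_iff₀ hx0] at h1
        have : 0 < la * x := by positivity
        by_contra hneg
        rw [not_le] at hneg
        have : (l : ℝ) < 0 := by exact_mod_cast hneg
        nlinarith
      have hcast : ((l.toNat : ℕ) : ℤ) = l := Int.toNat_of_nonneg hlpos
      refine Finset.mem_map.2 ⟨l.toNat, hL _ ?_, hcast⟩
      have : ((l.toNat : ℕ) : ℝ) = (l : ℝ) := by exact_mod_cast hcast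
      rw [this]; exact h
  have hus0 : HasSum (fun l : ℤ => D * N / x ^ 2 * (if l = 0 then (1 : ℝ) else 0)) (D * N / x ^ 2) := by
    have := hasSum_ite_eq (0 : ℤ) (D * N / x ^ 2)
    refine this.congr_fun ?_ |> fun h => h
    intro l
    split_ifs <;> simp
  have husum : HasSum u (D * N / x ^ 2 + D / N * Z) := hus0.add (hs0.hasSum.mul_left (D / N))
  have hg'sum : Summable g' := Summable.of_norm_bounded husum.summable hgle
  have hfin : HasSum (fun l => if l ∈ L' then g l else 0) (∑ l ∈ L', g l) := by
    have h1 : HasSum (fun l => if l ∈ L' then g l else 0)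
        (∑ l ∈ L', if l ∈ L' then g l else 0) :=
      hasSum_sum_of_ne_finset_zero fun l hl => if_neg hl
    rwa [Finset.sum_congr rfl fun l hl => if_pos hl] at h1
  have htot : HasSum g (∑ l ∈ L', g l + ∑' l, g' l) := by
    have := hfin.add hg'sum.hasSum
    refine this.congr_fun ?_ |> fun h => h
    intro l
    simp only [hg']
    split_ifs <;> simp
  rw [hpois, htot.tsum_eq, hLsum, add_sub_cancel_left]
  refine (tsum_of_norm_bounded husum hgle).trans ?_
  have e1 : D * N / x ^ 2 ≤ D * N / x := by
    refine div_le_div_of_nonneg_left (by positivity) hx0 ?_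
    nlinarith
  have e2 : D / N * Z ≤ D * Z * N / x := by
    rw [div_mul_eq_mul_div, div_le_div_iff₀ hN' hx0]
    calc D * Z * x ≤ D * Z * N ^ 2 := by gcongr
      _ = _ := by ring
  calc _ ≤ D * N / x + D * Z * N / x := add_le_add e1 e2
    _ = _ := by ring

/-! ### Fourth moments through dual sums -/

theorem sum_Ico_mul_eq_abel (e A : ℕ → ℂ) {a b : ℕ} (hab : a ≤ b) :
    ∑ l ∈ Finset.Ico a (b + 1), e l * A l = A b * ∑ l ∈ Finset.Ico a (b + 1), e l
      - ∑ j ∈ Finset.Ico a b, (A (j + 1) - A j) * ∑ l ∈ Finset.Ico a (j + 1), e l := by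
  induction b, hab using Nat.le_induction with
  | base => simp [mul_comm]
  | succ b hab ih =>
    rw [Finset.sum_Ico_succ_top (by omega : a ≤ b + 1), ih,
      Finset.sum_Ico_succ_top (by omega : a ≤ b + 1) e, Finset.sum_Ico_succ_top hab (fun j =>
        (A (j + 1) - A j) * ∑ l ∈ Finset.Ico a (j + 1), e l)]
    ring

theorem pow_four_sum_le {ι : Type*} (s : Finset ι) (f : ι → ℝ) (hf : ∀ i ∈ s, 0 ≤ f i) :
    (∑ i ∈ s, f i) ^ 4 ≤ (s.card : ℝ) ^ 3 * ∑ i ∈ s, f i ^ 4 := by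
  rcases s.eq_empty_or_nonempty with rfl | hs
  · simp
  have h1 := pow_sum_div_card_le_sum_pow (s := s) (f := f) hf 3
  have : 0 < (s.card : ℝ) := by exact_mod_cast hs.card_pos
  rw [div_le_iff₀ (by positivity), mul_comm] at h1
  exact h1

theorem pow_four_add_le {a b : ℝ} : (a + b) ^ 4 ≤ 8 * (a ^ 4 + b ^ 4) := by
  nlinarith [sq_nonneg (a - b), sq_nonneg (a + b), sq_nonneg (a ^ 2 - b ^ 2),
    sq_nonneg (a * b), mul_nonneg (sq_nonneg (a - b)) (sq_nonneg (a + b)),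
    mul_nonneg (sq_nonneg (a - b)) (sq_nonneg (a - b)), mul_nonneg (sq_nonneg (a - b)) (sq_nonneg a),
    mul_nonneg (sq_nonneg (a - b)) (sq_nonneg b)]

/-- Fourth power form of summation by parts for a slowly varying amplitude. -/
theorem norm_sum_Ico_mul_pow_four_le (e A : ℕ → ℂ) {a b : ℕ} (hab : a ≤ b) {M V : ℝ}
    (hM : ‖A b‖ ≤ M) (hV : ∀ j ∈ Finset.Ico a b, ‖A (j + 1) - A j‖ ≤ V) :
    ‖∑ l ∈ Finset.Ico a (b + 1), e l * A l‖ ^ 4 ≤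
      8 * (M ^ 4 * ‖∑ l ∈ Finset.Ico a (b + 1), e l‖ ^ 4 +
        V ^ 4 * ((b - a : ℕ) : ℝ) ^ 3 *
          ∑ j ∈ Finset.Ico a b, ‖∑ l ∈ Finset.Ico a (j + 1), e l‖ ^ 4) := by
  rw [sum_Ico_mul_eq_abel e A hab]
  have hM0 : 0 ≤ M := (norm_nonneg _).trans hM
  have h1 : ‖A b * ∑ l ∈ Finset.Ico a (b + 1), e l
      - ∑ j ∈ Finset.Ico a b, (A (j + 1) - A j) * ∑ l ∈ Finset.Ico a (j + 1), e l‖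
      ≤ M * ‖∑ l ∈ Finset.Ico a (b + 1), e l‖
        + ∑ j ∈ Finset.Ico a b, V * ‖∑ l ∈ Finset.Ico a (j + 1), e l‖ := by
    refine (norm_sub_le _ _).trans (add_le_add ?_ (norm_sum_le_of_le _ fun j hj => ?_))
    · rw [norm_mul]; gcongr
    · rw [norm_mul]
      exact mul_le_mul_of_nonneg_right (hV j hj) (norm_nonneg _)
  have h2 := pow_four_sum_le (Finset.Ico a b) (fun j => V * ‖∑ l ∈ Finset.Ico a (j + 1), e l‖)
    (fun j hj => mul_nonneg ((norm_nonneg _).trans (hV j hj)) (norm_nonneg _))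
  rw [Nat.card_Ico] at h2
  simp_rw [mul_pow] at h2
  rw [← Finset.mul_sum _ _ (V ^ 4)] at h2
  calc _ ≤ _ := pow_le_pow_left₀ (norm_nonneg _) h1 4
    _ ≤ _ := pow_four_add_le
    _ ≤ _ := by
      rw [mul_pow]
      linarith

theorem continuous_smoothSum (α : ℝ) (N : ℕ) : Continuous (smoothSum α N) := by
  have := continuous_addExp
  unfold smoothSum smoothTerm
  fun_prop

/-- The sum dual to `smoothSum`. -/
noncomputable def dualSum (α : ℝ) (N : ℕ) (s : Finset ℕ) (x : ℝ) : ℂ :=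
  ∑ l ∈ s, addExp (-(x * powPhase (α / (α - 1)) (N * l / x)))

theorem continuousOn_dualSum {α : ℝ} (hα0 : α ≠ 0) (hα1 : α ≠ 1) {N : ℕ} (hN : 0 < N)
    {s : Finset ℕ} (hs : ∀ l ∈ s, 0 < l) : ContinuousOn (dualSum α N s) (Set.Ioi 0) := by
  have hα' : α / (α - 1) ≠ 0 := div_ne_zero hα0 (sub_ne_zero.2 hα1)
  refine continuousOn_finsetSum _ fun l hl => ?_
  have hl0 : (0 : ℝ) < l := by exact_mod_cast hs l hl
  have hN0 : (0 : ℝ) < N := by exact_mod_cast hN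
  refine continuous_addExp.comp_continuousOn (ContinuousOn.neg (continuousOn_id.mul ?_))
  refine (continuousOn_powPhase hα').comp
    (continuousOn_const.div continuousOn_id fun x hx => ne_of_gt hx) fun x hx => ?_
  have : 0 < x := hx
  exact div_pos (mul_pos hN0 hl0) this

/-- Fourth moment of the smoothed sum in terms of fourth moments of dual sums. -/
theorem exists_moment_le_dual {α : ℝ} (hα0 : α ≠ 0) (hα1 : α < 1) :
    ∃ la lb C : ℝ, 0 < la ∧ la ≤ lb ∧ 0 < C ∧ ∀ (N : ℕ) (T Q : ℝ), 0 < N → 1 ≤ T →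
      2 * T ≤ (N : ℝ) ^ 2 →
      (∀ s : Finset ℕ, (∀ l ∈ s, la * T ≤ N * (l : ℝ) ∧ N * (l : ℝ) ≤ 2 * lb * T) →
        ∫ x in T..2 * T, ‖dualSum α N s x‖ ^ 4 ≤ Q) →
      ∫ x in T..2 * T, ‖smoothSum α N x‖ ^ 4 ≤ C * ((N : ℝ) ^ 4 / T ^ 2 * Q + (N : ℝ) ^ 4 / T ^ 3) := by
  obtain ⟨la, lb, D, hla, hlab, hD, hpois⟩ := exists_poisson_truncated hα0 hα1
  obtain ⟨D', hD', hamp⟩ := exists_oscAmp_bounds (la := la / 2) (lb := 2 * lb) hα0 hα1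
    (by linarith) (by linarith)
  have hlb : 0 < lb := by linarith
  refine ⟨la, lb, 64 * D' ^ 4 * (1 + (2 * lb) ^ 4) + 8 * D ^ 4, hla, hlab, by positivity, ?_⟩
  intro N T Q hN hT hTN hQ
  have hN0 : (0 : ℝ) < N := by exact_mod_cast hN
  have hT0 : 0 < T := by linarith
  have hTT : T ≤ 2 * T := by linarith
  -- The range is fixed for all `x` in `[T, 2T]` and contains every frequency with a stationary
  -- point. The normalised frequencies `N l / x` then lie in `[la/2, 2 lb]`, where the amplitude
  -- bounds were taken.
  set a : ℕ := ⌈la * T / N⌉₊ with ha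
  set b : ℕ := ⌊2 * lb * T / N⌋₊ with hb
  have hmem : ∀ l : ℕ, l ∈ Finset.Ico a (b + 1) ↔ la * T ≤ N * (l : ℝ) ∧ N * (l : ℝ) ≤ 2 * lb * T := by
    intro l
    rw [Finset.mem_Ico, ha, hb, Nat.lt_succ_iff, Nat.ceil_le, Nat.le_floor_iff (by positivity),
      div_le_iff₀ hN0, le_div_iff₀ hN0, mul_comm (l : ℝ)]
  have hQ0 : 0 ≤ Q := by
    have := hQ ∅ (by simp)
    simpa [dualSum] using this
  set E : ℕ → ℝ → ℂ := fun j => dualSum α N (Finset.Ico a j) with hE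
  have hsubset : ∀ j, j ≤ b → ∀ l ∈ Finset.Ico a (j + 1), l ∈ Finset.Ico a (b + 1) := by
    intro j hj l hl
    rw [Finset.mem_Ico] at hl ⊢
    omega
  have hEQ : ∀ j, j ≤ b → ∫ x in T..2 * T, ‖E (j + 1) x‖ ^ 4 ≤ Q := fun j hj =>
    hQ _ fun l hl => (hmem l).1 (hsubset j hj l hl)
  have hapos : 0 < a := Nat.ceil_pos.2 (by positivity)
  have hEc : ∀ j, ContinuousOn (fun x => ‖E j x‖ ^ 4) (Set.Icc T (2 * T)) := by
    intro j
    have := continuousOn_dualSum (s := Finset.Ico a j) hα0 hα1.ne hN fun l hl => by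
      rw [Finset.mem_Ico] at hl; omega
    exact (this.norm.pow 4).mono fun x hx => lt_of_lt_of_le hT0 hx.1
  have hEint : ∀ j, IntervalIntegrable (fun x => ‖E j x‖ ^ 4) volume T (2 * T) := fun j =>
    (hEc j).intervalIntegrable_of_Icc hTT
  have hbn : ((b - a : ℕ) : ℝ) ≤ 2 * lb * T / N := by
    have h1 : ((b - a : ℕ) : ℝ) ≤ b := by exact_mod_cast Nat.sub_le _ _
    exact h1.trans (Nat.floor_le (by positivity))
  -- Partial summation strips the amplitude: each step changes it by `O(N/T)` relative to its size
  -- `x^(-1/2)`, over `O(T/N)` steps. Its partial sums explain why the hypothesis bounds dual sums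
  -- over arbitrary index sets.
  set R : ℝ → ℝ := fun x => ‖E (b + 1) x‖ ^ 4 +
    (2 * lb) ^ 3 * (N / T) * ∑ j ∈ Finset.Ico a b, ‖E (j + 1) x‖ ^ 4 with hR
  have hsint : IntervalIntegrable (fun x => ∑ j ∈ Finset.Ico a b, ‖E (j + 1) x‖ ^ 4) volume
      T (2 * T) :=
    (continuousOn_finsetSum _ fun j _ => hEc (j + 1)).intervalIntegrable_of_Icc hTT
  have hRint : IntervalIntegrable R volume T (2 * T) := by
    exact (hEint _).add (hsint.const_mul _)
  have hR0 : ∀ x, 0 ≤ R x := fun x => by simp only [hR]; positivity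
  have hpt : ∀ x ∈ Set.Icc T (2 * T), ‖smoothSum α N x‖ ^ 4
      ≤ 64 * D' ^ 4 * (N ^ 4 / T ^ 2) * R x + 8 * D ^ 4 * (N ^ 4 / T ^ 4) := by
    intro x hx
    have hx0 : 0 < x := by linarith [hx.1]
    have hsx := Real.sqrt_pos.2 hx0
    have h1 := hpois N x (Finset.Ico a (b + 1)) hN (hT.trans hx.1) (hx.2.trans hTN) (by
      intro l hl
      rw [hmem]
      have h1 := hl.1
      have h2 := hl.2
      rw [le_div_iff₀ hx0] at h1
      rw [div_le_iff₀ hx0] at h2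
      constructor
      · calc la * T ≤ la * x := by gcongr; exact hx.1
          _ ≤ _ := h1
      · calc _ ≤ lb * x := h2
          _ ≤ lb * (2 * T) := by gcongr; exact hx.2
          _ = _ := by ring)
    have hlam : ∀ l ∈ Finset.Ico a (b + 1), (N : ℝ) * l / x ∈ Set.Icc (la / 2) (2 * lb) := by
      intro l hl
      obtain ⟨h1, h2⟩ := (hmem l).1 hl
      constructor
      · rw [le_div_iff₀ hx0]
        calc la / 2 * x ≤ la / 2 * (2 * T) := by gcongr; exact hx.2
          _ = la * T := by ring
          _ ≤ _ := h1
      · rw [div_le_iff₀ hx0]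
        calc _ ≤ 2 * lb * T := h2
          _ ≤ _ := by gcongr; exact hx.1
    obtain ⟨hA1, hA2⟩ := hamp x hx0
    have h2 : ‖∑ l ∈ Finset.Ico a (b + 1), oscInt α x (N * l / x)‖ ^ 4 ≤
        8 * ((D' / Real.sqrt x) ^ 4 * R x) := by
      simp_rw [oscInt_eq]
      rcases lt_or_ge b a with hlt | hab
      · rw [Finset.Ico_eq_empty (by omega)]
        have := hR0 x
        rw [Finset.sum_empty, norm_zero, zero_pow (by norm_num)]
        positivity
      have h3 := norm_sum_Ico_mul_pow_four_le
        (fun l => addExp (-(x * powPhase (α / (α - 1)) (N * l / x))))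
        (fun l => oscAmp α x (N * l / x)) hab (M := D' / Real.sqrt x)
        (V := D' / Real.sqrt x * (N / x))
        (hA1 _ (hlam b (by rw [Finset.mem_Ico]; omega))) (by
          intro j hj
          rw [Finset.mem_Ico] at hj
          refine (hA2 _ (hlam (j + 1) (by rw [Finset.mem_Ico]; omega)) _
            (hlam j (by rw [Finset.mem_Ico]; omega))).trans (le_of_eq ?_)
          congr 1
          push_cast
          rw [← sub_div, mul_add, mul_one, add_sub_cancel_left, abs_of_pos (by positivity)])
      refine h3.trans ?_
      have h4 : (D' / Real.sqrt x * (N / x)) ^ 4 * ((b - a : ℕ) : ℝ) ^ 3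
          ≤ (D' / Real.sqrt x) ^ 4 * ((2 * lb) ^ 3 * (N / T)) := by
        calc _ ≤ (D' / Real.sqrt x * (N / T)) ^ 4 * (2 * lb * T / N) ^ 3 := by
              gcongr; exact hx.1
          _ = _ := by field_simp
      have h5 := mul_le_mul_of_nonneg_right h4 (show 0 ≤ ∑ j ∈ Finset.Ico a b, ‖E (j + 1) x‖ ^ 4
        from Finset.sum_nonneg fun j _ => by positivity)
      have h6 : (D' / Real.sqrt x) ^ 4 * R x = (D' / Real.sqrt x) ^ 4 * ‖E (b + 1) x‖ ^ 4 +
          (D' / Real.sqrt x) ^ 4 * ((2 * lb) ^ 3 * (N / T)) *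
            ∑ j ∈ Finset.Ico a b, ‖E (j + 1) x‖ ^ 4 := by simp only [hR]; ring
      rw [h6]
      simp only [hE, dualSum] at h5 ⊢
      linarith
    have h7 : ‖smoothSum α N x‖ ≤ N * ‖∑ l ∈ Finset.Ico a (b + 1), oscInt α x (N * l / x)‖
        + D * N / x := by
      have := norm_add_le (smoothSum α N x - N * ∑ l ∈ Finset.Ico a (b + 1), oscInt α x (N * l / x))
        (N * ∑ l ∈ Finset.Ico a (b + 1), oscInt α x (N * l / x))
      rw [sub_add_cancel, norm_mul, Complex.norm_natCast] at this
      linarith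
    have h8 : (D' / Real.sqrt x) ^ 4 ≤ D' ^ 4 / T ^ 2 := by
      rw [div_pow]
      have : Real.sqrt x ^ 4 = x ^ 2 := by
        rw [show Real.sqrt x ^ 4 = (Real.sqrt x ^ 2) ^ 2 by ring, Real.sq_sqrt hx0.le]
      rw [this]
      gcongr; exact hx.1
    calc ‖smoothSum α N x‖ ^ 4 ≤ _ := pow_le_pow_left₀ (norm_nonneg _) h7 4
      _ ≤ _ := pow_four_add_le
      _ = 8 * (N ^ 4 * ‖∑ l ∈ Finset.Ico a (b + 1), oscInt α x (N * l / x)‖ ^ 4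
          + D ^ 4 * (N ^ 4 / x ^ 4)) := by
        rw [mul_pow, div_pow, mul_pow]; ring
      _ ≤ 8 * (N ^ 4 * (8 * ((D' ^ 4 / T ^ 2) * R x)) + D ^ 4 * (N ^ 4 / T ^ 4)) := by
        have := hR0 x
        gcongr
        · refine h2.trans ?_
          gcongr
        · exact hx.1
      _ = _ := by ring
  have hRval : ∫ x in T..2 * T, R x ≤ (1 + (2 * lb) ^ 4) * Q := by
    simp only [hR]
    rw [intervalIntegral.integral_add (hEint _)
      (hsint.const_mul _),
      intervalIntegral.integral_const_mul, intervalIntegral.integral_finsetSum fun j _ => hEint _]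
    have h1 : ∑ j ∈ Finset.Ico a b, ∫ x in T..2 * T, ‖E (j + 1) x‖ ^ 4 ≤ 2 * lb * T / N * Q := by
      calc _ ≤ ∑ j ∈ Finset.Ico a b, Q := Finset.sum_le_sum fun j hj =>
            hEQ j (by rw [Finset.mem_Ico] at hj; omega)
        _ = ((b - a : ℕ) : ℝ) * Q := by rw [Finset.sum_const, Nat.card_Ico, nsmul_eq_mul]
        _ ≤ _ := by gcongr
    calc _ ≤ Q + (2 * lb) ^ 3 * (N / T) * (2 * lb * T / N * Q) := by
          gcongr
          exact hEQ b le_rfl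
      _ = _ := by field_simp
  calc ∫ x in T..2 * T, ‖smoothSum α N x‖ ^ 4
      ≤ ∫ x in T..2 * T, (64 * D' ^ 4 * (N ^ 4 / T ^ 2) * R x + 8 * D ^ 4 * (N ^ 4 / T ^ 4)) := by
        refine intervalIntegral.integral_mono_on hTT ?_ ?_ hpt
        · exact ((continuous_smoothSum α N).norm.pow 4).intervalIntegrable _ _
        · exact (hRint.const_mul _).add (by simp)
    _ = 64 * D' ^ 4 * (N ^ 4 / T ^ 2) * (∫ x in T..2 * T, R x) + 8 * D ^ 4 * (N ^ 4 / T ^ 3) := by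
        rw [intervalIntegral.integral_add (hRint.const_mul _) (by simp),
          intervalIntegral.integral_const_mul, intervalIntegral.integral_const, smul_eq_mul]
        field_simp
        ring
    _ ≤ 64 * D' ^ 4 * (N ^ 4 / T ^ 2) * ((1 + (2 * lb) ^ 4) * Q) + 8 * D ^ 4 * (N ^ 4 / T ^ 3) := by
        gcongr
    _ ≤ _ := by
        have e1 : 0 ≤ 8 * D ^ 4 * ((N : ℝ) ^ 4 / T ^ 2 * Q) := by positivity
        have e2 : 0 ≤ 64 * D' ^ 4 * (1 + (2 * lb) ^ 4) * ((N : ℝ) ^ 4 / T ^ 3) := by positivity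
        linarith

/-! ### Counting quadruples by induction through duality -/

/-- The number of quadruples of integers in `[2 ^ k, 2 ^ (k + 1))` whose normalised alternating sum
of `β`-th powers is at most `4 ^ (-k)`. -/
noncomputable def quadCount (β : ℝ) (k : ℕ) : ℕ :=
  closeCount (Finset.Ico (2 ^ k) (2 ^ (k + 1)) ×ˢ Finset.Ico (2 ^ k) (2 ^ (k + 1)))
    (fun p : ℕ × ℕ => powPhase β (p.1 / 2 ^ k) - powPhase β (p.2 / 2 ^ k)) (1 / 4 ^ k)

/-- The fourth power is the square of a sum over pairs whose frequencies are differences, so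
mean-square results govern quadruples. -/
theorem norm_sum_addExp_pow_four (s : Finset ℕ) (f : ℕ → ℝ) (y : ℝ) :
    ‖∑ l ∈ s, addExp (-(y * f l))‖ ^ 4
      = ‖∑ p ∈ s ×ˢ s, 1 * addExp (y * (f p.1 - f p.2))‖ ^ 2 := by
  have h : ∑ p ∈ s ×ˢ s, 1 * addExp (y * (f p.1 - f p.2))
      = (∑ l ∈ s, addExp (y * f l)) * (starRingEnd ℂ) (∑ l ∈ s, addExp (y * f l)) := by
    rw [map_sum, Finset.sum_mul_sum, Finset.sum_product]
    refine Finset.sum_congr rfl fun p _ => Finset.sum_congr rfl fun q _ => ?_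
    rw [one_mul, mul_sub, addExp_sub]
  have h2 : ‖∑ l ∈ s, addExp (-(y * f l))‖ = ‖∑ l ∈ s, addExp (y * f l)‖ := by
    rw [← RCLike.norm_conj, map_sum]
    simp_rw [conj_addExp, neg_neg]
  rw [h, norm_mul, RCLike.norm_conj, h2]
  ring

/-- The mean square over length `R` sees close pairs at scale `1/R`; passing to the scale `4^(-k)`
of `quadCount` multiplies the count by `O(4^k / R + 1)`. -/
theorem exists_block_moment_le {β : ℝ} :
    ∃ C : ℝ, 0 < C ∧ ∀ (k : ℕ) (s : Finset ℕ) (R : ℝ), 0 < R →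
      s ⊆ Finset.Ico (2 ^ k) (2 ^ (k + 1)) →
      ∫ y in (0 : ℝ)..R, ‖∑ l ∈ s, addExp (-(y * powPhase β (l / 2 ^ k)))‖ ^ 4
        ≤ C * (R + 4 ^ k) * quadCount β k := by
  obtain ⟨C, hC, h⟩ := exists_mean_square_le
  refine ⟨3 * C, by positivity, fun k s R hR hs => ?_⟩
  simp_rw [norm_sum_addExp_pow_four s (fun l => powPhase β (l / 2 ^ k))]
  have h1 := h (s ×ˢ s) (fun _ => 1)
    (fun p : ℕ × ℕ => powPhase β (p.1 / 2 ^ k) - powPhase β (p.2 / 2 ^ k)) (B := 1) (R := R)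
    (by simp) hR
  refine h1.trans ?_
  have h2 : (closeCount (s ×ˢ s)
      (fun p : ℕ × ℕ => powPhase β (p.1 / 2 ^ k) - powPhase β (p.2 / 2 ^ k)) (1 / R) : ℝ)
      ≤ (2 * (4 ^ k / R) + 3) * quadCount β k := by
    have e1 : (closeCount (s ×ˢ s)
      (fun p : ℕ × ℕ => powPhase β (p.1 / 2 ^ k) - powPhase β (p.2 / 2 ^ k)) (1 / R) : ℝ)
        ≤ closeCount (Finset.Ico (2 ^ k) (2 ^ (k + 1)) ×ˢ Finset.Ico (2 ^ k) (2 ^ (k + 1)))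
      (fun p : ℕ × ℕ => powPhase β (p.1 / 2 ^ k) - powPhase β (p.2 / 2 ^ k)) (1 / R) := by
      exact_mod_cast closeCount_mono_set _ (Finset.product_subset_product hs hs) _
    refine e1.trans ?_
    have e2 := closeCount_le_mul
      (Finset.Ico (2 ^ k) (2 ^ (k + 1)) ×ˢ Finset.Ico (2 ^ k) (2 ^ (k + 1)))
      (fun p : ℕ × ℕ => powPhase β (p.1 / 2 ^ k) - powPhase β (p.2 / 2 ^ k))
      (η := 1 / 4 ^ k) (t := 4 ^ k / R) (by positivity) (by positivity)
    rw [show (4 : ℝ) ^ k / R * (1 / 4 ^ k) = 1 / R by field_simp] at e2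
    exact e2
  calc _ ≤ C * 1 ^ 2 * R * ((2 * (4 ^ k / R) + 3) * quadCount β k) := by gcongr
    _ = C * (3 * R + 2 * 4 ^ k) * quadCount β k := by field_simp; ring
    _ ≤ _ := by
      have : 0 ≤ C * 4 ^ k * quadCount β k := by positivity
      linarith

/-- Change of variables bounding a mean value of the dual sum over a dyadic block. -/
theorem exists_dualSum_block_le {α la lb : ℝ} (hα1 : α < 1) (hla : 0 < la)
    (hlab : la ≤ lb) :
    ∃ C : ℝ, 0 < C ∧ ∀ (N k : ℕ) (T : ℝ) (s : Finset ℕ), 0 < N → 0 < T →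
      s ⊆ Finset.Ico (2 ^ k) (2 ^ (k + 1)) →
      la * T ≤ N * (2 : ℝ) ^ (k + 1) → N * (2 : ℝ) ^ k ≤ 2 * lb * T →
      ∫ x in T..2 * T, ‖dualSum α N s x‖ ^ 4 ≤ C * (T + 4 ^ k) * quadCount (α / (α - 1)) k := by
  obtain ⟨C, hC, hblock⟩ := exists_block_moment_le (β := α / (α - 1))
  set β := α / (α - 1) with hβ
  have hα1' : α - 1 ≠ 0 := by linarith
  have hθ : 1 - β = 1 / (1 - α) := by
    rw [hβ]
    have : 1 - α ≠ 0 := by linarith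
    field_simp
    ring
  have hθpos : 0 < 1 - β := by rw [hθ]; exact one_div_pos.2 (by linarith)
  have hcont : ContinuousOn (fun r : ℝ => r ^ β) (Set.Icc (la / 4) (2 * lb)) :=
    ContinuousOn.rpow_const continuousOn_id fun r hr => Or.inl (by
      have := hr.1; change r ≠ 0; linarith)
  obtain ⟨m2, hm2⟩ := isCompact_Icc.exists_bound_of_continuousOn hcont
  have hcont' : ContinuousOn (fun r : ℝ => r ^ (-β)) (Set.Icc (la / 4) (2 * lb)) :=
    ContinuousOn.rpow_const continuousOn_id fun r hr => Or.inl (by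
      have := hr.1; change r ≠ 0; linarith)
  obtain ⟨m1, hm1⟩ := isCompact_Icc.exists_bound_of_continuousOn hcont'
  have hmem : la ∈ Set.Icc (la / 4) (2 * lb) := ⟨by linarith, by linarith⟩
  have hm2p : 0 < m2 := lt_of_lt_of_le (norm_pos_iff.2 (Real.rpow_pos_of_pos hla _).ne') (hm2 la hmem)
  have hm1p : 0 < m1 := lt_of_lt_of_le (norm_pos_iff.2 (Real.rpow_pos_of_pos hla _).ne') (hm1 la hmem)
  refine ⟨m1 / (1 - β) * C * (2 * m2 + 1), by positivity, ?_⟩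
  intro N k T s hN hT hs hlo hhi
  have hN0 : (0 : ℝ) < N := by exact_mod_cast hN
  set P : ℝ := N * 2 ^ k with hP
  have hPp : 0 < P := by positivity
  -- Homogeneity separates the variables: `x (N l / x)^β = y(x) (l / 2^k)^β`. As `P / x` stays in a
  -- fixed compact interval, `y'` is bounded below and `y = O(T)`, so `y` can be the variable of
  -- integration.
  set y : ℝ → ℝ := fun x => x ^ (1 - β) * P ^ β with hy
  have hyr : ∀ x, 0 < x → y x = x * (P / x) ^ β := by
    intro x hx
    simp only [hy]
    rw [Real.div_rpow hPp.le hx.le, Real.rpow_sub hx, Real.rpow_one]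
    ring
  set y' : ℝ → ℝ := fun x => (1 - β) * x ^ (1 - β - 1) * P ^ β with hy'
  have hyd : ∀ x, 0 < x → HasDerivAt y (y' x) x := fun x hx =>
    (Real.hasDerivAt_rpow_const (Or.inl hx.ne')).mul_const _
  have hrange : ∀ x ∈ Set.Icc T (2 * T), P / x ∈ Set.Icc (la / 4) (2 * lb) := by
    intro x hx
    have hx0 : 0 < x := by linarith [hx.1]
    constructor
    · rw [le_div_iff₀ hx0]
      have : la * T ≤ 2 * P := by rw [hP]; rw [pow_succ] at hlo; linarith
      calc la / 4 * x ≤ la / 4 * (2 * T) := by gcongr; exact hx.2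
        _ ≤ P := by linarith
    · rw [div_le_iff₀ hx0]
      calc P ≤ 2 * lb * T := hhi
        _ ≤ _ := by
          have : 0 ≤ 2 * lb := by linarith
          gcongr; exact hx.1
  have hy'lo : ∀ x ∈ Set.Icc T (2 * T), 1 ≤ m1 / (1 - β) * y' x := by
    intro x hx
    have hx0 : 0 < x := by linarith [hx.1]
    have h1 := hm1 _ (hrange x hx)
    have hq : 0 < P / x := by positivity
    rw [Real.norm_of_nonneg (by positivity), Real.rpow_neg hq.le] at h1
    have h2 : y' x = (1 - β) * (P / x) ^ β := by
      simp only [hy']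
      rw [Real.div_rpow hPp.le hx0.le, show 1 - β - 1 = -β by ring, Real.rpow_neg hx0.le]
      ring
    have hqp := Real.rpow_pos_of_pos hq β
    rw [h2, show m1 / (1 - β) * ((1 - β) * (P / x) ^ β) = m1 * (P / x) ^ β by field_simp]
    calc (1 : ℝ) = ((P / x) ^ β)⁻¹ * (P / x) ^ β := by field_simp
      _ ≤ _ := by gcongr
  have hyhi : y (2 * T) ≤ 2 * m2 * T := by
    have h2T : 0 < 2 * T := by linarith
    rw [hyr _ h2T]
    have h1 := hm2 _ (hrange (2 * T) ⟨by linarith, le_rfl⟩)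
    rw [Real.norm_of_nonneg (by positivity)] at h1
    calc _ ≤ 2 * T * m2 := by gcongr
      _ = _ := by ring
  have hypos : 0 < y T := by simp only [hy]; positivity
  have hTT : T ≤ 2 * T := by linarith
  have hpos : ∀ x ∈ Set.Icc T (2 * T), 0 < x := fun x hx => by linarith [hx.1]
  set F : ℝ → ℝ := fun z => ‖∑ l ∈ s, addExp (-(z * powPhase β (l / 2 ^ k)))‖ ^ 4 with hF
  have hFc : Continuous F := by
    have := continuous_addExp
    simp only [hF]; fun_prop
  have hF0 : ∀ z, 0 ≤ F z := fun z => by simp only [hF]; positivity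
  have hFy : ∀ x ∈ Set.Icc T (2 * T), ‖dualSum α N s x‖ ^ 4 = F (y x) := by
    intro x hx
    have hx0 := hpos x hx
    simp only [hF, dualSum]
    congr 2
    refine Finset.sum_congr rfl fun l _ => ?_
    congr 2
    rw [← hβ, powPhase, powPhase, hyr x hx0]
    have : (N : ℝ) * l / x = P / x * (l / 2 ^ k) := by rw [hP]; field_simp
    rw [this, Real.mul_rpow (by positivity) (by positivity)]
    ring
  have hy'c : ContinuousOn y' (Set.Icc T (2 * T)) :=
    (continuousOn_const.mul (ContinuousOn.rpow_const continuousOn_id fun x hx =>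
      Or.inl (hpos x hx).ne')).mul continuousOn_const
  have hyc : ContinuousOn y (Set.Icc T (2 * T)) := fun x hx =>
    (hyd x (hpos x hx)).continuousAt.continuousWithinAt
  have huIcc : Set.uIcc T (2 * T) = Set.Icc T (2 * T) := Set.uIcc_of_le hTT
  have hsub := intervalIntegral.integral_comp_mul_deriv (a := T) (b := 2 * T) (f := y) (f' := y')
    (g := F) (fun x hx => hyd x (hpos x (huIcc ▸ hx))) (huIcc ▸ hy'c) hFc
  have hymono : y T ≤ y (2 * T) := by
    simp only [hy]
    gcongr
  calc ∫ x in T..2 * T, ‖dualSum α N s x‖ ^ 4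
      ≤ ∫ x in T..2 * T, m1 / (1 - β) * ((F ∘ y) x * y' x) := by
        refine intervalIntegral.integral_mono_on hTT ?_ ?_ ?_
        · refine ContinuousOn.intervalIntegrable_of_Icc hTT ?_
          exact (hFc.comp_continuousOn hyc).congr hFy
        · refine ContinuousOn.intervalIntegrable_of_Icc hTT ?_
          exact continuousOn_const.mul ((hFc.comp_continuousOn hyc).mul hy'c)
        · intro x hx
          rw [hFy x hx]
          have := hF0 (y x)
          calc F (y x) = F (y x) * 1 := (mul_one _).symm
            _ ≤ F (y x) * (m1 / (1 - β) * y' x) := by gcongr; exact hy'lo x hx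
            _ = _ := by simp only [Function.comp]; ring
    _ = m1 / (1 - β) * ∫ z in y T..y (2 * T), F z := by
        rw [intervalIntegral.integral_const_mul, hsub]
    _ ≤ m1 / (1 - β) * ∫ z in (0 : ℝ)..2 * m2 * T, F z := by
        gcongr
        exact intervalIntegral.integral_mono_interval hypos.le hymono hyhi
          (Filter.Eventually.of_forall hF0) (hFc.intervalIntegrable _ _)
    _ ≤ m1 / (1 - β) * (C * (2 * m2 * T + 4 ^ k) * quadCount β k) := by
        gcongr
        exact hblock k s _ (by positivity) hs
    _ ≤ m1 / (1 - β) * (C * ((2 * m2 + 1) * (T + 4 ^ k)) * quadCount β k) := by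
        gcongr
        have : 0 ≤ m2 * 4 ^ k := by positivity
        linarith
    _ = _ := by ring

/-- Mean value of the dual sum, given bounds for the number of quadruples in dyadic blocks. -/
theorem exists_dualSum_moment_le {α la lb ε : ℝ} (hα0 : α ≠ 0) (hα1 : α < 1) (hla : 0 < la)
    (hlab : la ≤ lb) (hε : 0 < ε) :
    ∃ C : ℝ, 0 < C ∧ ∀ (N : ℕ) (T A : ℝ) (s : Finset ℕ), 0 < N → 0 < T → T ≤ (N : ℝ) ^ 2 → 0 ≤ A →
      (∀ l ∈ s, la * T ≤ N * (l : ℝ) ∧ N * (l : ℝ) ≤ 2 * lb * T) →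
      (∀ k : ℕ, N * (2 : ℝ) ^ k ≤ 2 * lb * T →
        (quadCount (α / (α - 1)) k : ℝ) ≤ A * ((2 : ℝ) ^ k) ^ (2 + ε)) →
      ∫ x in T..2 * T, ‖dualSum α N s x‖ ^ 4 ≤ C * A * T * (T / N) ^ (2 + ε) := by
  classical
  obtain ⟨C, hC, hblock⟩ := exists_dualSum_block_le hα1 hla hlab
  have hlb : 0 < lb := by linarith
  -- The admissible `l` lie in an interval with bounded ratio of endpoints, hence meet at most `J +
  -- 1` dyadic blocks.
  obtain ⟨J, hJ⟩ := pow_unbounded_of_one_lt (4 * lb / la) (one_lt_two)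
  refine ⟨((J : ℝ) + 1) ^ 4 * (C * (1 + 4 * lb ^ 2) * (2 * lb) ^ (2 + ε)), by positivity, ?_⟩
  intro N T A s hN hT hTN hA hs hquad
  have hN0 : (0 : ℝ) < N := by exact_mod_cast hN
  have hspos : ∀ l ∈ s, 0 < l := by
    intro l hl
    have h1 := (hs l hl).1
    have : 0 < la * T := by positivity
    by_contra h0
    have : l = 0 := by omega
    subst this
    simp at h1
    linarith
  set I : Finset ℕ := s.image (Nat.log 2) with hI
  set blk : ℕ → Finset ℕ := fun k => s.filter (fun l => Nat.log 2 l = k) with hblk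
  have hblksub : ∀ k, blk k ⊆ Finset.Ico (2 ^ k) (2 ^ (k + 1)) := by
    intro k l hl
    rw [hblk, Finset.mem_filter] at hl
    have h0 := hspos l hl.1
    rw [Finset.mem_Ico, ← hl.2]
    exact ⟨Nat.pow_log_le_self 2 h0.ne', Nat.lt_pow_succ_log_self one_lt_two l⟩
  have hk : ∀ k ∈ I, la * T ≤ N * (2 : ℝ) ^ (k + 1) ∧ N * (2 : ℝ) ^ k ≤ 2 * lb * T := by
    intro k hk
    obtain ⟨l, hl, rfl⟩ := Finset.mem_image.1 hk
    have h0 := hspos l hl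
    have h1 : ((2 : ℝ) ^ Nat.log 2 l) ≤ l := by exact_mod_cast Nat.pow_log_le_self 2 h0.ne'
    have h2 : (l : ℝ) ≤ (2 : ℝ) ^ (Nat.log 2 l + 1) := by
      exact_mod_cast (Nat.lt_pow_succ_log_self one_lt_two l).le
    obtain ⟨h3, h4⟩ := hs l hl
    exact ⟨h3.trans (by gcongr), le_trans (by gcongr) h4⟩
  have hcard : I.card ≤ J + 1 := by
    rcases I.eq_empty_or_nonempty with h0 | hne
    · simp [h0]
    have hsub : I ⊆ Finset.Icc (I.min' hne) (I.min' hne + J) := by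
      intro k hkI
      rw [Finset.mem_Icc]
      refine ⟨I.min'_le k hkI, ?_⟩
      by_contra hlt
      rw [not_le] at hlt
      obtain ⟨h1, -⟩ := hk _ (I.min'_mem hne)
      obtain ⟨-, h2⟩ := hk k hkI
      set i := I.min' hne
      have h3 : (2 : ℝ) ^ (i + 1) * 2 ^ J ≤ 2 ^ k := by
        rw [← pow_add]
        exact pow_le_pow_right₀ one_le_two (by omega)
      rw [div_lt_iff₀ hla] at hJ
      have h4 : la * T * 2 ^ J ≤ 2 * lb * T := by
        calc la * T * 2 ^ J ≤ N * (2 : ℝ) ^ (i + 1) * 2 ^ J := by gcongr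
          _ = N * ((2 : ℝ) ^ (i + 1) * 2 ^ J) := by ring
          _ ≤ N * 2 ^ k := by gcongr
          _ ≤ _ := h2
      have h5 : 4 * lb * T < la * T * 2 ^ J := by
        calc 4 * lb * T < 2 ^ J * la * T := by gcongr
          _ = _ := by ring
      have : 0 < lb * T := by positivity
      linarith
    calc I.card ≤ (Finset.Icc (I.min' hne) (I.min' hne + J)).card := Finset.card_le_card hsub
      _ = J + 1 := by rw [Nat.card_Icc]; omega
  have hsplit : ∀ x, dualSum α N s x = ∑ k ∈ I, dualSum α N (blk k) x := by
    intro x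
    simp only [dualSum, hblk]
    exact (Finset.sum_fiberwise_of_maps_to (fun l hl => Finset.mem_image_of_mem _ hl) _).symm
  have hcont : ∀ k, ContinuousOn (fun x => ‖dualSum α N (blk k) x‖ ^ 4) (Set.Icc T (2 * T)) := by
    intro k
    have := continuousOn_dualSum (s := blk k) hα0 hα1.ne hN fun l hl =>
      hspos l (Finset.mem_filter.1 hl).1
    exact (this.norm.pow 4).mono fun x hx => lt_of_lt_of_le hT hx.1
  have hcont' : ContinuousOn (fun x => ‖dualSum α N s x‖ ^ 4) (Set.Icc T (2 * T)) := by
    have := continuousOn_dualSum (s := s) hα0 hα1.ne hN hspos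
    exact (this.norm.pow 4).mono fun x hx => lt_of_lt_of_le hT hx.1
  have hTT : T ≤ 2 * T := by linarith
  have hJ1 : (I.card : ℝ) ≤ J + 1 := by exact_mod_cast hcard
  have hblockbd : ∀ k ∈ I, ∫ x in T..2 * T, ‖dualSum α N (blk k) x‖ ^ 4
      ≤ C * (1 + 4 * lb ^ 2) * (2 * lb) ^ (2 + ε) * (A * T * (T / N) ^ (2 + ε)) := by
    intro k hkI
    obtain ⟨h1, h2⟩ := hk k hkI
    have h3 : (2 : ℝ) ^ k ≤ 2 * lb * (T / N) := by
      rw [← mul_div_assoc, le_div_iff₀ hN0]; linarith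
    -- Since `2^k ≪ T/N` and `T ≤ N^2`, the term `4^k` in the block estimate is absorbed by `T`.
    have h4 : (4 : ℝ) ^ k ≤ 4 * lb ^ 2 * T := by
      have e : (4 : ℝ) ^ k = (2 ^ k) ^ 2 := by rw [← pow_mul, mul_comm, pow_mul]; norm_num
      rw [e]
      calc ((2 : ℝ) ^ k) ^ 2 ≤ (2 * lb * (T / N)) ^ 2 := by gcongr
        _ = 4 * lb ^ 2 * T * (T / N ^ 2) := by ring
        _ ≤ 4 * lb ^ 2 * T * 1 := by
          gcongr
          rw [div_le_one (by positivity)]; exact hTN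
        _ = _ := by ring
    have h5 := hquad k h2
    have h6 : ((2 : ℝ) ^ k) ^ (2 + ε) ≤ (2 * lb) ^ (2 + ε) * (T / N) ^ (2 + ε) := by
      rw [← Real.mul_rpow (by positivity) (by positivity)]
      exact Real.rpow_le_rpow (by positivity) h3 (by linarith)
    calc _ ≤ C * (T + 4 ^ k) * quadCount (α / (α - 1)) k :=
          hblock N k T (blk k) hN hT (hblksub k) h1 h2
      _ ≤ C * (T + 4 * lb ^ 2 * T) * (A * ((2 * lb) ^ (2 + ε) * (T / N) ^ (2 + ε))) := by
          have : (quadCount (α / (α - 1)) k : ℝ) ≤ A * ((2 * lb) ^ (2 + ε) * (T / N) ^ (2 + ε)) :=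
            h5.trans (by gcongr)
          gcongr
      _ = _ := by ring
  calc ∫ x in T..2 * T, ‖dualSum α N s x‖ ^ 4
      ≤ ∫ x in T..2 * T, ((J : ℝ) + 1) ^ 3 * ∑ k ∈ I, ‖dualSum α N (blk k) x‖ ^ 4 := by
        refine intervalIntegral.integral_mono_on hTT (hcont'.intervalIntegrable_of_Icc hTT) ?_ ?_
        · exact (continuousOn_const.mul
            (continuousOn_finsetSum _ fun k _ => hcont k)).intervalIntegrable_of_Icc hTT
        · intro x _
          rw [hsplit]
          calc _ ≤ (∑ k ∈ I, ‖dualSum α N (blk k) x‖) ^ 4 :=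
                pow_le_pow_left₀ (norm_nonneg _) (norm_sum_le _ _) 4
            _ ≤ (I.card : ℝ) ^ 3 * ∑ k ∈ I, ‖dualSum α N (blk k) x‖ ^ 4 :=
                pow_four_sum_le _ _ fun k _ => norm_nonneg _
            _ ≤ _ := by gcongr
    _ = ((J : ℝ) + 1) ^ 3 * ∑ k ∈ I, ∫ x in T..2 * T, ‖dualSum α N (blk k) x‖ ^ 4 := by
        rw [intervalIntegral.integral_const_mul, intervalIntegral.integral_finsetSum fun k _ =>
          (hcont k).intervalIntegrable_of_Icc hTT]
    _ ≤ ((J : ℝ) + 1) ^ 3 * ∑ k ∈ I,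
          (C * (1 + 4 * lb ^ 2) * (2 * lb) ^ (2 + ε) * (A * T * (T / N) ^ (2 + ε))) := by
        gcongr with k hkI
        exact hblockbd k hkI
    _ = ((J : ℝ) + 1) ^ 3 * ((I.card : ℝ) *
          (C * (1 + 4 * lb ^ 2) * (2 * lb) ^ (2 + ε) * (A * T * (T / N) ^ (2 + ε)))) := by
        rw [Finset.sum_const, nsmul_eq_mul]
    _ ≤ ((J : ℝ) + 1) ^ 3 * (((J : ℝ) + 1) *
          (C * (1 + 4 * lb ^ 2) * (2 * lb) ^ (2 + ε) * (A * T * (T / N) ^ (2 + ε)))) := by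
        gcongr
    _ = _ := by ring

theorem norm_smoothSum_le (α : ℝ) (N : ℕ) (x : ℝ) : ‖smoothSum α N x‖ ≤ 3 * N := by
  have hb : ∀ s, bump s ≤ 1 := fun s => ContDiffBump.le_one _
  calc ‖smoothSum α N x‖ ≤ ∑ n ∈ Finset.range (3 * N), (1 : ℝ) := by
        refine norm_sum_le_of_le _ fun n _ => ?_
        rw [smoothTerm, norm_mul, norm_addExp, mul_one, Complex.norm_real,
          Real.norm_of_nonneg (bump_nonneg _)]
        exact hb _
    _ = _ := by simp

/-- Full fourth moment of the smoothed sum, given bounds for the dual numbers of quadruples. -/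
theorem exists_smoothSum_moment_le {α ε : ℝ} (hα0 : α ≠ 0) (hα1 : α < 1) (hε : 0 < ε) :
    ∃ lb C : ℝ, 0 < lb ∧ 0 < C ∧ ∀ (N m : ℕ) (A : ℝ), 0 < N → (2 : ℝ) ^ m ≤ (N : ℝ) ^ 2 → 0 ≤ A →
      (∀ k : ℕ, N * (2 : ℝ) ^ k ≤ lb * 2 ^ m →
        (quadCount (α / (α - 1)) k : ℝ) ≤ A * ((2 : ℝ) ^ k) ^ (2 + ε)) →
      ∫ x in (0 : ℝ)..2 ^ m, ‖smoothSum α N x‖ ^ 4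
        ≤ C * ((N : ℝ) ^ 4 * (2 - (1 / 2) ^ m) + A * (N : ℝ) ^ (2 - ε) * ((2 : ℝ) ^ m) ^ (1 + ε)) := by
  obtain ⟨la, lb, C1, hla, hlab, hC1, hmom⟩ := exists_moment_le_dual hα0 hα1
  obtain ⟨C2, hC2, hdual⟩ := exists_dualSum_moment_le hα0 hα1 hla hlab hε
  have hlb : 0 < lb := by linarith
  refine ⟨lb, 81 + 2 * C1 + C1 * C2, hlb, by positivity, ?_⟩
  intro N m A hN hm hA hquad
  have hN0 : (0 : ℝ) < N := by exact_mod_cast hN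
  have hcont : Continuous fun x => ‖smoothSum α N x‖ ^ 4 := (continuous_smoothSum α N).norm.pow 4
  -- The range is doubled at each step. The new piece adds `O(N^4 / 2^m)`, absorbed by the
  -- increasing factor `2 - (1/2)^m`, and its other term is absorbed by `2 T^(1+ε) ≤ (2T)^(1+ε)`.
  -- The constant is thus the same for all `m`.
  induction m with
  | zero =>
    have h1 : ∫ x in (0 : ℝ)..2 ^ 0, ‖smoothSum α N x‖ ^ 4 ≤ 81 * N ^ 4 := by
      calc _ ≤ ∫ x in (0 : ℝ)..1, (81 * (N : ℝ) ^ 4) := by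
            rw [pow_zero]
            refine intervalIntegral.integral_mono_on zero_le_one (hcont.intervalIntegrable _ _)
              (by simp) fun x _ => ?_
            calc _ ≤ (3 * (N : ℝ)) ^ 4 :=
                  pow_le_pow_left₀ (norm_nonneg _) (norm_smoothSum_le α N x) 4
              _ = _ := by ring
        _ = _ := by simp
    have h2 : 0 ≤ (81 + 2 * C1 + C1 * C2) * (A * (N : ℝ) ^ (2 - ε) * ((2 : ℝ) ^ 0) ^ (1 + ε)) := by
      positivity
    have h3 : 0 ≤ (2 * C1 + C1 * C2) * (N : ℝ) ^ 4 := by positivity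
    rw [pow_zero, pow_zero] at *
    linarith
  | succ m ih =>
    set T : ℝ := 2 ^ m with hT
    have hTp : 0 < T := by positivity
    have hT1 : 1 ≤ T := one_le_pow₀ one_le_two
    have hsucc : (2 : ℝ) ^ (m + 1) = 2 * T := by rw [pow_succ, hT]; ring
    rw [hsucc] at hm hquad ⊢
    have ih' := ih (by linarith) fun k hk => hquad k (hk.trans (by gcongr; linarith))
    have hstep := hmom N T (C2 * A * T * (T / N) ^ (2 + ε)) hN hT1 hm fun s hs =>
      hdual N T A s hN hTp (by linarith) hA hs fun k hk => hquad k (by linarith)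
    have e1 : (N : ℝ) ^ 4 / T ^ 2 * (C2 * A * T * (T / N) ^ (2 + ε))
        = C2 * (A * (N : ℝ) ^ (2 - ε) * T ^ (1 + ε)) := by
      have h1 : T ^ (2 + ε) = T * T ^ (1 + ε) := by
        rw [show 2 + ε = 1 + (1 + ε) by ring, Real.rpow_add hTp, Real.rpow_one]
      have h2 : (N : ℝ) ^ (2 - ε) = N ^ 4 / N ^ (2 + ε) := by
        rw [show 2 - ε = 4 - (2 + ε) by ring, Real.rpow_sub hN0]
        norm_cast
      rw [Real.div_rpow hTp.le hN0.le, h1, h2]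
      field_simp
    have e2 : (N : ℝ) ^ 4 / T ^ 3 ≤ (N : ℝ) ^ 4 * (1 / 2) ^ m := by
      rw [one_div, inv_pow, ← hT, div_eq_mul_inv]
      gcongr
      calc T = T ^ 1 := (pow_one T).symm
        _ ≤ T ^ 3 := pow_le_pow_right₀ hT1 (by norm_num)
    rw [e1] at hstep
    rw [← intervalIntegral.integral_add_adjacent_intervals (b := T)
      (hcont.intervalIntegrable _ _) (hcont.intervalIntegrable _ _)]
    have e3 : T ^ (1 + ε) + T ^ (1 + ε) ≤ (2 * T) ^ (1 + ε) := by
      rw [Real.mul_rpow two_pos.le hTp.le]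
      have : (2 : ℝ) ≤ 2 ^ (1 + ε) := by
        calc (2 : ℝ) = 2 ^ (1 : ℝ) := (Real.rpow_one 2).symm
          _ ≤ _ := Real.rpow_le_rpow_of_exponent_le one_le_two (by linarith)
      have h0 := Real.rpow_pos_of_pos hTp (1 + ε)
      nlinarith
    have e4 : (1 / 2 : ℝ) ^ (m + 1) = (1 / 2) ^ m / 2 := by rw [pow_succ]; ring
    rw [e4]
    set D := A * (N : ℝ) ^ (2 - ε) with hD
    have hD0 : 0 ≤ D := by positivity
    set q : ℝ := (1 / 2) ^ m with hq
    have hq0 : 0 ≤ q := by positivity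
    have hN4 : (0 : ℝ) ≤ (N : ℝ) ^ 4 * q := by positivity
    set t := T ^ (1 + ε) with ht
    have ht0 : 0 ≤ t := by positivity
    set C := 81 + 2 * C1 + C1 * C2 with hC
    have hC1C : C1 * C2 ≤ C := by rw [hC]; linarith
    have hC1C' : 2 * C1 ≤ C := by
      have : 0 < C1 * C2 := by positivity
      rw [hC]; linarith
    have hC0 : 0 ≤ C := by positivity
    calc (∫ x in (0 : ℝ)..T, ‖smoothSum α N x‖ ^ 4) + ∫ x in T..2 * T, ‖smoothSum α N x‖ ^ 4
        ≤ C * ((N : ℝ) ^ 4 * (2 - q) + D * t) + C1 * (C2 * (D * t) + (N : ℝ) ^ 4 * q) :=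
          add_le_add ih' (hstep.trans (by gcongr))
      _ = C * ((N : ℝ) ^ 4 * (2 - q)) + C1 * ((N : ℝ) ^ 4 * q) + (C + C1 * C2) * (D * t) := by ring
      _ ≤ C * ((N : ℝ) ^ 4 * (2 - q)) + C / 2 * ((N : ℝ) ^ 4 * q) + (C + C) * (D * t) := by
          have : C1 ≤ C / 2 := by linarith
          gcongr
      _ = C * ((N : ℝ) ^ 4 * (2 - q / 2)) + C * (D * (t + t)) := by ring
      _ ≤ C * ((N : ℝ) ^ 4 * (2 - q / 2)) + C * (D * (2 * T) ^ (1 + ε)) := by gcongr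
      _ = _ := by ring

/-- The bump equals `1` on the block and is nonnegative, so smoothing only enlarges the count; `4 ·
2^m ≤ 4^K` permits the coarser scale `1 / (4 · 2^m)`. -/
theorem quadCount_le_moment (α : ℝ) (K m : ℕ) (hm : 4 * (2 : ℝ) ^ m ≤ 4 ^ K) :
    (quadCount α K : ℝ) ≤ 8 / 2 ^ m *
      ∫ x in (0 : ℝ)..2 ^ m, ‖smoothSum α (2 ^ K) x‖ ^ 4 := by
  set N : ℕ := 2 ^ K with hN
  have hNr : ((N : ℕ) : ℝ) = 2 ^ K := by rw [hN]; push_cast; rfl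
  have hN0 : (0 : ℝ) < N := by rw [hNr]; positivity
  set T : ℝ := 2 ^ m with hT
  have hTp : 0 < T := by positivity
  set f : ℕ × ℕ → ℝ := fun p => powPhase α (p.1 / 2 ^ K) - powPhase α (p.2 / 2 ^ K) with hf
  have h1 : (quadCount α K : ℝ) ≤ closeCount
      (Finset.Ico (2 ^ K) (2 ^ (K + 1)) ×ˢ Finset.Ico (2 ^ K) (2 ^ (K + 1))) f (1 / (4 * T)) := by
    unfold quadCount
    exact Nat.cast_le.2 (closeCount_mono _ _ (one_div_le_one_div_of_le (by positivity) hm))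
  have hsub : Finset.Ico (2 ^ K) (2 ^ (K + 1)) ⊆ Finset.range (3 * N) := by
    intro n hn
    rw [Finset.mem_Ico, pow_succ] at hn
    rw [Finset.mem_range]
    have : 0 < 2 ^ K := by positivity
    omega
  have h2 := closeCount_le_mean_square (Finset.product_subset_product hsub hsub)
    (fun p : ℕ × ℕ => bump (p.1 / N) * bump (p.2 / N))
    (fun p _ => mul_nonneg (bump_nonneg _) (bump_nonneg _)) (by
      intro p hp
      rw [Finset.mem_product, Finset.mem_Ico, Finset.mem_Ico] at hp
      have hb : ∀ n : ℕ, 2 ^ K ≤ n → n < 2 ^ (K + 1) → bump (n / N) = 1 := by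
        intro n h1 h2
        refine bump_eq_one ⟨?_, ?_⟩
        · rw [le_div_iff₀ hN0, one_mul, hNr]; exact_mod_cast h1
        · rw [div_le_iff₀ hN0, hNr]
          rw [pow_succ] at h2
          have : (n : ℝ) ≤ 2 ^ K * 2 := by exact_mod_cast h2.le
          linarith
      rw [hb _ hp.1.1 hp.1.2, hb _ hp.2.1 hp.2.2, one_mul]) f hTp
  have h3 : ∀ y : ℝ, ‖∑ p ∈ Finset.range (3 * N) ×ˢ Finset.range (3 * N),
      ((bump (p.1 / N) * bump (p.2 / N) : ℝ) : ℂ) * addExp (y * T * f p)‖ ^ 2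
      = ‖smoothSum α N (y * T)‖ ^ 4 := by
    intro y
    have : ∑ p ∈ Finset.range (3 * N) ×ˢ Finset.range (3 * N),
        ((bump (p.1 / N) * bump (p.2 / N) : ℝ) : ℂ) * addExp (y * T * f p)
        = smoothSum α N (y * T) * (starRingEnd ℂ) (smoothSum α N (y * T)) := by
      rw [smoothSum, map_sum, Finset.sum_mul_sum, Finset.sum_product]
      refine Finset.sum_congr rfl fun p _ => Finset.sum_congr rfl fun q _ => ?_
      simp only [smoothTerm, hf]
      rw [map_mul, Complex.conj_ofReal, mul_sub, addExp_sub, hNr]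
      push_cast
      ring
    rw [this, norm_mul, RCLike.norm_conj]
    ring
  simp_rw [h3] at h2
  have h4 := intervalIntegral.integral_comp_mul_right (a := 0) (b := 1)
    (fun x => ‖smoothSum α N x‖ ^ 4) hTp.ne'
  rw [h4, zero_mul, one_mul, smul_eq_mul] at h2
  calc _ ≤ _ := h1.trans h2
    _ = _ := by ring

/-- One step of the induction on the length of the dyadic block. -/
theorem exists_quadCount_step {α ε : ℝ} (hα0 : α ≠ 0) (hα1 : α < 1) (hε : 0 < ε) :
    ∃ lb C : ℝ, 0 < lb ∧ 0 < C ∧ ∀ (K w : ℕ) (A : ℝ), 2 ≤ w → w ≤ 2 * K → lb < 2 ^ w → 0 ≤ A →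
      (∀ k < K, (quadCount (α / (α - 1)) k : ℝ) ≤ A * ((2 : ℝ) ^ k) ^ (2 + ε)) →
      (quadCount α K : ℝ) ≤ C * (2 ^ w + A * ((1 / 2 : ℝ) ^ ε) ^ w) * ((2 : ℝ) ^ K) ^ (2 + ε) := by
  obtain ⟨lb, C, hlb, hC, hmom⟩ := exists_smoothSum_moment_le hα0 hα1 hε
  refine ⟨lb, 16 * C, hlb, by positivity, ?_⟩
  intro K w A hw2 hwK hw hA hquad
  obtain ⟨m, hm⟩ := Nat.exists_eq_add_of_le hwK
  set N : ℕ := 2 ^ K with hN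
  have hNr : ((N : ℕ) : ℝ) = 2 ^ K := by rw [hN]; push_cast; rfl
  have hNpos : 0 < N := by positivity
  have hN0 : (0 : ℝ) < N := by exact_mod_cast hNpos
  have hN1 : (1 : ℝ) ≤ N := by exact_mod_cast hNpos
  set T : ℝ := 2 ^ m with hT
  have hTp : 0 < T := by positivity
  have hw0 : (0 : ℝ) < 2 ^ w := by positivity
  have hTw : 2 ^ w * T = (N : ℝ) ^ 2 := by
    rw [hNr, hT, ← pow_add, ← hm, mul_comm 2 K, pow_mul]
  have hw4 : (4 : ℝ) ≤ 2 ^ w := by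
    calc (4 : ℝ) = 2 ^ 2 := by norm_num
      _ ≤ _ := pow_le_pow_right₀ one_le_two hw2
  have h1 := hmom N m A hNpos (by rw [← hT, ← hTw]; nlinarith) hA (by
    intro k hk
    refine hquad k ?_
    have h2 : (N : ℝ) * 2 ^ k < N * N := by
      calc (N : ℝ) * 2 ^ k ≤ lb * T := hk
        _ < 2 ^ w * T := by gcongr
        _ = _ := by rw [hTw]; ring
    have h3 : (2 : ℝ) ^ k < 2 ^ K := by rw [← hNr]; exact lt_of_mul_lt_mul_left h2 hN0.le
    exact (pow_lt_pow_iff_right₀ one_lt_two).1 h3)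
  have h2 := quadCount_le_moment α K m (by
    have e : (4 : ℝ) ^ K = (N : ℝ) ^ 2 := by
      rw [hNr, ← pow_mul, mul_comm, pow_mul]; norm_num
    rw [e, ← hTw, ← hT]
    gcongr)
  rw [← hNr]
  have e1 : (N : ℝ) ^ 4 / T = 2 ^ w * (N : ℝ) ^ 2 := by
    rw [div_eq_iff hTp.ne', ← hTw]
    calc (N : ℝ) ^ 4 = (N ^ 2) ^ 2 := by ring
      _ = _ := by rw [← hTw]; ring
  have e2 : (N : ℝ) ^ (2 - ε) * T ^ (1 + ε) / T = ((1 / 2 : ℝ) ^ ε) ^ w * (N : ℝ) ^ (2 + ε) := by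
    have hTe : T = (N : ℝ) ^ 2 / 2 ^ w := by rw [← hTw]; field_simp
    rw [Real.rpow_add hTp, Real.rpow_one, mul_div_assoc, mul_div_cancel_left₀ _ hTp.ne']
    rw [hTe, Real.div_rpow (by positivity) (by positivity)]
    have a1 : ((N : ℝ) ^ 2) ^ ε = (N : ℝ) ^ (2 * ε) := by
      rw [Real.rpow_mul hN0.le, Real.rpow_two]
    have a2 : ((1 / 2 : ℝ) ^ ε) ^ w = 1 / ((2 : ℝ) ^ w) ^ ε := by
      rw [Real.rpow_pow_comm (by norm_num), one_div, inv_pow, Real.inv_rpow (by positivity), one_div]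
    rw [a1, a2, mul_div_assoc', ← Real.rpow_add hN0]
    rw [show 2 - ε + 2 * ε = 2 + ε by ring]
    ring
  have e3 : (N : ℝ) ^ 2 ≤ (N : ℝ) ^ (2 + ε) := by
    rw [← Real.rpow_two]
    exact Real.rpow_le_rpow_of_exponent_le hN1 (by linarith)
  have e4 : (2 : ℝ) - (1 / 2) ^ m ≤ 2 := by
    have : (0 : ℝ) ≤ (1 / 2) ^ m := by positivity
    linarith
  calc (quadCount α K : ℝ) ≤ 8 / T *
        (C * ((N : ℝ) ^ 4 * (2 - (1 / 2) ^ m) + A * (N : ℝ) ^ (2 - ε) * T ^ (1 + ε))) :=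
        h2.trans (by gcongr)
    _ ≤ 8 / T * (C * ((N : ℝ) ^ 4 * 2 + A * (N : ℝ) ^ (2 - ε) * T ^ (1 + ε))) := by gcongr
    _ = 16 * C * ((N : ℝ) ^ 4 / T) + 8 * C * A * ((N : ℝ) ^ (2 - ε) * T ^ (1 + ε) / T) := by ring
    _ = 16 * C * (2 ^ w * (N : ℝ) ^ 2) + 8 * C * A * (((1 / 2 : ℝ) ^ ε) ^ w * (N : ℝ) ^ (2 + ε)) := by
        rw [e1, e2]
    _ ≤ 16 * C * (2 ^ w * (N : ℝ) ^ (2 + ε)) +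
          16 * C * A * (((1 / 2 : ℝ) ^ ε) ^ w * (N : ℝ) ^ (2 + ε)) := by
        gcongr
        norm_num
    _ = _ := by ring

theorem quadCount_le_trivial (α : ℝ) (K : ℕ) : (quadCount α K : ℝ) ≤ ((2 : ℝ) ^ K) ^ 4 := by
  unfold quadCount
  refine (closeCount_le_sq _ _ _).trans (le_of_eq ?_)
  have h : 2 ^ (K + 1) - 2 ^ K = 2 ^ K := by rw [pow_succ]; omega
  rw [Finset.card_product, Nat.card_Ico, h]
  push_cast
  ring

/-- The number of quadruples in a dyadic block is at most its length to the power `2 + ε`. -/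
theorem exists_quadCount_le {α ε : ℝ} (hα0 : α ≠ 0) (hα1 : α < 1) (hε : 0 < ε) :
    ∃ A : ℝ, 0 < A ∧ ∀ K : ℕ, (quadCount α K : ℝ) ≤ A * ((2 : ℝ) ^ K) ^ (2 + ε) := by
  have hα1' : α - 1 ≠ 0 := by linarith
  set β := α / (α - 1) with hβ
  have hβ0 : β ≠ 0 := div_ne_zero hα0 hα1'
  have hβα : β / (β - 1) = α := by
    have : β - 1 = 1 / (α - 1) := by rw [hβ]; field_simp; ring
    rw [this, hβ]; field_simp
  have hβ1 : β < 1 := by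
    have : β - 1 = 1 / (α - 1) := by rw [hβ]; field_simp; ring
    have h2 : 1 / (α - 1) < 0 := one_div_neg.2 (by linarith)
    linarith
  obtain ⟨lb1, C1, hlb1, hC1, hs1⟩ := exists_quadCount_step hα0 hα1 hε
  obtain ⟨lb2, C2, hlb2, hC2, hs2⟩ := exists_quadCount_step hβ0 hβ1 hε
  rw [hβα] at hs2
  have hhalf : (1 / 2 : ℝ) ^ ε < 1 := Real.rpow_lt_one (by norm_num) (by norm_num) hε
  have hhalf0 : 0 ≤ (1 / 2 : ℝ) ^ ε := by positivity
  -- This makes the coefficient of `A` in the inductive step at most `1/2`, for both exponents at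
  -- once.
  obtain ⟨w0, hw0⟩ := exists_pow_lt_of_lt_one (show 0 < 1 / (2 * (C1 + C2)) by positivity) hhalf
  obtain ⟨w1, hw1⟩ := pow_unbounded_of_one_lt (lb1 + lb2) (one_lt_two)
  set w := w0 + w1 + 2 with hw
  have hwpow : ((1 / 2 : ℝ) ^ ε) ^ w ≤ 1 / (2 * (C1 + C2)) :=
    (pow_le_pow_of_le_one hhalf0 hhalf.le (by omega)).trans hw0.le
  have hwlb : lb1 + lb2 < 2 ^ w := lt_of_lt_of_le hw1 (pow_le_pow_right₀ one_le_two (by omega))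
  -- The first summand absorbs the inhomogeneous term of the step, the second covers the base range
  -- `2K < w` by the trivial count.
  set A : ℝ := 2 * (C1 + C2) * 2 ^ w + (2 ^ w) ^ 4 with hA
  have hA0 : 0 < A := by positivity
  have hclose : ∀ C, 0 < C → C ≤ C1 + C2 → C * (2 ^ w + A * ((1 / 2 : ℝ) ^ ε) ^ w) ≤ A := by
    intro C hC hle
    have h1 : (C1 + C2) * (A * ((1 / 2 : ℝ) ^ ε) ^ w) ≤ A / 2 := by
      calc _ ≤ (C1 + C2) * (A * (1 / (2 * (C1 + C2)))) := by gcongr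
        _ = A / 2 := by field_simp
    have h2 : 2 * ((C1 + C2) * 2 ^ w) ≤ A := by
      have : (0 : ℝ) ≤ (2 ^ w) ^ 4 := by positivity
      rw [hA]; linarith
    calc _ ≤ (C1 + C2) * (2 ^ w + A * ((1 / 2 : ℝ) ^ ε) ^ w) := by gcongr
      _ = (C1 + C2) * 2 ^ w + (C1 + C2) * (A * ((1 / 2 : ℝ) ^ ε) ^ w) := by ring
      _ ≤ A := by linarith
  -- Duality exchanges `α` and `β` and is an involution, so the two bounds must be proved together.
  have hmain : ∀ K : ℕ, (quadCount α K : ℝ) ≤ A * ((2 : ℝ) ^ K) ^ (2 + ε) ∧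
      (quadCount β K : ℝ) ≤ A * ((2 : ℝ) ^ K) ^ (2 + ε) := by
    intro K
    induction K using Nat.strong_induction_on with
    | _ K ih =>
      rcases le_or_gt w (2 * K) with hle | hlt
      · constructor
        · refine (hs1 K w A (by omega) hle (by linarith) hA0.le fun k hk => (ih k hk).2).trans ?_
          gcongr
          exact hclose C1 hC1 (by linarith)
        · refine (hs2 K w A (by omega) hle (by linarith) hA0.le fun k hk => (ih k hk).1).trans ?_
          gcongr
          exact hclose C2 hC2 (by linarith)
      · have h1 : ((2 : ℝ) ^ K) ^ 4 ≤ A := by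
          have : (2 : ℝ) ^ K ≤ 2 ^ w := pow_le_pow_right₀ one_le_two (by omega)
          calc ((2 : ℝ) ^ K) ^ 4 ≤ (2 ^ w) ^ 4 := by gcongr
            _ ≤ A := by
              have : 0 ≤ 2 * (C1 + C2) * 2 ^ w := by positivity
              rw [hA]; linarith
        have h2 : A ≤ A * ((2 : ℝ) ^ K) ^ (2 + ε) :=
          le_mul_of_one_le_right hA0.le
            (Real.one_le_rpow (one_le_pow₀ one_le_two) (by linarith))
        exact ⟨(quadCount_le_trivial α K).trans (h1.trans h2),
          (quadCount_le_trivial β K).trans (h1.trans h2)⟩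
  exact ⟨A, hA0, fun K => (hmain K).1⟩

/-! ### Quadruples of negative powers -/

theorem closeCount_neg {ι : Type*} (s : Finset ι) (f : ι → ℝ) (η : ℝ) :
    closeCount s (fun p => -f p) η = closeCount s f η := by
  classical
  unfold closeCount
  congr 1
  refine Finset.filter_congr fun p _ => ?_
  rw [← neg_sub', abs_neg]

/-- Up to the factor `γ (N / 2^j)^γ`, the frequency `-(N/l)^γ` is the monomial phase of exponent
`-γ` at `l / 2^j`, and `-γ` is nonzero and less than `1`. That factor is bounded below as `N` and
`2^j` are comparable, so the moment has length `≫ N^2`. -/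
theorem exists_negPow_block_moment_le {γ ε : ℝ} (hγ : 0 < γ) (hε : 0 < ε) :
    ∃ C : ℝ, 0 < C ∧ ∀ (N j : ℕ) (s : Finset ℕ), 0 < N → 2 ^ j ≤ 2 * N → N ≤ 2 * 2 ^ j →
      s ⊆ Finset.Ico (2 ^ j) (2 ^ (j + 1)) →
      ∫ y in (0 : ℝ)..1, ‖∑ l ∈ s, addExp (-(y * ((N : ℝ) ^ 2 / 4) * -((N / l : ℝ) ^ γ)))‖ ^ 4
        ≤ C * (N : ℝ) ^ (2 + ε) := by
  obtain ⟨C, hC, hblock⟩ := exists_block_moment_le (β := -γ)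
  obtain ⟨A, hA, hquad⟩ := exists_quadCount_le (α := -γ) (by linarith) (by linarith) hε
  refine ⟨C * (1 + 16 * 2 ^ γ / γ) * (A * 2 ^ (2 + ε)), by positivity, ?_⟩
  intro N j s hN h1 h2 hs
  have hN0 : (0 : ℝ) < N := by exact_mod_cast hN
  have h1r : (2 : ℝ) ^ j ≤ 2 * N := by exact_mod_cast h1
  have h2r : (N : ℝ) ≤ 2 * 2 ^ j := by exact_mod_cast h2
  set P : ℝ := 2 ^ j with hP
  have hP0 : 0 < P := by positivity
  set c : ℝ := γ * (N / P) ^ γ with hc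
  have hc0 : 0 < c := by positivity
  set T : ℝ := (N : ℝ) ^ 2 / 4 with hT
  have hT0 : 0 < T := by positivity
  have hR0 : 0 < T * c := by positivity
  have heq : ∀ y : ℝ, ‖∑ l ∈ s, addExp (-(y * T * -((N / l : ℝ) ^ γ)))‖ ^ 4
      = (fun x => ‖∑ l ∈ s, addExp (-(x * powPhase (-γ) (l / P)))‖ ^ 4) (y * (T * c)) := by
    intro y
    congr 2
    refine Finset.sum_congr rfl fun l hl => ?_
    have hl0 : (0 : ℝ) < l := by
      have := (Finset.mem_Ico.1 (hs hl)).1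
      have h3 : 0 < 2 ^ j := by positivity
      exact_mod_cast (by omega : 0 < l)
    congr 2
    have : (N / l : ℝ) ^ γ = (N / P) ^ γ * (l / P) ^ (-γ) := by
      rw [Real.rpow_neg (by positivity), ← Real.inv_rpow (by positivity),
        ← Real.mul_rpow (by positivity) (by positivity)]
      congr 1
      field_simp
    rw [this, powPhase, hc]
    field_simp
  rw [intervalIntegral.integral_congr fun y _ => heq y]
  rw [intervalIntegral.integral_comp_mul_right
    (fun x => ‖∑ l ∈ s, addExp (-(x * powPhase (-γ) (l / P)))‖ ^ 4) hR0.ne', zero_mul, one_mul, smul_eq_mul]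
  have hb := hblock j s (T * c) hR0 hs
  rw [← hP] at hb
  have hq := hquad j
  rw [← hP] at hq
  have e1 : (T * c)⁻¹ * 4 ^ j ≤ 16 * 2 ^ γ / γ := by
    have h4 : (4 : ℝ) ^ j = P ^ 2 := by rw [hP, ← pow_mul, mul_comm, pow_mul]; norm_num
    have hcl : γ * (1 / 2) ^ γ ≤ c := by
      have : (1 / 2 : ℝ) ≤ N / P := by rw [div_le_div_iff₀ two_pos hP0]; linarith
      rw [hc]
      exact mul_le_mul_of_nonneg_left (Real.rpow_le_rpow (by norm_num) this hγ.le) hγ.le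
    rw [h4, inv_mul_le_iff₀ hR0]
    have h5 : (1 / 2 : ℝ) ^ γ * 2 ^ γ = 1 := by
      rw [← Real.mul_rpow (by norm_num) (by norm_num)]; norm_num
    calc P ^ 2 ≤ (2 * N) ^ 2 := by gcongr
      _ = T * (γ * (1 / 2) ^ γ) * (16 * 2 ^ γ / γ) := by
          rw [hT]; field_simp; linear_combination (-16 : ℝ) * h5
      _ ≤ _ := by gcongr
  calc (T * c)⁻¹ * _ ≤ (T * c)⁻¹ * (C * (T * c + 4 ^ j) * (A * P ^ (2 + ε))) := by
        gcongr
        exact hb.trans (by gcongr)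
    _ = C * (1 + (T * c)⁻¹ * 4 ^ j) * (A * P ^ (2 + ε)) := by field_simp
    _ ≤ C * (1 + 16 * 2 ^ γ / γ) * (A * (2 * N) ^ (2 + ε)) := by gcongr
    _ = _ := by rw [Real.mul_rpow two_pos.le hN0.le]; ring

/-- Quadruples `n₁, …, n₄` in a dyadic range with `(N/n₁)^γ - (N/n₂)^γ` close to
`(N/n₃)^γ - (N/n₄)^γ`. -/
theorem exists_quadruple_count_le {γ ε : ℝ} (hγ : 0 < γ) (hε : 0 < ε) :
    ∃ C : ℝ, 0 < C ∧ ∀ (N : ℕ) (η : ℝ), 0 < N → 0 ≤ η →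
      (closeCount (Finset.Ioc N (2 * N) ×ˢ Finset.Ioc N (2 * N))
        (fun p : ℕ × ℕ => (N / p.1 : ℝ) ^ γ - (N / p.2 : ℝ) ^ γ) η : ℝ)
        ≤ C * (η * N ^ 2 + 1) * (N : ℝ) ^ (2 + ε) := by
  classical
  obtain ⟨C, hC, hb⟩ := exists_negPow_block_moment_le hγ hε
  refine ⟨3 * (128 * C), by positivity, ?_⟩
  intro N η hN hη
  have hN0 : (0 : ℝ) < N := by exact_mod_cast hN
  set s := Finset.Ioc N (2 * N) with hs
  set f : ℕ × ℕ → ℝ := fun p => (N / p.1 : ℝ) ^ γ - (N / p.2 : ℝ) ^ γ with hf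
  set T : ℝ := (N : ℝ) ^ 2 / 4 with hT
  have hT0 : 0 < T := by positivity
  have h1 : (closeCount (s ×ˢ s) f (1 / N ^ 2) : ℝ) ≤ 128 * C * (N : ℝ) ^ (2 + ε) := by
    set g : ℕ → ℝ := fun l => -((N / l : ℝ) ^ γ) with hg
    have hfg : closeCount (s ×ˢ s) f (1 / N ^ 2) =
        closeCount (s ×ˢ s) (fun p => g p.1 - g p.2) (1 / (4 * T)) := by
      rw [← closeCount_neg, hT, mul_div_cancel₀ _ (by norm_num : (4 : ℝ) ≠ 0)]
      congr 1
      ext p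
      simp only [hf, hg]; ring
    have hms := closeCount_le_mean_square (subset_refl (s ×ˢ s)) (fun _ => 1)
      (fun _ _ => zero_le_one) (fun _ _ => le_refl 1) (fun p : ℕ × ℕ => g p.1 - g p.2) hT0
    rw [hfg]
    refine hms.trans ?_
    -- The interval `(N, 2N]` meets only two dyadic blocks and is cut at `2^(K+1)`. The constant 128
    -- is 8 from counting by a mean square, 8 from the fourth power of a sum of two, and 2 for the
    -- blocks.
    set K := Nat.log 2 N with hK
    have hK1 : 2 ^ K ≤ N := Nat.pow_log_le_self 2 hN.ne'
    have hK2 : N < 2 ^ (K + 1) := Nat.lt_pow_succ_log_self one_lt_two N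
    have hK3 : 2 ^ (K + 1) = 2 * 2 ^ K := by rw [pow_succ, mul_comm]
    have hK4 : 2 ^ (K + 1 + 1) = 2 * 2 ^ (K + 1) := by rw [pow_succ, mul_comm]
    set s0 := s.filter (· < 2 ^ (K + 1)) with hs0
    set s1 := s.filter (fun n => ¬ n < 2 ^ (K + 1)) with hs1
    have hb0 := hb N K s0 hN (by omega) (by omega) (by
      intro n hn
      rw [hs0, Finset.mem_filter, hs, Finset.mem_Ioc] at hn
      rw [Finset.mem_Ico]; omega)
    have hb1 := hb N (K + 1) s1 hN (by omega) (by omega) (by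
      intro n hn
      rw [hs1, Finset.mem_filter, hs, Finset.mem_Ioc] at hn
      rw [Finset.mem_Ico]; omega)
    have hcont : ∀ t : Finset ℕ, Continuous fun y : ℝ => ‖∑ l ∈ t, addExp (-(y * T * g l))‖ ^ 4 := by
      intro t
      have := continuous_addExp
      fun_prop
    have hle : (∫ y in (0 : ℝ)..1, ‖∑ p ∈ s ×ˢ s, ((1 : ℝ) : ℂ) *
          addExp (y * T * (g p.1 - g p.2))‖ ^ 2)
        ≤ ∫ y in (0 : ℝ)..1, (8 * (‖∑ l ∈ s0, addExp (-(y * T * g l))‖ ^ 4 +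
          ‖∑ l ∈ s1, addExp (-(y * T * g l))‖ ^ 4)) := by
      simp_rw [Complex.ofReal_one, ← norm_sum_addExp_pow_four]
      refine intervalIntegral.integral_mono_on zero_le_one ((hcont s).intervalIntegrable _ _)
        ((((hcont s0).add (hcont s1)).const_mul 8).intervalIntegrable _ _) fun y _ => ?_
      rw [← Finset.sum_filter_add_sum_filter_not s (· < 2 ^ (K + 1))]
      exact (pow_le_pow_left₀ (norm_nonneg _) (norm_add_le _ _) 4).trans pow_four_add_le
    rw [intervalIntegral.integral_const_mul, intervalIntegral.integral_add
      ((hcont s0).intervalIntegrable _ _) ((hcont s1).intervalIntegrable _ _)] at hle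
    linarith
  have h2 := closeCount_le_mul (s ×ˢ s) f (η := 1 / (N : ℝ) ^ 2) (t := η * N ^ 2) (by positivity)
    (by positivity)
  rw [show η * (N : ℝ) ^ 2 * (1 / (N : ℝ) ^ 2) = η by field_simp] at h2
  calc _ ≤ _ := h2
    _ ≤ (3 * (η * N ^ 2) + 3) * (128 * C * (N : ℝ) ^ (2 + ε)) := by
        gcongr
        norm_num
    _ = _ := by ring

/-! ### Spacing of the monomials -/

theorem card_le_of_separated {ι : Type*} (s : Finset ι) (f : ι → ℝ) {σ ℓ : ℝ} (hσ : 0 < σ)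
    (hℓ : 0 ≤ ℓ) (hsep : ∀ i ∈ s, ∀ j ∈ s, i ≠ j → σ ≤ |f i - f j|)
    (hd : ∀ i ∈ s, ∀ j ∈ s, |f i - f j| ≤ ℓ) : (s.card : ℝ) ≤ ℓ / σ + 1 := by
  classical
  rcases s.eq_empty_or_nonempty with rfl | hs
  · simp; positivity
  obtain ⟨i0, hi0, hmin⟩ := s.exists_min_image f hs
  have hcard : s.card ≤ (Finset.range (⌊ℓ / σ⌋₊ + 1)).card := by
    refine Finset.card_le_card_of_injOn (fun i => ⌊(f i - f i0) / σ⌋₊) ?_ ?_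
    · intro i hi
      simp only [Finset.coe_range, Set.mem_Iio, Order.lt_add_one_iff]
      refine Nat.floor_le_floor ?_
      gcongr
      exact (le_abs_self _).trans (hd i hi i0 hi0)
    · intro i hi j hj hij
      by_contra hne
      simp only at hij
      have h1 := hsep i hi j hj hne
      have hi1 : 0 ≤ (f i - f i0) / σ := div_nonneg (sub_nonneg.2 (hmin i hi)) hσ.le
      have hj1 : 0 ≤ (f j - f i0) / σ := div_nonneg (sub_nonneg.2 (hmin j hj)) hσ.le
      have a1 := Nat.floor_le hi1
      have a2 := Nat.lt_floor_add_one ((f i - f i0) / σ)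
      have a3 := Nat.floor_le hj1
      have a4 := Nat.lt_floor_add_one ((f j - f i0) / σ)
      rw [hij] at a1 a2
      have : |(f i - f i0) / σ - (f j - f i0) / σ| < 1 := by
        rw [abs_lt]; constructor <;> linarith
      rw [← sub_div, sub_sub_sub_cancel_right, abs_div, abs_of_pos hσ, div_lt_one hσ] at this
      linarith
  rw [Finset.card_range] at hcard
  calc (s.card : ℝ) ≤ ((⌊ℓ / σ⌋₊ + 1 : ℕ) : ℝ) := by exact_mod_cast hcard
    _ ≤ _ := by push_cast; linarith [Nat.floor_le (show 0 ≤ ℓ / σ by positivity)]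

/-- A fraction determines its reduced numerator and denominator; fixing the gcd determines the pair.
-/
theorem eq_of_gcd_eq_of_mul_eq {a b c d g : ℕ} (hg : 0 < g) (h1 : Nat.gcd a b = g)
    (h2 : Nat.gcd c d = g) (h : a * d = c * b) : a = c ∧ b = d := by
  obtain ⟨a', b', hco, ha, hb⟩ := Nat.exists_coprime a b
  obtain ⟨c', d', hco', hc, hd⟩ := Nat.exists_coprime c d
  rw [h1] at ha hb
  rw [h2] at hc hd
  have h' : a' * d' = c' * b' := by
    have : (g * g) * (a' * d') = (g * g) * (c' * b') := by
      rw [ha, hb, hc, hd] at h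
      linarith
    exact Nat.eq_of_mul_eq_mul_left (by positivity) this
  have e1 : a' = c' := Nat.dvd_antisymm
    (hco.dvd_of_dvd_mul_right (h' ▸ Dvd.intro _ rfl))
    (hco'.dvd_of_dvd_mul_right (h'.symm ▸ Dvd.intro _ rfl))
  have e2 : b' = d' := Nat.dvd_antisymm
    (hco.symm.dvd_of_dvd_mul_left (h'.symm ▸ Dvd.intro_left _ rfl))
    (hco'.symm.dvd_of_dvd_mul_left (h' ▸ Dvd.intro_left _ rfl))
  exact ⟨by rw [ha, hc, e1], by rw [hb, hd, e2]⟩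

/-- Pairs with a prescribed greatest common divisor and nearly equal ratios. -/
theorem card_gcd_eq_close_ratio_le {H d : ℕ} (hH : 0 < H) (hd : 0 < d) {ℓ : ℝ} (hℓ : 0 ≤ ℓ)
    (s : Finset (ℕ × ℕ)) (hs : s ⊆ Finset.Ioc H (2 * H) ×ˢ Finset.Ioc H (2 * H))
    (hgcd : ∀ p ∈ s, Nat.gcd p.1 p.2 = d)
    (hclose : ∀ p ∈ s, ∀ q ∈ s, |(p.1 / p.2 : ℝ) - q.1 / q.2| ≤ ℓ) :
    (s.card : ℝ) ≤ 4 * ℓ * H ^ 2 / d ^ 2 + 1 := by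
  have hH0 : (0 : ℝ) < H := by exact_mod_cast hH
  have hd0 : (0 : ℝ) < d := by exact_mod_cast hd
  have h := card_le_of_separated s (fun p : ℕ × ℕ => (p.1 / p.2 : ℝ))
    (σ := (d : ℝ) ^ 2 / (4 * H ^ 2)) (by positivity) hℓ ?_ hclose
  · refine h.trans (le_of_eq ?_)
    field_simp
  intro p hp q hq hpq
  have bd : ∀ p ∈ s, (0 : ℝ) < p.2 ∧ (p.2 : ℝ) ≤ 2 * H := by
    intro p hp
    have h1 := hs hp
    rw [Finset.mem_product, Finset.mem_Ioc, Finset.mem_Ioc] at h1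
    exact ⟨by exact_mod_cast (by omega : 0 < p.2), by exact_mod_cast h1.2.2⟩
  obtain ⟨p0, p1⟩ := bd p hp
  obtain ⟨q0, q1⟩ := bd q hq
  have hne : p.1 * q.2 ≠ q.1 * p.2 := by
    intro he
    obtain ⟨e1, e2⟩ := eq_of_gcd_eq_of_mul_eq hd (hgcd p hp) (hgcd q hq) he
    exact hpq (Prod.ext e1 e2)
  -- The cross product of two pairs is a nonzero multiple of `d^2`, which separates the ratios by at
  -- least `d^2 / (4 H^2)`.
  have hdvd : ((d : ℤ) ^ 2) ∣ ((p.1 * q.2 : ℤ) - q.1 * p.2) := by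
    have a1 : (d : ℤ) ∣ p.1 := by exact_mod_cast (hgcd p hp) ▸ Nat.gcd_dvd_left p.1 p.2
    have a2 : (d : ℤ) ∣ p.2 := by exact_mod_cast (hgcd p hp) ▸ Nat.gcd_dvd_right p.1 p.2
    have a3 : (d : ℤ) ∣ q.1 := by exact_mod_cast (hgcd q hq) ▸ Nat.gcd_dvd_left q.1 q.2
    have a4 : (d : ℤ) ∣ q.2 := by exact_mod_cast (hgcd q hq) ▸ Nat.gcd_dvd_right q.1 q.2
    rw [sq]
    exact dvd_sub (mul_dvd_mul a1 a4) (mul_dvd_mul a3 a2)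
  have hz : ((p.1 * q.2 : ℤ) - q.1 * p.2) ≠ 0 := by
    rw [sub_ne_zero]; exact_mod_cast hne
  have hle : (d : ℤ) ^ 2 ≤ |(p.1 * q.2 : ℤ) - q.1 * p.2| :=
    Int.le_of_dvd (abs_pos.2 hz) ((dvd_abs _ _).2 hdvd)
  have hler : (d : ℝ) ^ 2 ≤ |(p.1 * q.2 : ℝ) - q.1 * p.2| := by exact_mod_cast hle
  have : (p.1 / p.2 : ℝ) - q.1 / q.2 = (p.1 * q.2 - q.1 * p.2) / (p.2 * q.2) := by
    field_simp
  rw [this, abs_div, abs_of_pos (mul_pos p0 q0)]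
  calc (d : ℝ) ^ 2 / (4 * H ^ 2) = d ^ 2 / ((2 * H) * (2 * H)) := by ring
    _ ≤ _ := by gcongr

/-- Fix the second pair: both its entries are multiples of `e`, leaving at most `(2M/e)^2` choices.
The first pairs above it share a gcd and have nearly equal ratios. -/
theorem card_mul_gcd_eq_le {H M d e : ℕ} (hH : 0 < H) (hd : 0 < d)
    {ℓ : ℝ} (hℓ : 0 ≤ ℓ) (Q : Finset ((ℕ × ℕ) × (ℕ × ℕ)))
    (hQ1 : ∀ p ∈ Q, p.1 ∈ Finset.Ioc H (2 * H) ×ˢ Finset.Ioc H (2 * H))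
    (hQ2 : ∀ p ∈ Q, p.2 ∈ Finset.Ioc M (2 * M) ×ˢ Finset.Ioc M (2 * M))
    (hd1 : ∀ p ∈ Q, Nat.gcd p.1.1 p.1.2 = d) (he : ∀ p ∈ Q, Nat.gcd p.2.1 p.2.2 = e)
    (hclose : ∀ p ∈ Q, ∀ q ∈ Q, p.2 = q.2 → |(p.1.1 / p.1.2 : ℝ) - q.1.1 / q.1.2| ≤ ℓ) :
    (Q.card : ℝ) ≤ (2 * M / e) ^ 2 * (4 * ℓ * H ^ 2 / d ^ 2 + 1) := by
  classical
  set D := (Finset.Ioc 0 (2 * M)).filter (e ∣ ·) with hD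
  have hDcard : (D.card : ℝ) ≤ 2 * M / e := by
    rw [hD, Nat.Ioc_filter_dvd_card_eq_div]
    exact_mod_cast Nat.cast_div_le (α := ℝ) (m := 2 * M) (n := e)
  have hmaps : ∀ p ∈ Q, p.2 ∈ D ×ˢ D := by
    intro p hp
    have h2 := hQ2 p hp
    rw [Finset.mem_product, Finset.mem_Ioc, Finset.mem_Ioc] at h2
    rw [hD, Finset.mem_product, Finset.mem_filter, Finset.mem_filter, Finset.mem_Ioc,
      Finset.mem_Ioc]
    exact ⟨⟨⟨by omega, h2.1.2⟩, he p hp ▸ Nat.gcd_dvd_left _ _⟩,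
      ⟨⟨by omega, h2.2.2⟩, he p hp ▸ Nat.gcd_dvd_right _ _⟩⟩
  rw [Finset.card_eq_sum_card_fiberwise hmaps]
  push_cast
  calc _ ≤ ∑ _v ∈ D ×ˢ D, (4 * ℓ * H ^ 2 / d ^ 2 + 1) := by
        refine Finset.sum_le_sum fun v _ => ?_
        have hinj : Set.InjOn Prod.fst (Q.filter fun p => p.2 = v : Set ((ℕ × ℕ) × (ℕ × ℕ))) := by
          intro p hp q hq hpq
          simp only [Finset.coe_filter, Set.mem_ofPred_eq] at hp hq
          exact Prod.ext hpq (hp.2.trans hq.2.symm)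
        rw [← Finset.card_image_of_injOn (f := Prod.fst) (by simpa using hinj)]
        refine card_gcd_eq_close_ratio_le hH hd hℓ _ ?_ ?_ ?_
        · intro w hw
          obtain ⟨p, hp, rfl⟩ := Finset.mem_image.1 hw
          exact hQ1 p (Finset.mem_filter.1 hp).1
        · intro w hw
          obtain ⟨p, hp, rfl⟩ := Finset.mem_image.1 hw
          exact hd1 p (Finset.mem_filter.1 hp).1
        · intro w hw w' hw'
          obtain ⟨p, hp, rfl⟩ := Finset.mem_image.1 hw
          obtain ⟨q, hq, rfl⟩ := Finset.mem_image.1 hw'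
          rw [Finset.mem_filter] at hp hq
          exact hclose p hp.1 q hq.1 (hp.2.trans hq.2.symm)
    _ = (D.card : ℝ) ^ 2 * (4 * ℓ * H ^ 2 / d ^ 2 + 1) := by
        rw [Finset.sum_const, Finset.card_product, nsmul_eq_mul]; push_cast; ring
    _ ≤ _ := by gcongr

theorem abs_log_sub_log_le {a b c : ℝ} (hc : 0 < c) (ha : c ≤ a) (hb : c ≤ b) :
    |Real.log a - Real.log b| ≤ |a - b| / c := by
  wlog h : b ≤ a generalizing a b
  · rw [abs_sub_comm, abs_sub_comm a]; exact this hb ha (le_of_not_ge h)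
  have ha0 : 0 < a := hc.trans_le ha
  have hb0 : 0 < b := hc.trans_le hb
  rw [abs_of_nonneg (sub_nonneg.2 (Real.log_le_log hb0 h)), abs_of_nonneg (sub_nonneg.2 h),
    ← Real.log_div ha0.ne' hb0.ne']
  calc Real.log (a / b) ≤ a / b - 1 := Real.log_le_sub_one_of_pos (by positivity)
    _ = (a - b) / b := by field_simp
    _ ≤ _ := by gcongr

theorem abs_sub_le_mul_abs_log_sub_log {a b c : ℝ} (ha0 : 0 < a) (hb0 : 0 < b) (ha : a ≤ c)
    (hb : b ≤ c) : |a - b| ≤ c * |Real.log a - Real.log b| := by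
  wlog h : b ≤ a generalizing a b
  · rw [abs_sub_comm, abs_sub_comm (Real.log a)]; exact this hb0 ha0 hb ha (le_of_not_ge h)
  have hl := Real.log_le_log hb0 h
  rw [abs_of_nonneg (sub_nonneg.2 hl), abs_of_nonneg (sub_nonneg.2 h)]
  have h1 : Real.log (b / a) ≤ b / a - 1 := Real.log_le_sub_one_of_pos (by positivity)
  rw [Real.log_div hb0.ne' ha0.ne'] at h1
  calc a - b = a * (1 - b / a) := by field_simp
    _ ≤ a * (Real.log a - Real.log b) := mul_le_mul_of_nonneg_left (by linarith) ha0.le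
    _ ≤ _ := mul_le_mul_of_nonneg_right ha (by linarith)

/-- Points `(h, m)` at which the monomial `(h/H)^α (M/m)^β` takes close values have nearly
proportional coordinates. -/
theorem abs_log_ratio_le {α β : ℝ} (hα : 0 < α) (hβ : 0 < β) {H M h h' m m' : ℕ} (hM : 0 < M)
    (hH : 0 < H)
    (hh : h ∈ Finset.Ioc H (2 * H)) (hh' : h' ∈ Finset.Ioc H (2 * H))
    (hm : m ∈ Finset.Ioc M (2 * M)) (hm' : m' ∈ Finset.Ioc M (2 * M)) {η : ℝ}
    (hx : |(h / H : ℝ) ^ α * (M / m : ℝ) ^ β - (h' / H : ℝ) ^ α * (M / m' : ℝ) ^ β| ≤ η) :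
    |α * Real.log (h / h') - β * Real.log (m / m')| ≤ 2 ^ β * η := by
  rw [Finset.mem_Ioc] at hh hh' hm hm'
  have H0 : (0 : ℝ) < H := by exact_mod_cast hH
  have M0 : (0 : ℝ) < M := by exact_mod_cast hM
  have lower : ∀ h m : ℕ, H < h ∧ h ≤ 2 * H → M < m ∧ m ≤ 2 * M →
      (1 / 2 : ℝ) ^ β ≤ (h / H : ℝ) ^ α * (M / m : ℝ) ^ β := by
    intro h m hh hm
    have h0 : (H : ℝ) ≤ h := by exact_mod_cast hh.1.le
    have m0 : (0 : ℝ) < m := by exact_mod_cast (by omega : 0 < m)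
    have m1 : (m : ℝ) ≤ 2 * M := by exact_mod_cast hm.2
    have a1 : (1 : ℝ) ≤ (h / H : ℝ) ^ α := Real.one_le_rpow ((one_le_div H0).2 h0) hα.le
    have a2 : (1 / 2 : ℝ) ^ β ≤ (M / m : ℝ) ^ β := by
      refine Real.rpow_le_rpow (by norm_num) ?_ hβ.le
      rw [div_le_div_iff₀ two_pos m0]; linarith
    exact a2.trans (le_mul_of_one_le_left (by positivity) a1)
  have hlog : ∀ h m : ℕ, H < h → M < m → Real.log ((h / H : ℝ) ^ α * (M / m : ℝ) ^ β)
      = α * (Real.log h - Real.log H) + β * (Real.log M - Real.log m) := by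
    intro h m hh hm
    have h0 : (0 : ℝ) < h := by exact_mod_cast (by omega : 0 < h)
    have m0 : (0 : ℝ) < m := by exact_mod_cast (by omega : 0 < m)
    rw [Real.log_mul (by positivity) (by positivity), Real.log_rpow (by positivity),
      Real.log_rpow (by positivity), Real.log_div h0.ne' H0.ne', Real.log_div M0.ne' m0.ne']
  have h1 := abs_log_sub_log_le (by positivity) (lower h m hh hm) (lower h' m' hh' hm')
  rw [hlog h m hh.1 hm.1, hlog h' m' hh'.1 hm'.1] at h1
  have e1 : (0 : ℝ) < h := by exact_mod_cast (by omega : 0 < h)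
  have e2 : (0 : ℝ) < h' := by exact_mod_cast (by omega : 0 < h')
  have e3 : (0 : ℝ) < m := by exact_mod_cast (by omega : 0 < m)
  have e4 : (0 : ℝ) < m' := by exact_mod_cast (by omega : 0 < m')
  rw [Real.log_div e1.ne' e2.ne', Real.log_div e3.ne' e4.ne']
  calc _ = |α * (Real.log h - Real.log H) + β * (Real.log M - Real.log m) -
        (α * (Real.log h' - Real.log H) + β * (Real.log M - Real.log m'))| := by congr 1; ring
    _ ≤ _ := h1
    _ ≤ η / (1 / 2 : ℝ) ^ β := by gcongr
    _ = _ := by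
        rw [one_div, Real.inv_rpow two_pos.le]; field_simp

theorem exists_sum_inv_le {ε : ℝ} (hε : 0 < ε) :
    ∃ C : ℝ, 0 < C ∧ ∀ n : ℕ, 0 < n →
      ∑ d ∈ Finset.Icc 1 (2 * n), (1 / d : ℝ) ≤ C * (n : ℝ) ^ ε := by
  refine ⟨1 + 2 ^ ε / ε, by positivity, fun n hn => ?_⟩
  have hn1 : (1 : ℝ) ≤ n := by exact_mod_cast hn
  have h1 : ∑ d ∈ Finset.Icc 1 (2 * n), (1 / d : ℝ) = (harmonic (2 * n) : ℝ) := by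
    rw [harmonic_eq_sum_Icc]; push_cast
    simp [one_div]
  have h2 := harmonic_le_one_add_log (2 * n)
  have h3 := Real.log_le_rpow_div (x := ((2 * n : ℕ) : ℝ)) (by positivity) hε
  rw [h1]
  refine h2.trans ?_
  have h4 : (((2 * n : ℕ)) : ℝ) ^ ε = 2 ^ ε * (n : ℝ) ^ ε := by
    push_cast; rw [Real.mul_rpow two_pos.le (by positivity)]
  rw [h4] at h3
  have h5 : (1 : ℝ) ≤ (n : ℝ) ^ ε := Real.one_le_rpow hn1 hε.le
  calc _ ≤ (n : ℝ) ^ ε + 2 ^ ε * (n : ℝ) ^ ε / ε := by linarith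
    _ = _ := by ring

/-- The values of the monomial `(h/H)^α (M/m)^β` are well spaced on average. -/
theorem exists_monomial_count_le {α β ε : ℝ} (hα : 0 < α) (hβ : 0 < β) (hε : 0 < ε) :
    ∃ C : ℝ, 0 < C ∧ ∀ (H M : ℕ) (η : ℝ), 0 < H → 0 < M → 0 ≤ η →
      (closeCount (Finset.Ioc H (2 * H) ×ˢ Finset.Ioc M (2 * M))
        (fun u : ℕ × ℕ => (u.1 / H : ℝ) ^ α * (M / u.2 : ℝ) ^ β) η : ℝ)
        ≤ C * (η * (H * M) + 1) * ((H * M : ℝ)) ^ (1 + ε) := by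
  classical
  obtain ⟨L, hL, hsum⟩ := exists_sum_inv_le hε
  set c : ℝ := 4 * 2 ^ β * (1 / α + 1 / β) with hc
  have hc0 : 0 < c := by positivity
  set B : ℝ := 16 * c + 4 with hB
  have hB0 : 0 < B := by positivity
  refine ⟨3 * (B * L ^ 2), by positivity, ?_⟩
  intro H M η hH hM hη
  have H0 : (0 : ℝ) < H := by exact_mod_cast hH
  have M0 : (0 : ℝ) < M := by exact_mod_cast hM
  set s := Finset.Ioc H (2 * H) ×ˢ Finset.Ioc M (2 * M) with hs
  set f : ℕ × ℕ → ℝ := fun u => (u.1 / H : ℝ) ^ α * (M / u.2 : ℝ) ^ β with hf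
  have h1 : (closeCount s f (1 / (H * M)) : ℝ) ≤ B * L ^ 2 * (H * M : ℝ) ^ (1 + ε) := by
    -- Regroup `(h, m), (h', m')` as `(h, h'), (m, m')`: closeness is now a relation between the
    -- ratios `h/h'` and `m/m'`.
    set Q : Finset ((ℕ × ℕ) × (ℕ × ℕ)) :=
      ((s ×ˢ s).filter fun p => |f p.1 - f p.2| ≤ 1 / (H * M)).image
        (fun p => ((p.1.1, p.2.1), (p.1.2, p.2.2))) with hQ
    have hQcard : closeCount s f (1 / (H * M)) = Q.card := by
      rw [hQ, Finset.card_image_of_injective]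
      · unfold closeCount; congr!
      · rintro ⟨⟨a, b⟩, ⟨c, d⟩⟩ ⟨⟨a', b'⟩, ⟨c', d'⟩⟩ h
        simp only [Prod.mk.injEq] at h ⊢
        tauto
    have hQmem : ∀ p ∈ Q, p.1.1 ∈ Finset.Ioc H (2 * H) ∧ p.1.2 ∈ Finset.Ioc H (2 * H) ∧
        p.2.1 ∈ Finset.Ioc M (2 * M) ∧ p.2.2 ∈ Finset.Ioc M (2 * M) ∧
        |α * Real.log (p.1.1 / p.1.2) - β * Real.log (p.2.1 / p.2.2)| ≤ 2 ^ β * (1 / (H * M)) := by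
      intro p hp
      obtain ⟨q, hq, rfl⟩ := Finset.mem_image.1 hp
      rw [Finset.mem_filter, Finset.mem_product, hs, Finset.mem_product, Finset.mem_product] at hq
      obtain ⟨⟨⟨q1, q2⟩, q3, q4⟩, q5⟩ := hq
      exact ⟨q1, q3, q2, q4, abs_log_ratio_le hα hβ hM hH q1 q3 q2 q4 q5⟩
    have ratio : ∀ (X a b : ℕ), a ∈ Finset.Ioc X (2 * X) → b ∈ Finset.Ioc X (2 * X) →
        (0 : ℝ) < a / b ∧ (a / b : ℝ) ≤ 2 := by
      intro X a b ha hb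
      rw [Finset.mem_Ioc] at ha hb
      have a0 : (0 : ℝ) < a := by exact_mod_cast (by omega : 0 < a)
      have b0 : (0 : ℝ) < b := by exact_mod_cast (by omega : 0 < b)
      refine ⟨by positivity, ?_⟩
      rw [div_le_iff₀ b0]
      exact_mod_cast (by omega : a ≤ 2 * b)
    set κ : ℝ := 2 ^ β * (1 / (H * M)) with hκ
    have hκ0 : 0 < κ := by positivity
    have hdiff : ∀ {a b c d : ℝ} {α : ℝ}, 0 < α → |α * a - c| ≤ κ → |α * b - d| ≤ κ → c = d →
        2 * |a - b| ≤ 4 * κ * (1 / α) := by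
      intro a b c d α hα h1 h2 h3
      subst h3
      have : α * |a - b| ≤ 2 * κ := by
        calc α * |a - b| = |α * (a - b)| := by rw [abs_mul, abs_of_pos hα]
          _ = |(α * a - c) - (α * b - c)| := by congr 1; ring
          _ ≤ _ := (abs_sub _ _).trans (by linarith)
      rw [mul_one_div, le_div_iff₀ hα]
      linarith
    -- The count is made twice, fixing first `(m, m')` and then `(h, h')`. With `x = H/d` and `y =
    -- M/e` the bounds are `16 c x y` plus `4 y^2` and `4 x^2` respectively, and the smaller of the
    -- two squares is at most `x y`. Summing `1/(d e)` then loses only logarithms.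
    have hde : ∀ d e : ℕ, 0 < d → 0 < e →
        ((Q.filter fun p => (Nat.gcd p.1.1 p.1.2, Nat.gcd p.2.1 p.2.2) = (d, e)).card : ℝ)
          ≤ B * (H * M) * ((1 / d) * (1 / e)) := by
      intro d e hd he
      have d1 : (1 : ℝ) ≤ d := by exact_mod_cast hd
      have e1 : (1 : ℝ) ≤ e := by exact_mod_cast he
      set R := Q.filter fun p => (Nat.gcd p.1.1 p.1.2, Nat.gcd p.2.1 p.2.2) = (d, e) with hR
      have hRm : ∀ p ∈ R, p ∈ Q ∧ Nat.gcd p.1.1 p.1.2 = d ∧ Nat.gcd p.2.1 p.2.2 = e := by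
        intro p hp
        rw [hR, Finset.mem_filter, Prod.mk.injEq] at hp
        exact hp
      have b1 := card_mul_gcd_eq_le (H := H) (M := M) (d := d) (e := e) hH hd
        (ℓ := 4 * κ * (1 / α)) (by positivity) R
        (fun p hp => Finset.mem_product.2 ⟨(hQmem p (hRm p hp).1).1, (hQmem p (hRm p hp).1).2.1⟩)
        (fun p hp => Finset.mem_product.2
          ⟨(hQmem p (hRm p hp).1).2.2.1, (hQmem p (hRm p hp).1).2.2.2.1⟩)
        (fun p hp => (hRm p hp).2.1) (fun p hp => (hRm p hp).2.2) (by
          intro p hp q hq hpq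
          obtain ⟨p1, p2, p3, p4, p5⟩ := hQmem p (hRm p hp).1
          obtain ⟨q1, q2, q3, q4, q5⟩ := hQmem q (hRm q hq).1
          obtain ⟨u1, u2⟩ := ratio H _ _ p1 p2
          obtain ⟨w1, w2⟩ := ratio H _ _ q1 q2
          refine (abs_sub_le_mul_abs_log_sub_log u1 w1 u2 w2).trans ?_
          exact hdiff hα p5 q5 (by rw [hpq]))
      have hR'card : (R.image Prod.swap).card = R.card :=
        Finset.card_image_of_injective _ Prod.swap_injective
      have b2 := card_mul_gcd_eq_le (H := M) (M := H) (d := e) (e := d) hM he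
        (ℓ := 4 * κ * (1 / β)) (by positivity) (R.image Prod.swap)
        (by
          intro p hp
          obtain ⟨p, hpR, rfl⟩ := Finset.mem_image.1 hp
          exact Finset.mem_product.2
            ⟨(hQmem p (hRm p hpR).1).2.2.1, (hQmem p (hRm p hpR).1).2.2.2.1⟩)
        (by
          intro p hp
          obtain ⟨p, hpR, rfl⟩ := Finset.mem_image.1 hp
          exact Finset.mem_product.2 ⟨(hQmem p (hRm p hpR).1).1, (hQmem p (hRm p hpR).1).2.1⟩)
        (by
          intro p hp
          obtain ⟨p, hpR, rfl⟩ := Finset.mem_image.1 hp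
          exact (hRm p hpR).2.2)
        (by
          intro p hp
          obtain ⟨p, hpR, rfl⟩ := Finset.mem_image.1 hp
          exact (hRm p hpR).2.1)
        (by
          intro p hp q hq hpq
          obtain ⟨p, hpR, rfl⟩ := Finset.mem_image.1 hp
          obtain ⟨q, hqR, rfl⟩ := Finset.mem_image.1 hq
          obtain ⟨p1, p2, p3, p4, p5⟩ := hQmem p (hRm p hpR).1
          obtain ⟨q1, q2, q3, q4, q5⟩ := hQmem q (hRm q hqR).1
          obtain ⟨u1, u2⟩ := ratio M _ _ p3 p4
          obtain ⟨w1, w2⟩ := ratio M _ _ q3 q4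
          refine (abs_sub_le_mul_abs_log_sub_log u1 w1 u2 w2).trans ?_
          rw [abs_sub_comm] at p5 q5
          simp only [Prod.snd_swap] at hpq
          exact hdiff hβ p5 q5 (by rw [hpq]))
      rw [hR'card] at b2
      set x : ℝ := H / d with hx
      set y : ℝ := M / e with hy
      have hx0 : 0 < x := by positivity
      have hy0 : 0 < y := by positivity
      have hκHM : κ * (H * M) = 2 ^ β := by rw [hκ]; field_simp
      have hxy : κ * (x * y) ≤ 2 ^ β := by
        rw [← hκHM]
        gcongr
        · exact div_le_self H0.le d1
        · exact div_le_self M0.le e1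
      have key : ∀ γ : ℝ, 0 < γ → 4 * 2 ^ β * (1 / γ) ≤ c →
          64 * (κ * (x * y)) * (1 / γ) * (x * y) ≤ 16 * c * (x * y) := by
        intro γ hγ hle
        calc _ ≤ 64 * 2 ^ β * (1 / γ) * (x * y) := by gcongr
          _ = 16 * (4 * 2 ^ β * (1 / γ)) * (x * y) := by ring
          _ ≤ _ := by gcongr
      have k1 := key α hα (by
        rw [hc]; gcongr
        have : 0 < 1 / β := by positivity
        linarith)
      have k2 := key β hβ (by
        rw [hc]; gcongr
        have : 0 < 1 / α := by positivity
        linarith)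
      have b1' : (R.card : ℝ) ≤ 16 * c * (x * y) + 4 * y ^ 2 := by
        refine b1.trans (le_trans (le_of_eq ?_) (add_le_add_left k1 _))
        rw [hx, hy]; field_simp; ring
      have b2' : (R.card : ℝ) ≤ 16 * c * (x * y) + 4 * x ^ 2 := by
        refine b2.trans (le_trans (le_of_eq ?_) (add_le_add_left k2 _))
        rw [hx, hy]; field_simp; ring
      have hfin : (R.card : ℝ) ≤ B * (x * y) := by
        rw [hB, add_mul]
        rcases le_total x y with hle | hle
        · refine b2'.trans ?_
          have : x ^ 2 ≤ x * y := by rw [sq]; gcongr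
          linarith
        · refine b1'.trans ?_
          have : y ^ 2 ≤ x * y := by rw [sq]; gcongr
          linarith
      refine hfin.trans (le_of_eq ?_)
      rw [hx, hy]; ring
    have hmaps : ∀ p ∈ Q, (Nat.gcd p.1.1 p.1.2, Nat.gcd p.2.1 p.2.2) ∈
        Finset.Icc 1 (2 * H) ×ˢ Finset.Icc 1 (2 * M) := by
      intro p hp
      obtain ⟨p1, p2, p3, p4, -⟩ := hQmem p hp
      rw [Finset.mem_Ioc] at p1 p3
      have g1 := Nat.gcd_pos_of_pos_left p.1.2 (show 0 < p.1.1 by omega)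
      have g2 := Nat.gcd_le_left p.1.2 (show 0 < p.1.1 by omega)
      have g3 := Nat.gcd_pos_of_pos_left p.2.2 (show 0 < p.2.1 by omega)
      have g4 := Nat.gcd_le_left p.2.2 (show 0 < p.2.1 by omega)
      rw [Finset.mem_product, Finset.mem_Icc, Finset.mem_Icc]
      exact ⟨⟨g1, by omega⟩, ⟨g3, by omega⟩⟩
    rw [hQcard, Finset.card_eq_sum_card_fiberwise hmaps]
    push_cast
    rw [Finset.sum_product]
    calc _ ≤ ∑ d ∈ Finset.Icc 1 (2 * H), ∑ e ∈ Finset.Icc 1 (2 * M),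
          B * (H * M) * ((1 / d : ℝ) * (1 / e)) := by
          refine Finset.sum_le_sum fun d hd => Finset.sum_le_sum fun e he => ?_
          exact hde d e (Finset.mem_Icc.1 hd).1 (Finset.mem_Icc.1 he).1
      _ = B * (H * M) * ((∑ d ∈ Finset.Icc 1 (2 * H), (1 / d : ℝ)) *
            ∑ e ∈ Finset.Icc 1 (2 * M), (1 / e : ℝ)) := by
          rw [Finset.sum_mul_sum, Finset.mul_sum]
          refine Finset.sum_congr rfl fun d _ => ?_
          rw [Finset.mul_sum]
      _ ≤ B * (H * M) * ((L * (H : ℝ) ^ ε) * (L * (M : ℝ) ^ ε)) := by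
          gcongr
          · exact hsum H hH
          · exact hsum M hM
      _ = _ := by
          rw [Real.rpow_add (by positivity), Real.rpow_one, Real.mul_rpow H0.le M0.le]; ring
  have h2 := closeCount_le_mul s f (η := 1 / (H * M : ℝ)) (t := η * (H * M)) (by positivity)
    (by positivity)
  rw [show η * (H * M : ℝ) * (1 / (H * M)) = η by field_simp] at h2
  calc _ ≤ _ := h2
    _ ≤ (3 * (η * (H * M)) + 3) * (B * L ^ 2 * (H * M : ℝ) ^ (1 + ε)) := by
        gcongr
        norm_num
    _ = _ := by ring

/-! ### Multipliers and removal of the perturbation -/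

/-- `B` bounds all bilinear forms with kernel `T` and coefficients of modulus at most one. -/
def BilinearBound {ι κ : Type*} (s : Finset ι) (t : Finset κ) (T : ι → κ → ℂ) (B : ℝ) : Prop :=
  ∀ (a : ι → ℂ) (b : κ → ℂ), (∀ u ∈ s, ‖a u‖ ≤ 1) → (∀ v ∈ t, ‖b v‖ ≤ 1) →
    ‖∑ u ∈ s, ∑ v ∈ t, a u * b v * T u v‖ ≤ B

/-- Multiplication of a kernel by `P` increases its bilinear bound by at most a factor `c`. -/
def IsMultiplier {ι κ : Type*} (s : Finset ι) (t : Finset κ) (P : ι → κ → ℂ) (c : ℝ) : Prop :=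
  ∀ (T : ι → κ → ℂ) (B : ℝ), BilinearBound s t T B →
    BilinearBound s t (fun u v => P u v * T u v) (c * B)

section Multiplier
variable {ι κ : Type*} {s : Finset ι} {t : Finset κ}

theorem BilinearBound.nonneg {T : ι → κ → ℂ} {B : ℝ} (h : BilinearBound s t T B) : 0 ≤ B :=
  (norm_nonneg _).trans (h 0 0 (by simp) (by simp))

theorem IsMultiplier.mono {P : ι → κ → ℂ} {c d : ℝ} (h : IsMultiplier s t P c) (hcd : c ≤ d) :
    IsMultiplier s t P d := fun T B hT a b ha hb =>
  (h T B hT a b ha hb).trans (mul_le_mul_of_nonneg_right hcd hT.nonneg)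

/-- A separated factor is absorbed into the arbitrary coefficients `a` and `b`. -/
theorem isMultiplier_const_mul_mul (c : ℂ) {f : ι → ℂ} {g : κ → ℂ} (hf : ∀ u ∈ s, ‖f u‖ ≤ 1)
    (hg : ∀ v ∈ t, ‖g v‖ ≤ 1) : IsMultiplier s t (fun u v => c * (f u * g v)) ‖c‖ := by
  intro T B hT a b ha hb
  have h := hT (fun u => a u * f u) (fun v => b v * g v)
    (fun u hu => by rw [norm_mul]; exact mul_le_one₀ (ha u hu) (norm_nonneg _) (hf u hu))
    (fun v hv => by rw [norm_mul]; exact mul_le_one₀ (hb v hv) (norm_nonneg _) (hg v hv))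
  have e : ∑ u ∈ s, ∑ v ∈ t, a u * b v * (c * (f u * g v) * T u v)
      = c * ∑ u ∈ s, ∑ v ∈ t, a u * f u * (b v * g v) * T u v := by
    rw [Finset.mul_sum]
    refine Finset.sum_congr rfl fun u _ => ?_
    rw [Finset.mul_sum]
    exact Finset.sum_congr rfl fun v _ => by ring
  rw [e, norm_mul]
  gcongr

theorem IsMultiplier.const_mul {P : ι → κ → ℂ} {c : ℝ} (h : IsMultiplier s t P c) (z : ℂ) :
    IsMultiplier s t (fun u v => z * P u v) (‖z‖ * c) := by
  intro T B hT a b ha hb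
  have e : ∑ u ∈ s, ∑ v ∈ t, a u * b v * (z * P u v * T u v)
      = z * ∑ u ∈ s, ∑ v ∈ t, a u * b v * (P u v * T u v) := by
    rw [Finset.mul_sum]
    refine Finset.sum_congr rfl fun u _ => ?_
    rw [Finset.mul_sum]
    exact Finset.sum_congr rfl fun v _ => by ring
  rw [e, norm_mul, mul_assoc]
  gcongr
  exact h T B hT a b ha hb

theorem IsMultiplier.pow {P : ι → κ → ℂ} {c : ℝ} (h : IsMultiplier s t P c) (k : ℕ) :
    IsMultiplier s t (fun u v => P u v ^ k) (c ^ k) := by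
  induction k with
  | zero => intro T B hT; simpa using hT
  | succ k ih =>
    intro T B hT
    have := h _ _ (ih T B hT)
    simp_rw [pow_succ', mul_assoc]
    exact this

theorem IsMultiplier.hasSum {P : ℕ → ι → κ → ℂ} {Q : ι → κ → ℂ} {c : ℕ → ℝ} {C : ℝ}
    (h : ∀ k, IsMultiplier s t (P k) (c k)) (hc : HasSum c C)
    (hP : ∀ u ∈ s, ∀ v ∈ t, HasSum (fun k => P k u v) (Q u v)) : IsMultiplier s t Q C := by
  intro T B hT a b ha hb
  have h1 : HasSum (fun k => ∑ u ∈ s, ∑ v ∈ t, a u * b v * (P k u v * T u v))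
      (∑ u ∈ s, ∑ v ∈ t, a u * b v * (Q u v * T u v)) :=
    hasSum_sum fun u hu => hasSum_sum fun v hv => ((hP u hu v hv).mul_right _).mul_left _
  exact h1.norm_le_of_bounded (hc.mul_right B) fun k => h k T B hT a b ha hb

/-- Multipliers compose and may be summed with their norms, so the exponential series applies
termwise. -/
theorem IsMultiplier.cexp {P : ι → κ → ℂ} {c : ℝ} (h : IsMultiplier s t P c) :
    IsMultiplier s t (fun u v => Complex.exp (P u v)) (Real.exp c) := by
  refine IsMultiplier.hasSum (P := fun k u v => ((k.factorial : ℂ)⁻¹) * P u v ^ k)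
    (c := fun k => ‖((k.factorial : ℂ)⁻¹)‖ * c ^ k) (fun k => (h.pow k).const_mul _) ?_ ?_
  · have := NormedSpace.exp_series_hasSum_exp' (𝕂 := ℝ) c
    rw [← Real.exp_eq_exp_ℝ] at this
    simpa [smul_eq_mul] using this
  · intro u _ v _
    have := NormedSpace.exp_series_hasSum_exp' (𝕂 := ℂ) (P u v)
    rw [← Complex.exp_eq_exp_ℂ] at this
    simpa [smul_eq_mul] using this

end Multiplier

theorem abs_pow_sub_pow_le_of_le_one {x y : ℝ} (hx0 : 0 ≤ x) (hx1 : x ≤ 1) (hy0 : 0 ≤ y) (hy1 : y ≤ 1)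
    (k : ℕ) : |x ^ k - y ^ k| ≤ k * |x - y| := by
  induction k with
  | zero => simp
  | succ k ih =>
    have e : x ^ (k + 1) - y ^ (k + 1) = x * (x ^ k - y ^ k) + (x - y) * y ^ k := by ring
    rw [e]
    refine (abs_add_le _ _).trans ?_
    rw [abs_mul, abs_mul, abs_of_nonneg hx0, abs_of_nonneg (pow_nonneg hy0 k)]
    have h1 : x * |x ^ k - y ^ k| ≤ 1 * (k * |x - y|) := by gcongr
    have h2 : |x - y| * y ^ k ≤ |x - y| * 1 := by gcongr; exact pow_le_one₀ hy0 hy1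
    push_cast
    linarith

/-- Nonlinear part of the perturbed phase `c w y / (1 + σ w y)`, expanded in powers of `σ`. -/
theorem hasSum_perturbed_phase {c σ w y y' : ℝ} (hσ0 : 0 ≤ σ) (hσ1 : σ < 1) (hw0 : 0 ≤ w)
    (hw1 : w ≤ 1) (hy0 : 0 ≤ y) (hy1 : y ≤ 1) (hy0' : 0 ≤ y') (hy1' : y' ≤ 1) :
    HasSum (fun k : ℕ => c * (-σ) ^ (k + 1) * (w ^ (k + 2) * (y ^ (k + 2) - y' ^ (k + 2))))
      ((c * w * y / (1 + σ * w * y) - c * w * y) -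
        (c * w * y' / (1 + σ * w * y') - c * w * y')) := by
  have key : ∀ y : ℝ, 0 ≤ y → y ≤ 1 → HasSum (fun k : ℕ => c * w * y * (-(σ * w * y)) *
      (-(σ * w * y)) ^ k) (c * w * y / (1 + σ * w * y) - c * w * y) := by
    intro y hy0 hy1
    have h0 : 0 ≤ σ * w * y := by positivity
    have h1 : σ * w * y < 1 := by
      calc σ * w * y ≤ σ * 1 * 1 := by gcongr
        _ < 1 := by linarith
    have := (hasSum_geometric_of_norm_lt_one (ξ := -(σ * w * y)) (by
      rw [norm_neg, Real.norm_of_nonneg h0]; exact h1)).mul_left (c * w * y * (-(σ * w * y)))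
    have h2 : 1 + σ * w * y ≠ 0 := by positivity
    have e : c * w * y / (1 + σ * w * y) - c * w * y
        = c * w * y * (-(σ * w * y)) * (1 - -(σ * w * y))⁻¹ := by
      rw [sub_neg_eq_add]
      field_simp
      ring
    rwa [e]
  refine ((key y hy0 hy1).sub (key y' hy0' hy1')).congr_fun fun k => ?_
  rw [neg_pow (σ * w * y), neg_pow (σ * w * y'), neg_pow σ]
  ring

/-- Every term of the expansion in `σ` separates the variables. The factor in `n` is a difference of
powers, of size `(k+2)/K` because `|y - y'| ≤ 1/K`, while the coefficient carries `X σ ≤ K/8`. The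
two factors of `K` cancel, and `σ ≤ 1/8` makes the series converge uniformly. -/
theorem exists_isMultiplier_perturbed_phase {Z : ℝ} (hZ : 0 < Z) :
    ∃ C : ℝ, 0 < C ∧ ∀ {ι κ : Type} (s : Finset ι) (t : Finset κ) (z w : ι → ℝ) (y y' : κ → ℝ)
      (X K σ : ℝ), 0 < K → K ≤ X → 0 ≤ σ → 8 * σ * X ≤ K →
      (∀ u ∈ s, |z u| ≤ Z) → (∀ u ∈ s, 0 ≤ w u ∧ w u ≤ 1) → (∀ n ∈ t, 0 ≤ y n ∧ y n ≤ 1) →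
      (∀ n ∈ t, 0 ≤ y' n ∧ y' n ≤ 1) → (∀ n ∈ t, K * |y n - y' n| ≤ 1) →
      IsMultiplier s t (fun u n => addExp
        ((X * z u * w u * y n / (1 + σ * w u * y n) - X * z u * w u * y n) -
        (X * z u * w u * y' n / (1 + σ * w u * y' n) - X * z u * w u * y' n))) C := by
  set c : ℕ → ℝ := fun k => Z * ((k + 2) * (1 / 8) ^ k) with hc
  have hs : Summable c := by
    have h1 := summable_pow_mul_geometric_of_norm_lt_one 1 (r := (1 / 8 : ℝ)) (by norm_num)
    have h0 := summable_geometric_of_norm_lt_one (x := (1 / 8 : ℝ)) (by norm_num)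
    refine ((h1.add (h0.mul_left 2)).mul_left Z).congr fun k => ?_
    simp only [hc, pow_one]; ring
  refine ⟨Real.exp (2 * Real.pi * ∑' k, c k), Real.exp_pos _, ?_⟩
  intro ι κ s t z w y y' X K σ hK hKX hσ0 hσ hz hw hy hy' hyy'
  have hX : 0 < X := hK.trans_le hKX
  have hσ8 : σ ≤ 1 / 8 := by
    by_contra! h
    have : 8 * (1 / 8) * X < 8 * σ * X := by gcongr
    linarith
  have hm : IsMultiplier s t (fun u n => (((X * z u * w u * y n / (1 + σ * w u * y n)
      - X * z u * w u * y n) - (X * z u * w u * y' n / (1 + σ * w u * y' n)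
      - X * z u * w u * y' n) : ℝ) : ℂ)) (∑' k, c k) := by
    refine IsMultiplier.hasSum (c := c) (P := fun k u n =>
      ((X * (-σ) ^ (k + 1) * Z * (k + 2) / K : ℝ) : ℂ) *
        (((z u / Z * w u ^ (k + 2) : ℝ) : ℂ) *
          ((K * (y n ^ (k + 2) - y' n ^ (k + 2)) / (k + 2) : ℝ) : ℂ))) ?_ hs.hasSum ?_
    · intro k
      refine (isMultiplier_const_mul_mul _ ?_ ?_).mono ?_
      · intro u hu
        rw [Complex.norm_real, Real.norm_eq_abs, abs_mul, abs_div, abs_of_pos hZ,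
          abs_of_nonneg (pow_nonneg (hw u hu).1 _)]
        exact mul_le_one₀ ((div_le_one hZ).2 (hz u hu)) (pow_nonneg (hw u hu).1 _)
          (pow_le_one₀ (hw u hu).1 (hw u hu).2)
      · intro n hn
        have h1 := abs_pow_sub_pow_le_of_le_one (hy n hn).1 (hy n hn).2 (hy' n hn).1 (hy' n hn).2 (k + 2)
        have hk2 : (0 : ℝ) < k + 2 := by positivity
        rw [Complex.norm_real, Real.norm_eq_abs, abs_div, abs_mul, abs_of_pos hK,
          abs_of_pos hk2, div_le_one hk2]
        push_cast at h1
        calc _ ≤ K * ((k + 2) * |y n - y' n|) := by gcongr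
          _ = (k + 2) * (K * |y n - y' n|) := by ring
          _ ≤ (k + 2) * 1 := by gcongr; exact hyy' n hn
          _ = _ := mul_one _
      · rw [Complex.norm_real, Real.norm_eq_abs, abs_div, abs_of_pos hK, abs_mul, abs_mul,
          abs_mul, abs_pow, abs_neg, abs_of_nonneg hσ0, abs_of_pos hX, abs_of_pos hZ,
          abs_of_pos (show (0 : ℝ) < k + 2 by positivity), div_le_iff₀ hK]
        have : X * σ ≤ K := by nlinarith
        calc X * σ ^ (k + 1) * Z * (k + 2) = (X * σ) * (Z * ((k + 2) * σ ^ k)) := by ring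
          _ ≤ K * (Z * ((k + 2) * (1 / 8) ^ k)) := by gcongr
          _ = _ := by rw [hc]; ring
    · intro u hu n hn
      have h := hasSum_perturbed_phase (c := X * z u) hσ0 (by linarith) (hw u hu).1 (hw u hu).2
        (hy n hn).1 (hy n hn).2 (hy' n hn).1 (hy' n hn).2
      have h' := Complex.hasSum_ofReal.2 h
      convert h' using 1
      ext k
      rw [← Complex.ofReal_mul, ← Complex.ofReal_mul]
      congr 1
      field_simp
  have hm2 := (hm.const_mul (2 * (Real.pi : ℂ) * Complex.I)).cexp
  have hnorm : ‖2 * (Real.pi : ℂ) * Complex.I‖ = 2 * Real.pi := by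
    simp [abs_of_pos Real.pi_pos]
  rw [hnorm] at hm2
  exact hm2

/-! ### Bilinear bounds over cells -/

/-- Close pairs lying in one cell are disjoint for different cells, so splitting into cells costs
nothing here. -/
theorem sum_closeCount_fiber_le {κ : Type*} (t : Finset κ) (f : κ → ℝ) (η : ℝ)
    (j : κ → ℕ) (J : ℕ) :
    ∑ i ∈ Finset.range J, closeCount (t.filter (j · = i)) f η ≤ closeCount t f η := by
  classical
  have e : ∀ i, closeCount (t.filter (j · = i)) f η =
      (((t ×ˢ t).filter fun p => |f p.1 - f p.2| ≤ η).filter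
        fun p => (j p.1, j p.2) = (i, i)).card := by
    intro i
    unfold closeCount
    congr 1
    ext p
    simp only [Finset.mem_filter, Finset.mem_product, Prod.mk.injEq]
    tauto
  have e2 : closeCount t f η = ((t ×ˢ t).filter fun p => |f p.1 - f p.2| ≤ η).card := by
    unfold closeCount; congr!
  simp_rw [e]
  rw [e2, ← Finset.card_biUnion]
  · exact Finset.card_le_card (Finset.biUnion_subset.2 fun i _ => Finset.filter_subset _ _)
  · intro i _ i' _ hne
    refine Finset.disjoint_left.2 fun p hp hp' => hne ?_
    rw [Finset.mem_filter] at hp hp'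
    exact (Prod.mk.injEq _ _ _ _ ▸ hp.2.symm.trans hp'.2).1

/-- Splitting a bilinear form according to the cell of the second variable. -/
theorem sum_eq_sum_cells {ι κ : Type*} (s : Finset ι) (t : Finset κ) (j : κ → ℕ) {J : ℕ}
    (hj : ∀ n ∈ t, j n < J) (F : ι → κ → ℂ) :
    ∑ u ∈ s, ∑ n ∈ t, F u n
      = ∑ i ∈ Finset.range J, ∑ u ∈ s, ∑ n ∈ t.filter (j · = i), F u n := by
  conv_rhs => rw [Finset.sum_comm]
  refine Finset.sum_congr rfl fun u _ => ?_
  exact (Finset.sum_fiberwise_of_maps_to (fun n hn => Finset.mem_range.2 (hj n hn)) (F u)).symm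

/-- Bilinear bound through the double large sieve applied in each cell. -/
theorem exists_cell_bilinear_le :
    ∃ C : ℝ, 0 < C ∧ ∀ {ι κ : Type} (s : Finset ι) (t : Finset κ) (x : ι → ℝ)
      (v : κ → ℝ) (j : κ → ℕ) (J : ℕ) (A : ℕ → ι → ℂ) (X K Z : ℝ), 0 < K → K ≤ X → 1 ≤ Z →
      (∀ u ∈ s, |x u| ≤ Z) → (∀ n ∈ t, j n < J) → (∀ n ∈ t, |K * v n - j n| ≤ 1) →
      (∀ i, ∀ u ∈ s, ‖A i u‖ ≤ 1) →
      ∀ (a : ι → ℂ) (b : κ → ℂ), (∀ u ∈ s, ‖a u‖ ≤ 1) → (∀ n ∈ t, ‖b n‖ ≤ 1) →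
      ‖∑ u ∈ s, ∑ n ∈ t, a u * b n * (A (j n) u * addExp (X * x u * v n))‖ ^ 2
        ≤ C * J * (Z * X / K) * closeCount s x (K / X) * closeCount t v (1 / X) := by
  obtain ⟨C, hC, hdls⟩ := exists_double_large_sieve
  refine ⟨C, hC, ?_⟩
  intro ι κ s t x v j J A X K Z hK hKX hZ hx hj hv hA a b ha hb
  have hX : 0 < X := hK.trans_le hKX
  rw [sum_eq_sum_cells s t j hj]
  set R : ℝ := Z * X / K with hR
  have hR1 : 1 ≤ R := by
    rw [hR, one_le_div hK]; nlinarith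
  have hcell : ∀ i, ‖∑ u ∈ s, ∑ n ∈ t.filter (j · = i),
      a u * b n * (A (j n) u * addExp (X * x u * v n))‖ ^ 2
      ≤ C * R * closeCount s x (K / X) * closeCount (t.filter (j · = i)) v (1 / X) := by
    intro i
    -- Within cell `i`, `X x v = X x (i/K) + (X/K) x (K v - i)`. The first part joins the
    -- coefficient of `u`; the second has variables bounded by `R` and by `1`.
    have h := hdls s (t.filter (j · = i)) (fun u => X / K * x u) (fun n => K * v n - i)
      (fun u => a u * (A i u * addExp (X * x u * (i / K)))) b R hR1 (by
        intro u hu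
        rw [abs_mul, abs_of_pos (by positivity), hR]
        calc _ ≤ X / K * Z := by gcongr; exact hx u hu
          _ = _ := by ring) (by
        intro n hn
        rw [Finset.mem_filter] at hn
        rw [← hn.2]; exact hv n hn.1) (by
        intro u hu
        rw [norm_mul, norm_mul, norm_addExp, mul_one]
        exact mul_le_one₀ (ha u hu) (norm_nonneg _) (hA i u hu))
      (fun n hn => hb n (Finset.mem_filter.1 hn).1)
    have e1 : closeCount s (fun u => X / K * x u) 1 = closeCount s x (K / X) := by
      rw [← closeCount_mul s x (show 0 < X / K by positivity) (K / X)]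
      congr 1; field_simp
    have e2 : closeCount (t.filter (j · = i)) (fun n => K * v n - i) (1 / R)
        ≤ closeCount (t.filter (j · = i)) v (1 / X) := by
      have : closeCount (t.filter (j · = i)) (fun n => K * v n - i) (1 / R)
          = closeCount (t.filter (j · = i)) (fun n => K * v n) (1 / R) := by
        unfold closeCount; congr! 4; ring
      rw [this, ← closeCount_mul _ v hK]
      refine closeCount_mono _ _ ?_
      rw [hR, one_div_div, mul_one_div]
      gcongr
      nlinarith
    rw [e1] at h
    have e3 : ∑ u ∈ s, ∑ n ∈ t.filter (j · = i), a u * b n * (A (j n) u * addExp (X * x u * v n))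
        = ∑ u ∈ s, ∑ n ∈ t.filter (j · = i), a u * (A i u * addExp (X * x u * (i / K))) * b n *
          addExp (X / K * x u * (K * v n - i)) := by
      refine Finset.sum_congr rfl fun u _ => Finset.sum_congr rfl fun n hn => ?_
      rw [(Finset.mem_filter.1 hn).2]
      have : X * x u * v n = X * x u * (i / K) + X / K * x u * (K * v n - i) := by
        field_simp; ring
      rw [this, addExp_add]; ring
    rw [e3]
    refine h.trans ?_
    gcongr
  calc _ ≤ (∑ i ∈ Finset.range J, ‖∑ u ∈ s, ∑ n ∈ t.filter (j · = i),
        a u * b n * (A (j n) u * addExp (X * x u * v n))‖) ^ 2 := by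
        gcongr; exact norm_sum_le _ _
    _ ≤ J * ∑ i ∈ Finset.range J, ‖∑ u ∈ s, ∑ n ∈ t.filter (j · = i),
        a u * b n * (A (j n) u * addExp (X * x u * v n))‖ ^ 2 := by
        have := sq_sum_le_card_mul_sum_sq (s := Finset.range J) (f := fun i => ‖∑ u ∈ s,
          ∑ n ∈ t.filter (j · = i), a u * b n * (A (j n) u * addExp (X * x u * v n))‖)
        rwa [Finset.card_range] at this
    _ ≤ J * ∑ i ∈ Finset.range J, C * R * closeCount s x (K / X) *
          closeCount (t.filter (j · = i)) v (1 / X) := by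
        gcongr; exact hcell _
    _ = J * (C * R * closeCount s x (K / X) *
          ((∑ i ∈ Finset.range J, closeCount (t.filter (j · = i)) v (1 / X) : ℕ) : ℝ)) := by
        rw [← Finset.mul_sum]; push_cast; rfl
    _ ≤ J * (C * R * closeCount s x (K / X) * closeCount t v (1 / X)) := by
        gcongr
        exact sum_closeCount_fiber_le t v _ j J
    _ = _ := by ring

/-- Bilinear bound through Cauchy's inequality followed by the double large sieve. -/
theorem exists_cauchy_bilinear_le :
    ∃ C : ℝ, 0 < C ∧ ∀ {ι κ : Type} (s : Finset ι) (t : Finset κ) (x : ι → ℝ)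
      (v : κ → ℝ) (j : κ → ℕ) (J : ℕ) (A : ℕ → ι → ℂ) (X K Z : ℝ), 0 < K → K ≤ X → 1 ≤ Z →
      (∀ u ∈ s, |x u| ≤ Z) → (∀ n ∈ t, j n < J) →
      (∀ n ∈ t, ∀ n' ∈ t, j n = j n' → |K * (v n - v n')| ≤ 1) →
      (∀ i, ∀ u ∈ s, ‖A i u‖ ≤ 1) →
      ∀ (a : ι → ℂ) (b : κ → ℂ), (∀ u ∈ s, ‖a u‖ ≤ 1) → (∀ n ∈ t, ‖b n‖ ≤ 1) →
      ‖∑ u ∈ s, ∑ n ∈ t, a u * b n * (A (j n) u * addExp (X * x u * v n))‖ ^ 4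
        ≤ C * (J * s.card) ^ 2 * (Z * X / K) * closeCount s x (K / X) *
          closeCount (t ×ˢ t) (fun p => v p.1 - v p.2) (1 / X) := by
  obtain ⟨C, hC, hdls⟩ := exists_double_large_sieve
  refine ⟨C, hC, ?_⟩
  intro ι κ s t x v j J A X K Z hK hKX hZ hx hj hv hA a b ha hb
  have hX : 0 < X := hK.trans_le hKX
  set R : ℝ := Z * X / K with hR
  have hR1 : 1 ≤ R := by
    rw [hR, one_le_div hK]; nlinarith
  -- After Cauchy over `u` and the cell, the weights `A` are gone and only pairs in a common cell
  -- survive. Their differences satisfy `|K (v - v')| ≤ 1`, as the sieve requires.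
  set P : Finset (κ × κ) := (t ×ˢ t).filter fun p => j p.1 = j p.2 with hP
  set V : ι → ℕ → ℂ := fun u i => ∑ n ∈ t.filter (j · = i), b n * addExp (X * x u * v n) with hV
  set W : ℝ := ∑ u ∈ s, ∑ i ∈ Finset.range J, ‖V u i‖ ^ 2 with hW
  have hW0 : 0 ≤ W := Finset.sum_nonneg fun _ _ => Finset.sum_nonneg fun _ _ => by positivity
  have h1 : ‖∑ u ∈ s, ∑ n ∈ t, a u * b n * (A (j n) u * addExp (X * x u * v n))‖ ^ 2
      ≤ J * s.card * W := by
    have e : ∀ u ∈ s, ‖∑ n ∈ t, a u * b n * (A (j n) u * addExp (X * x u * v n))‖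
        ≤ ∑ i ∈ Finset.range J, ‖V u i‖ := by
      intro u hu
      rw [← Finset.sum_fiberwise_of_maps_to (fun n hn => Finset.mem_range.2 (hj n hn))]
      refine norm_sum_le_of_le _ fun i _ => ?_
      have : ∑ n ∈ t with j n = i, a u * b n * (A (j n) u * addExp (X * x u * v n))
          = (a u * A i u) * V u i := by
        rw [hV, Finset.mul_sum]
        refine Finset.sum_congr rfl fun n hn => ?_
        rw [(Finset.mem_filter.1 hn).2]; ring
      rw [this, norm_mul, norm_mul]
      exact mul_le_of_le_one_left (norm_nonneg _)
        (mul_le_one₀ (ha u hu) (norm_nonneg _) (hA i u hu))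
    calc _ ≤ (∑ u ∈ s, ∑ i ∈ Finset.range J, ‖V u i‖) ^ 2 := by
          gcongr; exact norm_sum_le_of_le _ e
      _ ≤ s.card * ∑ u ∈ s, (∑ i ∈ Finset.range J, ‖V u i‖) ^ 2 := sq_sum_le_card_mul_sum_sq
      _ ≤ s.card * ∑ u ∈ s, (J * ∑ i ∈ Finset.range J, ‖V u i‖ ^ 2) := by
          gcongr with u hu
          have := sq_sum_le_card_mul_sum_sq (s := Finset.range J) (f := fun i => ‖V u i‖)
          rwa [Finset.card_range] at this
      _ = _ := by rw [← Finset.mul_sum, hW]; ring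
  have h2 : (W : ℂ) = ∑ u ∈ s, ∑ p ∈ P, 1 * (b p.1 * (starRingEnd ℂ) (b p.2)) *
      addExp (X / K * x u * (K * (v p.1 - v p.2))) := by
    rw [hW]
    push_cast
    refine Finset.sum_congr rfl fun u _ => ?_
    have hmaps : ∀ p ∈ P, j p.1 ∈ Finset.range J := by
      intro p hp
      rw [hP, Finset.mem_filter, Finset.mem_product] at hp
      exact Finset.mem_range.2 (hj _ hp.1.1)
    rw [← Finset.sum_fiberwise_of_maps_to hmaps]
    refine Finset.sum_congr rfl fun i _ => ?_
    have := norm_sq_sum_mul_addExp (t.filter (j · = i)) b (fun n => X * x u * v n)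
    rw [← Complex.ofReal_pow, hV]
    simp only
    rw [this, ← Finset.sum_product']
    refine Finset.sum_congr ?_ fun p _ => ?_
    · ext p
      simp only [hP, Finset.mem_filter, Finset.mem_product]
      constructor
      · rintro ⟨⟨q1, q2⟩, q3, q4⟩
        exact ⟨⟨⟨q1, q3⟩, q2.trans q4.symm⟩, q2⟩
      · rintro ⟨⟨⟨q1, q3⟩, q2⟩, q4⟩
        exact ⟨⟨q1, q4⟩, q3, q2.symm.trans q4⟩
    · rw [one_mul]
      congr 2
      field_simp
  have h3 : W ^ 2 ≤ C * R * closeCount s x (K / X) *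
      closeCount (t ×ˢ t) (fun p => v p.1 - v p.2) (1 / X) := by
    have h := hdls s P (fun u => X / K * x u) (fun p => K * (v p.1 - v p.2)) (fun _ => 1)
      (fun p => b p.1 * (starRingEnd ℂ) (b p.2)) R hR1 (by
        intro u hu
        rw [abs_mul, abs_of_pos (by positivity), hR]
        calc _ ≤ X / K * Z := by gcongr; exact hx u hu
          _ = _ := by ring) (by
        intro p hp
        rw [hP, Finset.mem_filter, Finset.mem_product] at hp
        exact hv _ hp.1.1 _ hp.1.2 hp.2) (by simp) (by
        intro p hp
        rw [hP, Finset.mem_filter, Finset.mem_product] at hp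
        rw [norm_mul, RCLike.norm_conj]
        exact mul_le_one₀ (hb _ hp.1.1) (norm_nonneg _) (hb _ hp.1.2))
    rw [← h2, Complex.norm_real, Real.norm_of_nonneg hW0] at h
    have e1 : closeCount s (fun u => X / K * x u) 1 = closeCount s x (K / X) := by
      rw [← closeCount_mul s x (show 0 < X / K by positivity) (K / X)]
      congr 1; field_simp
    -- The restriction to a common cell is now dropped, so the count over all quadruples can be
    -- used.
    have e2 : closeCount P (fun p => K * (v p.1 - v p.2)) (1 / R)
        ≤ closeCount (t ×ˢ t) (fun p => v p.1 - v p.2) (1 / X) := by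
      refine (closeCount_mono_set _ (Finset.filter_subset _ _) _).trans ?_
      rw [← closeCount_mul _ (fun p : κ × κ => v p.1 - v p.2) hK (1 / X)]
      refine closeCount_mono _ _ ?_
      rw [hR, one_div_div, mul_one_div]
      gcongr
      nlinarith
    rw [e1] at h
    refine h.trans ?_
    gcongr
  calc _ = (‖∑ u ∈ s, ∑ n ∈ t, a u * b n * (A (j n) u * addExp (X * x u * v n))‖ ^ 2) ^ 2 := by
        ring
    _ ≤ (J * s.card * W) ^ 2 := by gcongr
    _ = (J * s.card) ^ 2 * W ^ 2 := by ring
    _ ≤ _ := mul_le_mul_of_nonneg_left h3 (by positivity)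
    _ = _ := by ring

/-! ### Spacing of powers and assembly of the two regimes -/

/-- The values `(N/n)^γ` are spaced by about `1/N`. -/
theorem exists_power_count_le {γ : ℝ} (hγ : 0 < γ) :
    ∃ C : ℝ, 0 < C ∧ ∀ (N : ℕ) (η : ℝ), 0 < N → 0 ≤ η →
      (closeCount (Finset.Ioc N (2 * N)) (fun n : ℕ => (N / n : ℝ) ^ γ) η : ℝ)
        ≤ C * (η * N + 1) * N := by
  classical
  set c : ℝ := 4 * 2 ^ γ / γ with hc
  have hc0 : 0 < c := by positivity
  refine ⟨c + 1, by positivity, ?_⟩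
  intro N η hN hη
  have N0 : (0 : ℝ) < N := by exact_mod_cast hN
  set t := Finset.Ioc N (2 * N) with ht
  set f : ℕ → ℝ := fun n => (N / n : ℝ) ^ γ with hf
  have bd : ∀ n ∈ t, (0 : ℝ) < n ∧ (n : ℝ) ≤ 2 * N := by
    intro n hn
    rw [ht, Finset.mem_Ioc] at hn
    exact ⟨by exact_mod_cast (by omega : 0 < n), by exact_mod_cast hn.2⟩
  -- Comparison through logarithms transfers closeness of powers to closeness of the integers,
  -- losing only constants since all quantities are of fixed order.
  have hsp : ∀ n ∈ t, ∀ n' ∈ t, |f n - f n'| ≤ η → |(n : ℝ) - n'| ≤ c / 2 * (η * N) := by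
    intro n hn n' hn' h
    obtain ⟨n0, n1⟩ := bd n hn
    obtain ⟨n0', n1'⟩ := bd n' hn'
    have lower : ∀ n : ℝ, 0 < n → n ≤ 2 * N → (1 / 2 : ℝ) ^ γ ≤ (N / n) ^ γ := by
      intro n n0 n1
      refine Real.rpow_le_rpow (by norm_num) ?_ hγ.le
      rw [div_le_div_iff₀ two_pos n0]; linarith
    have h1 := abs_log_sub_log_le (by positivity) (lower n n0 n1) (lower n' n0' n1')
    rw [Real.log_rpow (by positivity), Real.log_rpow (by positivity),
      Real.log_div N0.ne' n0.ne', Real.log_div N0.ne' n0'.ne'] at h1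
    have h2 := abs_sub_le_mul_abs_log_sub_log n0 n0' n1 n1'
    have h3 : γ * |Real.log n - Real.log n'| ≤ η * 2 ^ γ := by
      calc _ = |γ * (Real.log N - Real.log n) - γ * (Real.log N - Real.log n')| := by
            rw [← mul_sub, abs_mul, abs_of_pos hγ, sub_sub_sub_cancel_left, abs_sub_comm]
        _ ≤ _ := h1
        _ ≤ η / (1 / 2) ^ γ := by gcongr
        _ = _ := by rw [one_div, Real.inv_rpow two_pos.le]; field_simp
    have h4 : |Real.log n - Real.log n'| ≤ η * 2 ^ γ / γ := by
      rw [le_div_iff₀ hγ]; linarith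
    calc _ ≤ _ := h2
      _ ≤ 2 * N * (η * 2 ^ γ / γ) := by gcongr
      _ = _ := by rw [hc]; ring
  rw [closeCount_eq_sum]
  have hcard : (t.card : ℝ) = N := by
    rw [ht, Nat.card_Ioc, two_mul, Nat.add_sub_cancel]
  calc _ ≤ ∑ n ∈ t, (c * (η * N) + 1) := by
        refine Finset.sum_le_sum fun n hn => ?_
        rw [← Finset.sum_filter, Finset.sum_const, nsmul_eq_mul, mul_one]
        have := card_le_of_separated (t.filter fun q => |f n - f q| ≤ η) (fun q : ℕ => (q : ℝ))
          (σ := 1) (ℓ := c * (η * N)) one_pos (by positivity) ?_ ?_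
        · simpa using this
        · intro p _ q _ hpq
          have : (1 : ℤ) ≤ |(p : ℤ) - q| := Int.one_le_abs (by omega)
          exact_mod_cast this
        · intro p hp q hq
          rw [Finset.mem_filter] at hp hq
          have a1 := hsp n hn p hp.1 hp.2
          have a2 := hsp n hn q hq.1 hq.2
          calc |(p : ℝ) - q| = |((n : ℝ) - q) - (n - p)| := by congr 1; ring
            _ ≤ _ := (abs_sub _ _).trans (by linarith)
    _ = (c * (η * N) + 1) * N := by
        rw [Finset.sum_const, nsmul_eq_mul, hcard]; ring
    _ ≤ _ := by
        gcongr
        have : 0 ≤ η * N := by positivity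
        nlinarith

theorem abs_mul_sub_floor_le {K y : ℝ} (hK : 0 ≤ K) (hy : 0 ≤ y) :
    |K * y - (⌊K * y⌋₊ : ℝ)| ≤ 1 := by
  have h1 := Nat.floor_le (mul_nonneg hK hy)
  have h2 := Nat.lt_floor_add_one (K * y)
  rw [abs_le]; constructor <;> linarith

theorem abs_mul_sub_le_of_floor_eq {K y y' : ℝ} (hK : 0 ≤ K) (hy : 0 ≤ y) (hy' : 0 ≤ y')
    (h : ⌊K * y⌋₊ = ⌊K * y'⌋₊) : |K * (y - y')| ≤ 1 := by
  have h1 := Nat.floor_le (mul_nonneg hK hy)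
  have h2 := Nat.lt_floor_add_one (K * y)
  have h3 := Nat.floor_le (mul_nonneg hK hy')
  have h4 := Nat.lt_floor_add_one (K * y')
  rw [h] at h1 h2
  rw [abs_le]; constructor <;> linarith

theorem le_mul_add_of_sq_le {S c p q : ℝ} (hc : 0 ≤ c) (hp : 0 ≤ p) (hq : 0 ≤ q)
    (h : S ^ 2 ≤ c ^ 2 * (p ^ 2 + q ^ 2)) : S ≤ c * (p + q) := by
  refine le_of_sq_le_sq (h.trans ?_) (by positivity)
  rw [mul_pow]
  gcongr
  nlinarith [mul_nonneg hp hq]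

theorem le_mul_add_of_pow_four_le {S c p q r : ℝ} (hc : 0 ≤ c) (hp : 0 ≤ p) (hq : 0 ≤ q)
    (hr : 0 ≤ r) (h : S ^ 4 ≤ c ^ 4 * (p ^ 4 + q ^ 4 + r ^ 4)) : S ≤ c * (p + q + r) := by
  have e1 : ∀ p q : ℝ, 0 ≤ p → 0 ≤ q → p ^ 4 + q ^ 4 ≤ (p + q) ^ 4 := by
    intro p q hp hq
    have h1 : 0 ≤ 4 * p ^ 3 * q + 6 * p ^ 2 * q ^ 2 + 4 * p * q ^ 3 := by positivity
    linear_combination h1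
  refine le_of_pow_le_pow_left₀ (n := 4) (by norm_num) (by positivity) (h.trans ?_)
  rw [mul_pow]
  gcongr
  linarith [e1 p q hp hq, e1 (p + q) r (by positivity) hr]

/-- For `X ≤ U` the count of `x` is dominated by `K U / X`, as `X ≤ K U`. The two terms come from
the two parts of the count of powers. -/
theorem cell_product_le {c0 c2 c3 Z U N X K E J P Q u : ℝ} (h0 : 0 ≤ c0) (h2 : 0 ≤ c2)
    (h3 : 0 ≤ c3) (hZ : 0 ≤ Z) (hU : 0 < U) (hN : 0 < N) (hX : 0 < X) (hK : 1 ≤ K) (hE : 1 ≤ E)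
    (hXU : X ≤ U) (hJ : J ≤ 2 * K) (hP0 : 0 ≤ P) (hQ0 : 0 ≤ Q) (hu0 : 0 ≤ u) (hu : u ≤ E)
    (hP : P ≤ c2 * (K / X * U + 1) * (U * u)) (hQ : Q ≤ c3 * (1 / X * N + 1) * N) :
    c0 * J * (Z * X / K) * P * Q
      ≤ c0 * 4 * Z * c2 * c3 * (U * N * E) ^ 2 * (K / N + K ^ 2 / X) := by
  have hK0 : 0 < K := by linarith
  have e1 : X ≤ K * U := by nlinarith
  have e2 : K ≤ K ^ 2 := by nlinarith
  have e3 : E ≤ E ^ 2 := by nlinarith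
  calc c0 * J * (Z * X / K) * P * Q
      ≤ c0 * (2 * K) * (Z * X / K) * (c2 * (K / X * U + 1) * (U * u)) *
          (c3 * (1 / X * N + 1) * N) := by gcongr
    _ = c0 * 2 * Z * c2 * c3 * ((K * U + X) * (1 / X * N + 1) * N * U) * u := by field_simp
    _ ≤ c0 * 2 * Z * c2 * c3 * ((K * U + K * U) * (1 / X * N + 1) * N * U) * E := by gcongr
    _ = c0 * 4 * Z * c2 * c3 * ((U * N) ^ 2 * (K / N + K / X)) * E := by field_simp; ring
    _ ≤ c0 * 4 * Z * c2 * c3 * ((U * N) ^ 2 * (K / N + K ^ 2 / X)) * E ^ 2 := by gcongr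
    _ = _ := by ring

/-- For `U ≤ X` multiplying the two counts gives four terms; `K^2/X` and `K/U` are both at most
`K^2/U`, leaving three. -/
theorem cauchy_product_le {c1 c2 c4 Z U N X K E J P Q u n : ℝ} (h1 : 0 ≤ c1) (h2 : 0 ≤ c2)
    (h4 : 0 ≤ c4) (hZ : 0 ≤ Z) (hU : 0 < U) (hN : 0 < N) (hX : 0 < X) (hK : 1 ≤ K) (hE : 1 ≤ E)
    (hUX : U ≤ X) (hJ0 : 0 ≤ J) (hJ : J ≤ 2 * K) (hP0 : 0 ≤ P) (hQ0 : 0 ≤ Q) (hu0 : 0 ≤ u) (hun : u * n = E)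
    (hP : P ≤ c2 * (K / X * U + 1) * (U * u)) (hQ : Q ≤ c4 * (1 / X * N ^ 2 + 1) * (N ^ 2 * n)) :
    c1 * (J * U) ^ 2 * (Z * X / K) * P * Q
      ≤ c1 * 8 * Z * c2 * c4 * (U * N * E) ^ 4 *
        (K * X / (U * N ^ 2) + K ^ 2 / U + (K / N) ^ 2) := by
  have hK0 : 0 < K := by linarith
  have e2 : K / U ≤ K ^ 2 / U := by gcongr; nlinarith
  have e1 : K ^ 2 / X ≤ K ^ 2 / U := by gcongr
  have e3 : E ≤ E ^ 4 := le_self_pow₀ hE (by norm_num)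
  have e4 : 0 ≤ K * X / (U * N ^ 2) := by positivity
  have e5 : 0 ≤ (K / N) ^ 2 := by positivity
  calc c1 * (J * U) ^ 2 * (Z * X / K) * P * Q
      ≤ c1 * (2 * K * U) ^ 2 * (Z * X / K) * (c2 * (K / X * U + 1) * (U * u)) *
          (c4 * (1 / X * N ^ 2 + 1) * (N ^ 2 * n)) := by gcongr
    _ = c1 * 4 * Z * c2 * c4 * ((U * N) ^ 4 * (K ^ 2 / X + (K / N) ^ 2 + K / U +
          K * X / (U * N ^ 2))) * (u * n) := by field_simp; ring
    _ ≤ c1 * 4 * Z * c2 * c4 * ((U * N) ^ 4 *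
          (2 * (K * X / (U * N ^ 2) + K ^ 2 / U + (K / N) ^ 2))) * E ^ 4 := by
        rw [hun]
        gcongr
        linarith
    _ = _ := by ring

/-- Bound for the unperturbed trilinear sum with weights depending on the cell of `n`. -/
theorem exists_cell_sum_le {α β γ ε : ℝ} (hα : 0 < α) (hβ : 0 < β) (hγ : 0 < γ) (hε : 0 < ε) :
    ∃ C : ℝ, 0 < C ∧ ∀ (H M N : ℕ) (A : ℕ → ℕ × ℕ → ℂ) (X K : ℝ), 0 < H → 0 < M → 0 < N →
      1 ≤ K → K ≤ X → (∀ i u, ‖A i u‖ ≤ 1) →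
      BilinearBound (Finset.Ioc H (2 * H) ×ˢ Finset.Ioc M (2 * M)) (Finset.Ioc N (2 * N))
        (fun u n => A ⌊K * (N / n : ℝ) ^ γ⌋₊ u *
          addExp (X * ((u.1 / H : ℝ) ^ α * (M / u.2 : ℝ) ^ β) * (N / n : ℝ) ^ γ))
        (C * ((H : ℝ) * M * N) ^ (1 + ε) *
            ((K * X / ((H : ℝ) * M * (N : ℝ) ^ (2 : ℕ))) ^ (1 / 4 : ℝ)
              + (K ^ (2 : ℕ) / ((H : ℝ) * M)) ^ (1 / 4 : ℝ)
              + (K / (N : ℝ)) ^ (1 / 2 : ℝ)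
              + K / X ^ (1 / 2 : ℝ))) := by
  obtain ⟨C0, hC0, hcell⟩ := exists_cell_bilinear_le
  obtain ⟨C1, hC1, hcauchy⟩ := exists_cauchy_bilinear_le
  obtain ⟨C2, hC2, hmono⟩ := exists_monomial_count_le hα hβ hε
  obtain ⟨C3, hC3, hpow⟩ := exists_power_count_le hγ
  obtain ⟨C4, hC4, hquad⟩ := exists_quadruple_count_le hγ hε
  set Z : ℝ := 2 ^ α with hZ
  have hZ1 : 1 ≤ Z := Real.one_le_rpow one_le_two hα.le
  -- The summand `1` ensures `C ≥ 1`, so that `C^2` and `C^4` dominate the constants arising before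
  -- roots are taken.
  set C : ℝ := 1 + C0 * 4 * Z * C2 * C3 + C1 * 8 * Z * C2 * C4 with hC
  have hp1 : 0 < C0 * 4 * Z * C2 * C3 := by positivity
  have hp2 : 0 < C1 * 8 * Z * C2 * C4 := by positivity
  have hCone : 1 ≤ C := by rw [hC]; linarith
  have hCpos : 0 < C := by linarith
  have hCsq : C0 * 4 * Z * C2 * C3 ≤ C ^ 2 :=
    le_trans (by rw [hC]; linarith) (le_self_pow₀ hCone (by norm_num))
  have hCfour : C1 * 8 * Z * C2 * C4 ≤ C ^ 4 :=
    le_trans (by rw [hC]; linarith) (le_self_pow₀ hCone (by norm_num))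
  have hZ0 : 0 ≤ Z := by linarith
  refine ⟨C, hCpos, ?_⟩
  intro H M N A X K hH hM hN hK hKX hA a b ha hb
  have H1 : (1 : ℝ) ≤ H := by exact_mod_cast hH
  have M1 : (1 : ℝ) ≤ M := by exact_mod_cast hM
  have N1 : (1 : ℝ) ≤ N := by exact_mod_cast hN
  have K0 : 0 < K := by linarith
  have X0 : 0 < X := by linarith
  set U : ℝ := (H : ℝ) * M with hU
  have U1 : 1 ≤ U := one_le_mul_of_one_le_of_one_le H1 M1
  have U0 : 0 < U := by linarith
  have N0 : (0 : ℝ) < N := by linarith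
  set s := Finset.Ioc H (2 * H) ×ˢ Finset.Ioc M (2 * M) with hs
  set t := Finset.Ioc N (2 * N) with ht
  set x : ℕ × ℕ → ℝ := fun u => (u.1 / H : ℝ) ^ α * (M / u.2 : ℝ) ^ β with hx
  set v : ℕ → ℝ := fun n => (N / n : ℝ) ^ γ with hv
  set j : ℕ → ℕ := fun n => ⌊K * v n⌋₊ with hj
  set J : ℕ := ⌊K⌋₊ + 1 with hJ
  have hv0 : ∀ n, 0 ≤ v n := fun n => by rw [hv]; positivity
  have hv1 : ∀ n ∈ t, v n ≤ 1 := by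
    intro n hn
    rw [ht, Finset.mem_Ioc] at hn
    have : (N : ℝ) ≤ n := by exact_mod_cast hn.1.le
    exact Real.rpow_le_one (by positivity) ((div_le_one (N0.trans_le this)).2 this) hγ.le
  have hjJ : ∀ n ∈ t, j n < J := by
    intro n hn
    rw [hJ, Nat.lt_add_one_iff]
    exact Nat.floor_le_floor (mul_le_of_le_one_right K0.le (hv1 n hn))
  have hJK : (J : ℝ) ≤ 2 * K := by
    rw [hJ]; push_cast; linarith [Nat.floor_le K0.le]
  have hxZ : ∀ u ∈ s, |x u| ≤ Z := by
    intro u hu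
    rw [hs, Finset.mem_product, Finset.mem_Ioc, Finset.mem_Ioc] at hu
    have h1 : (u.1 : ℝ) ≤ 2 * H := by exact_mod_cast hu.1.2
    have h2 : (M : ℝ) ≤ u.2 := by exact_mod_cast hu.2.1.le
    have e0 : 0 ≤ x u := by simp only [hx]; positivity
    rw [abs_of_nonneg e0]
    have e1 : (u.1 / H : ℝ) ^ α ≤ Z :=
      Real.rpow_le_rpow (by positivity) ((div_le_iff₀ (by linarith)).2 h1) hα.le
    have e2 : (M / u.2 : ℝ) ^ β ≤ 1 :=
      Real.rpow_le_one (by positivity) ((div_le_one (by linarith)).2 h2) hβ.le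
    calc x u ≤ Z * 1 := by simp only [hx]; gcongr
      _ = Z := mul_one _
  have hcards : (s.card : ℝ) = U := by
    rw [hs, Finset.card_product, Nat.card_Ioc, Nat.card_Ioc, two_mul, two_mul,
      Nat.add_sub_cancel, Nat.add_sub_cancel, hU]
    push_cast; rfl
  set Y : ℝ := U * N with hY
  have Y1 : 1 ≤ Y := one_le_mul_of_one_le_of_one_le U1 N1
  have Y0 : 0 < Y := by linarith
  set E : ℝ := Y ^ ε with hE
  have E1 : 1 ≤ E := Real.one_le_rpow Y1 hε.le
  have hYE : Y ^ (1 + ε) = Y * E := by rw [Real.rpow_add Y0, Real.rpow_one]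
  have hUE : U ^ ε ≤ E := Real.rpow_le_rpow U0.le (le_mul_of_one_le_right U0.le N1) hε.le
  have hU1ε : U ^ (1 + ε) = U * U ^ ε := by rw [Real.rpow_add U0, Real.rpow_one]
  have hN2ε : (N : ℝ) ^ (2 + ε) = N ^ 2 * (N : ℝ) ^ ε := by
    rw [Real.rpow_add N0, Real.rpow_two]
  set S : ℝ := ‖∑ u ∈ s, ∑ n ∈ t, a u * b n * (A (j n) u * addExp (X * x u * v n))‖ with hS
  set r1 : ℝ := (K * X / (U * (N : ℝ) ^ (2 : ℕ))) ^ (1 / 4 : ℝ) with hr1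
  set r2 : ℝ := (K ^ (2 : ℕ) / U) ^ (1 / 4 : ℝ) with hr2
  set r3 : ℝ := (K / (N : ℝ)) ^ (1 / 2 : ℝ) with hr3
  set r4 : ℝ := K / X ^ (1 / 2 : ℝ) with hr4
  have hr1' : r1 ^ 4 = K * X / (U * (N : ℝ) ^ 2) := by
    rw [hr1, ← Real.rpow_natCast, ← Real.rpow_mul (by positivity)]; norm_num
  have hr2' : r2 ^ 4 = K ^ 2 / U := by
    rw [hr2, ← Real.rpow_natCast, ← Real.rpow_mul (by positivity)]; norm_num
  have hr3' : r3 ^ 2 = K / N := by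
    rw [hr3, ← Real.rpow_natCast, ← Real.rpow_mul (by positivity)]; norm_num
  have hr4' : r4 ^ 2 = K ^ 2 / X := by
    rw [hr4, div_pow, ← Real.rpow_natCast (X ^ (1 / 2 : ℝ)), ← Real.rpow_mul X0.le]; norm_num
  have r10 : 0 ≤ r1 := by positivity
  have r20 : 0 ≤ r2 := by positivity
  have r30 : 0 ≤ r3 := by positivity
  have r40 : 0 ≤ r4 := by positivity
  change S ≤ C * Y ^ (1 + ε) * (r1 + r2 + r3 + r4)
  rw [hYE]
  have hu0 : 0 ≤ U ^ ε := by positivity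
  have hxc : (closeCount s x (K / X) : ℝ) ≤ C2 * (K / X * U + 1) * (U * U ^ ε) := by
    rw [← hU1ε]
    exact hmono H M (K / X) hH hM (by positivity)
  -- The direct sieve in each cell yields `r3 + r4` when `X ≤ HM`; Cauchy followed by the sieve
  -- yields `r1 + r2 + r3` when `X ≥ HM`.
  rcases le_total X U with hXU | hUX
  · have h : S ^ 2 ≤ C0 * J * (Z * X / K) * closeCount s x (K / X) * closeCount t v (1 / X) :=
      hcell s t x v j J A X K Z K0 hKX hZ1 hxZ hjJ
      (fun n _ => abs_mul_sub_floor_le K0.le (hv0 n)) (fun i u _ => hA i u) a b ha hb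
    have hvc : (closeCount t v (1 / X) : ℝ) ≤ C3 * (1 / X * N + 1) * N :=
      hpow N (1 / X) hN (by positivity)
    clear_value S x v t s
    have hsq : S ^ 2 ≤ (C * (Y * E)) ^ 2 * (r3 ^ 2 + r4 ^ 2) := by
      rw [hr3', hr4', mul_pow C]
      refine (h.trans (cell_product_le hC0.le hC2.le hC3.le hZ0 U0 N0 X0 hK E1 hXU
        hJK (Nat.cast_nonneg _) (Nat.cast_nonneg _) hu0 hUE hxc hvc)).trans ?_
      gcongr
    refine (le_mul_add_of_sq_le (by positivity) r30 r40 hsq).trans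
      (mul_le_mul_of_nonneg_left ?_ (by positivity))
    linarith only [r10, r20]
  · have h : S ^ 4 ≤ C1 * (J * s.card) ^ 2 * (Z * X / K) * closeCount s x (K / X) *
        closeCount (t ×ˢ t) (fun p => v p.1 - v p.2) (1 / X) :=
      hcauchy s t x v j J A X K Z K0 hKX hZ1 hxZ hjJ
      (fun n _ n' _ he => abs_mul_sub_le_of_floor_eq K0.le (hv0 n) (hv0 n') he)
      (fun i u _ => hA i u) a b ha hb
    have hqc : (closeCount (t ×ˢ t) (fun p => v p.1 - v p.2) (1 / X) : ℝ)
        ≤ C4 * (1 / X * N ^ 2 + 1) * (N ^ 2 * (N : ℝ) ^ ε) := by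
      rw [← hN2ε]
      exact hquad N (1 / X) hN (by positivity)
    rw [hcards] at h
    have hEE : U ^ ε * (N : ℝ) ^ ε = E := by rw [hE, hY, Real.mul_rpow U0.le N0.le]
    clear_value S x v t s
    have hsq : S ^ 4 ≤ (C * (Y * E)) ^ 4 * (r1 ^ 4 + r2 ^ 4 + r3 ^ 4) := by
      have e2 : r3 ^ 4 = (K / N) ^ 2 := by rw [← hr3']; ring
      rw [hr1', hr2', e2, mul_pow C]
      refine (h.trans (cauchy_product_le hC1.le hC2.le hC4.le hZ0 U0 N0 X0 hK E1 hUX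
        (Nat.cast_nonneg J) hJK (Nat.cast_nonneg _) (Nat.cast_nonneg _) hu0 hEE hxc hqc)).trans ?_
      gcongr
    refine (le_mul_add_of_pow_four_le (by positivity) r10 r20 r30 hsq).trans
      (mul_le_mul_of_nonneg_left ?_ (by positivity))
    linarith only [r40]

/-! ### The perturbed sum -/

/-- The perturbed phase in terms of the normalised variables. -/
theorem perturbed_phase_eq {α β γ X δ : ℝ} {H M N h m n : ℕ} (hH : 0 < H) (hM : 0 < M)
    (hN : 0 < N) (hm : 0 < m) (hn : 0 < n) (hδ : 0 < δ) :
    X * ((M : ℝ) ^ β * (N : ℝ) ^ γ / (H : ℝ) ^ α) * ((h : ℝ) ^ α / ((m : ℝ) ^ β * (n : ℝ) ^ γ + δ))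
      = X * (h / H : ℝ) ^ α * (M / m : ℝ) ^ β * (N / n : ℝ) ^ γ /
        (1 + δ / ((M : ℝ) ^ β * (N : ℝ) ^ γ) * (M / m : ℝ) ^ β * (N / n : ℝ) ^ γ) := by
  have h1 : (0 : ℝ) < H := by exact_mod_cast hH
  have h2 : (0 : ℝ) < M := by exact_mod_cast hM
  have h3 : (0 : ℝ) < N := by exact_mod_cast hN
  have h4 : (0 : ℝ) < m := by exact_mod_cast hm
  have h5 : (0 : ℝ) < n := by exact_mod_cast hn
  rw [Real.div_rpow (Nat.cast_nonneg h) h1.le, Real.div_rpow h2.le h4.le,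
    Real.div_rpow h3.le h5.le]
  have a1 : 0 < (H : ℝ) ^ α := by positivity
  have a2 : 0 < (M : ℝ) ^ β := by positivity
  have a3 : 0 < (N : ℝ) ^ γ := by positivity
  have a4 : 0 < (m : ℝ) ^ β := by positivity
  have a5 : 0 < (n : ℝ) ^ γ := by positivity
  generalize (H : ℝ) ^ α = p1 at *
  generalize (M : ℝ) ^ β = p2 at *
  generalize (N : ℝ) ^ γ = p3 at *
  generalize (m : ℝ) ^ β = p4 at *
  generalize (n : ℝ) ^ γ = p5 at *
  have a6 : 1 + δ / (p2 * p3) * (p2 / p4) * (p3 / p5) = (p4 * p5 + δ) / (p4 * p5) := by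
    field_simp
  rw [a6]
  have a7 : 0 < p4 * p5 + δ := by positivity
  field_simp

theorem norm_perturbedSum_le {α β γ δ X : ℝ} {a : ℕ → ℕ → ℂ} {b : ℕ → ℂ} {H M N : ℕ}
    (ha : ∀ h ∈ Finset.Ioc H (2 * H), ∀ m ∈ Finset.Ioc M (2 * M), ‖a h m‖ ≤ 1)
    (hb : ∀ n ∈ Finset.Ioc N (2 * N), ‖b n‖ ≤ 1) :
    ‖perturbedSum α β γ δ X a b H M N‖ ≤ (H : ℝ) * M * N := by
  have hc : ∀ N : ℕ, ((Finset.Ioc N (2 * N)).card : ℝ) = N := fun N => by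
    rw [Nat.card_Ioc, two_mul, Nat.add_sub_cancel]
  calc _ ≤ ∑ h ∈ Finset.Ioc H (2 * H), ∑ m ∈ Finset.Ioc M (2 * M), ∑ n ∈ Finset.Ioc N (2 * N),
        (1 : ℝ) := by
        refine norm_sum_le_of_le _ fun h hh => norm_sum_le_of_le _ fun m hm =>
          norm_sum_le_of_le _ fun n hn => ?_
        rw [norm_mul, norm_mul, norm_addExp, mul_one]
        exact mul_le_one₀ (ha h hh m hm) (norm_nonneg _) (hb n hn)
    _ = _ := by
        simp only [Finset.sum_const, nsmul_eq_mul, mul_one, hc]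
        ring

theorem theorem1p1 (α β γ : ℝ) (hα : 0 < α) (hβ : 0 < β) (hγ : 0 < γ) (ε : ℝ) (hε : 0 < ε) :
    ∃ C : ℝ, 0 < C ∧
      ∀ (H M N : ℕ), 0 < H → 0 < M → 0 < N →
      ∀ (a : ℕ → ℕ → ℂ) (b : ℕ → ℂ),
        (∀ h ∈ Finset.Ioc H (2 * H), ∀ m ∈ Finset.Ioc M (2 * M), ‖a h m‖ ≤ 1) →
        (∀ n ∈ Finset.Ioc N (2 * N), ‖b n‖ ≤ 1) →
      ∀ (X δ K : ℝ), 1 < X → 0 < δ → 1 ≤ K →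
        X ≤ (8 * δ)⁻¹ * K * (M : ℝ) ^ β * (N : ℝ) ^ γ →
        ‖perturbedSum α β γ δ X a b H M N‖ ≤
          C * ((H : ℝ) * (M : ℝ) * (N : ℝ)) ^ (1 + ε) *
            ((K * X / ((H : ℝ) * (M : ℝ) * (N : ℝ) ^ (2 : ℕ))) ^ (1 / 4 : ℝ)
              + (K ^ (2 : ℕ) / ((H : ℝ) * (M : ℝ))) ^ (1 / 4 : ℝ)
              + (K / (N : ℝ)) ^ (1 / 2 : ℝ)
              + K / X ^ (1 / 2 : ℝ)) := by
  obtain ⟨C1, hC1, hmain⟩ := exists_cell_sum_le hα hβ hγ hε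
  obtain ⟨C2, hC2, hmult⟩ := exists_isMultiplier_perturbed_phase (Z := 2 ^ α) (by positivity)
  refine ⟨1 + C2 * C1, by positivity, ?_⟩
  intro H M N hH hM hN a b ha hb X δ K hX hδ hK hXK
  have H1 : (1 : ℝ) ≤ H := by exact_mod_cast hH
  have M1 : (1 : ℝ) ≤ M := by exact_mod_cast hM
  have N1 : (1 : ℝ) ≤ N := by exact_mod_cast hN
  have K0 : 0 < K := by linarith
  have X0 : 0 < X := by linarith
  set Y : ℝ := (H : ℝ) * M * N with hY
  have Y1 : 1 ≤ Y :=
    one_le_mul_of_one_le_of_one_le (one_le_mul_of_one_le_of_one_le H1 M1) N1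
  have Y0 : 0 < Y := by linarith
  set r1 : ℝ := (K * X / ((H : ℝ) * (M : ℝ) * (N : ℝ) ^ (2 : ℕ))) ^ (1 / 4 : ℝ) with hr1
  set r2 : ℝ := (K ^ (2 : ℕ) / ((H : ℝ) * (M : ℝ))) ^ (1 / 4 : ℝ) with hr2
  set r3 : ℝ := (K / (N : ℝ)) ^ (1 / 2 : ℝ) with hr3
  have r10 : 0 ≤ r1 := by positivity
  have r20 : 0 ≤ r2 := by positivity
  have r30 : 0 ≤ r3 := by positivity
  -- When `K ≥ X^(1/2)` the last term is at least `1` and the trivial bound is enough. Otherwise `K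
  -- ≤ X`, which the cell estimates require.
  rcases le_total (X ^ (1 / 2 : ℝ)) K with htriv | hKX
  · have h4 : 1 ≤ K / X ^ (1 / 2 : ℝ) := (one_le_div (by positivity)).2 htriv
    have hYε : Y ≤ Y ^ (1 + ε) := by
      calc Y = Y ^ (1 : ℝ) := (Real.rpow_one Y).symm
        _ ≤ _ := Real.rpow_le_rpow_of_exponent_le Y1 (by linarith)
    calc _ ≤ Y := norm_perturbedSum_le ha hb
      _ = 1 * Y * 1 := by ring
      _ ≤ _ := by
        gcongr
        · have : 0 < C2 * C1 := by positivity
          linarith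
        · linarith
  have hKX' : K ≤ X := hKX.trans (by
    calc X ^ (1 / 2 : ℝ) ≤ X ^ (1 : ℝ) :=
          Real.rpow_le_rpow_of_exponent_le hX.le (by norm_num)
      _ = X := Real.rpow_one X)
  set s := Finset.Ioc H (2 * H) ×ˢ Finset.Ioc M (2 * M) with hs
  set t := Finset.Ioc N (2 * N) with ht
  set z : ℕ × ℕ → ℝ := fun u => (u.1 / H : ℝ) ^ α with hz
  set w : ℕ × ℕ → ℝ := fun u => (M / u.2 : ℝ) ^ β with hw
  set v : ℕ → ℝ := fun n => (N / n : ℝ) ^ γ with hv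
  set D : ℝ := (M : ℝ) ^ β * (N : ℝ) ^ γ with hD
  have hD0 : 0 < D := by positivity
  set σ : ℝ := δ / D with hσ
  -- `G` is the part of the phase that is not linear in `y = (N/n)^γ`.
  set G : ℕ × ℕ → ℝ → ℝ := fun u y => X * z u * w u * y / (1 + σ * w u * y) - X * z u * w u * y
    with hG
  rw [mul_assoc ((8 * δ)⁻¹ * K), ← hD] at hXK
  have hw01 : ∀ u ∈ s, 0 ≤ w u ∧ w u ≤ 1 := by
    intro u hu
    rw [hs, Finset.mem_product, Finset.mem_Ioc, Finset.mem_Ioc] at hu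
    have h2 : (M : ℝ) ≤ u.2 := by exact_mod_cast hu.2.1.le
    exact ⟨by simp only [hw]; positivity,
      Real.rpow_le_one (by positivity) ((div_le_one (by linarith)).2 h2) hβ.le⟩
  have hv01 : ∀ n ∈ t, 0 ≤ v n ∧ v n ≤ 1 := by
    intro n hn
    rw [ht, Finset.mem_Ioc] at hn
    have : (N : ℝ) ≤ n := by exact_mod_cast hn.1.le
    exact ⟨by simp only [hv]; positivity,
      Real.rpow_le_one (by positivity) ((div_le_one (by linarith)).2 this) hγ.le⟩
  -- The comparison point is the left endpoint `⌊K v⌋ / K` of the cell, within `1/K` of `v`; the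
  -- bound on `X` becomes `8 σ X ≤ K`.
  have hM2 := hmult s t z w v (fun n => (⌊K * v n⌋₊ : ℝ) / K) X K σ K0 hKX' (by positivity) (by
      calc 8 * σ * X ≤ 8 * σ * ((8 * δ)⁻¹ * K * D) := by gcongr
        _ = K := by rw [hσ]; field_simp) (by
      intro u hu
      rw [hs, Finset.mem_product, Finset.mem_Ioc, Finset.mem_Ioc] at hu
      have h1 : (u.1 : ℝ) ≤ 2 * H := by exact_mod_cast hu.1.2
      have e0 : 0 ≤ z u := by simp only [hz]; positivity
      rw [abs_of_nonneg e0]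
      exact Real.rpow_le_rpow (by positivity) ((div_le_iff₀ (by linarith)).2 h1) hα.le)
    hw01 hv01 (by
      intro n hn
      refine ⟨by positivity, (div_le_one K0).2 ?_⟩
      exact (Nat.floor_le (mul_nonneg K0.le (hv01 n hn).1)).trans
        (mul_le_of_le_one_right K0.le (hv01 n hn).2)) (by
      intro n hn
      have := abs_mul_sub_floor_le K0.le (hv01 n hn).1
      calc _ = |K * v n - (⌊K * v n⌋₊ : ℝ)| := by
            rw [← abs_of_pos K0, ← abs_mul, abs_of_pos K0, mul_sub, mul_div_cancel₀ _ K0.ne']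
        _ ≤ 1 := this)
  have hB := hmain H M N (fun i u => addExp (G u (i / K))) X K hH hM hN hK hKX'
    (fun i u => (norm_addExp _).le)
  have hfin := hM2 _ _ hB (fun u => a u.1 u.2) b (by
    intro u hu
    rw [hs, Finset.mem_product] at hu
    exact ha _ hu.1 _ hu.2) hb
  -- The phase is split into the variation of `G` within the cell, which is a multiplier, the value
  -- of `G` at the endpoint, which is a cell-dependent weight, and the bilinear phase.
  have heq : perturbedSum α β γ δ X a b H M N = ∑ u ∈ s, ∑ n ∈ t, a u.1 u.2 * b n *
      (addExp (G u (v n) - G u (⌊K * v n⌋₊ / K)) *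
        (addExp (G u (⌊K * v n⌋₊ / K)) * addExp (X * (z u * w u) * v n))) := by
    rw [perturbedSum, hs, Finset.sum_product]
    refine Finset.sum_congr rfl fun h hh => Finset.sum_congr rfl fun m hm =>
      Finset.sum_congr rfl fun n hn => ?_
    rw [Finset.mem_Ioc] at hm
    rw [ht, Finset.mem_Ioc] at hn
    rw [← addExp_add, ← addExp_add, perturbed_phase_eq hH hM hN (by omega) (by omega) hδ]
    congr 2
    simp only [hG]
    ring
  rw [heq]
  refine hfin.trans ?_
  rw [← mul_assoc, ← mul_assoc]
  gcongr
  linarith
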